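/- Let $\kappa\in\mathbb R$ and consider on $x\in\mathbb R$ the nonlinear Schrödinger (NLS) equation $iu_t+u_{xx}+\kappa|u|^2u=0$ with the splitting $u_t=f+g$, $f(u)=i\kappa|u|^2u$, $g(u)=iu_{xx}$, and, for $\tau>0$, its hyperbolic approximation (NLSH) for $Q=(q_0,q_1)$ with the splitting $$Q_t=f(Q)+g(Q),\qquad f(Q)=\begin{pmatrix} i\kappa|q_0|^2q_0\\0\end{pmatrix},\qquad g(Q)=\begin{pmatrix} i\,\partial_xq_1\\-i\tau^{-1}(\partial_xq_0-q_1)\end{pmatrix}.$$ An ImEx Runge–Kutta method with $s\ge 1$ stages is given by real coefficients $\tilde A=(\tilde a_{ij})$ (strictly lower triangular), $A=(a_{ij})$ (lower triangular), $\tilde b$, $b$; a step of size $\Delta t$ for $Q_t=f(Q)+g(Q)$ is $$Q^{(i)}=Q^n+\Delta t\sum_j\big(\tilde a_{ij}f(Q^{(j)})+a_{ij}g(Q^{(j)})\big),\qquad Q^{n+1}=Q^n+\Delta t\sum_j\big(\tilde b_jf(Q^{(j)})+b_jg(Q^{(j)})\big).$$ It is of type II (CK) if the first rows of $\tilde A$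 and $A$ vanish and the matrix $\hat A$ obtained from $A$ by deleting the first row and column is invertible; it is globally stiffly accurate (GSA) if $\tilde a_{si}=\tilde b_i$ and $a_{si}=b_i$ for all $i$; it has order $p$ if for every smooth split system of ordinary differential equations $y'=f(y)+g(y)$ the error after one step is $O(\Delta t^{p+1})$. Let $R(z)=1+z\,b^T(I-zA)^{-1}e$, $e=(1,\dots,1)^T$, be the stability function of the implicit part. Space is not discretized, and all functions, including the stages, are taken in $H^\infty(\mathbb R;\mathbb C)$, the smooth functions whose derivatives of all orders are square integrable; limits and $O(\cdot)$ for functions of $x$ are meant in every Sobolev norm $H^k(\mathbb R)$, $k=0,1,2,\dots$. **Theorem.** Consider a GSA ImEx Runge–Kutta method of type II and of order $p\ge1$. Let $u^0\in H^\infty$, and let $q_0^0,q_1^0\in H^\infty$ be initial data, depending on $\tau>0$, that are well-prepared: $q_0^0=u^0+O(\tau)$ and $q_1^0=u^0_x+O(\tau)$ as $\tau\to0$. For all $\Delta t,\tau>0$ the method determines unique numerical solutions: $(u^n)_{n\ge0}$ of NLS from $u^0$, and $(q_0^n,q_1^n)_{n\ge0}$ of NLSH from $(q_0^0,q_1^0)$.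 1. The method is asymptotic preserving for both components: for every fixed $\Delta t>0$ and every $n$, $q_0^{n}\to u^{n}$ and $q_1^{n}\to u^{n}_x$ as $\tau\to0$. 2. Let $T>0$, let $u\in C([0,T];H^\infty)$ be a solution of NLS with $u(0)=u^0$, and put $t_n=n\Delta t$. In the stiff limit, as $\Delta t\to 0$, $$q_0^{n}-u(t_{n})=O(\Delta t^p),\qquad q_1^{n}-u_x(t_{n})=O(\Delta t^p)$$ in the following two senses. Here "in the stiff limit" means that, for given $\Delta t$ and $n$, the bound holds for all sufficiently small $\tau>0$, with a constant independent of $\Delta t$ and $\tau$. (a) For each fixed number of steps $n$; in this case even with $O(\Delta t^{p+1})$ in place of $O(\Delta t^p)$. (b) If the limiting scheme is linearly stable, that is $|R(iy)|\le1$ for all $y\in\mathbb R$, then uniformly in all $n$ with $t_n\le T$: the constant is also independent of $n$. -/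

import Mathlib

open scoped ContDiff Topology
open Filter

/-- An implicit-explicit Runge-Kutta method with `s` stages: a strictly lower triangular explicit
part `(Aex, bex)` and a lower triangular (diagonally implicit) part `(Aim, bim)`. The abscissae are
not recorded, since all systems considered are autonomous. -/
structure ImExRK (s : ℕ) where
  Aex : Matrix (Fin s) (Fin s) ℝ
  bex : Fin s → ℝ
  Aim : Matrix (Fin s) (Fin s) ℝ
  bim : Fin s → ℝ
  Aex_strict : ∀ i j, i ≤ j → Aex i j = 0
  Aim_lower : ∀ i j, i < j → Aim i j = 0

/-- One step `Q ↦ Q'` of size `h`, with stages `S`, for the split system `Q_t = f Q + g Q`;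
`f` is treated explicitly and `g` implicitly. -/
def ImExRK.IsStep {s : ℕ} {E : Type*} [AddCommGroup E] [Module ℝ E] (M : ImExRK s)
    (f g : E → E) (h : ℝ) (Q : E) (S : Fin s → E) (Q' : E) : Prop :=
  (∀ i, S i = Q + h • (∑ j, M.Aex i j • f (S j) + ∑ j, M.Aim i j • g (S j))) ∧
    Q' = Q + h • (∑ j, M.bex j • f (S j) + ∑ j, M.bim j • g (S j))

/-- A sequence of numerical approximations with constant step `h`; all approximations and all
stages are required to lie in the admissible set `D`. -/
def ImExRK.IsNumericalSolution {s : ℕ} {E : Type*} [AddCommGroup E] [Module ℝ E] (M : ImExRK s)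
    (D : Set E) (f g : E → E) (h : ℝ) (Q : ℕ → E) : Prop :=
  (∀ n, Q n ∈ D) ∧
    ∀ n, ∃ S : Fin s → E, (∀ i, S i ∈ D) ∧ M.IsStep f g h (Q n) S (Q (n + 1))

/-- Type II (type CK): the first row of both coefficient matrices vanishes, and the implicit matrix
with its first row and first column removed is invertible. -/
def ImExRK.IsTypeII {m : ℕ} (M : ImExRK (m + 1)) : Prop :=
  (∀ j, M.Aex 0 j = 0) ∧ (∀ j, M.Aim 0 j = 0) ∧ IsUnit (M.Aim.submatrix Fin.succ Fin.succ)

/-- Globally stiffly accurate: the weights are the last rows of the coefficient matrices. -/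
def ImExRK.IsGSA {m : ℕ} (M : ImExRK (m + 1)) : Prop :=
  (∀ i, M.Aex (Fin.last m) i = M.bex i) ∧ ∀ i, M.Aim (Fin.last m) i = M.bim i

/-- Order (at least) `p`: for all smooth split ordinary differential equations `y' = f y + g y` the
error after one step of size `h` is `O(h ^ (p + 1))`. As the stages are defined implicitly, the
relevant solution of the stage equations is the one that tends to the initial value as `h → 0`. -/
def ImExRK.HasOrder {s : ℕ} (M : ImExRK s) (p : ℕ) : Prop :=
  ∀ (d : ℕ) (f g : (Fin d → ℝ) → (Fin d → ℝ)), ContDiff ℝ ∞ f → ContDiff ℝ ∞ g →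
    ∀ y : ℝ → (Fin d → ℝ), (∀ᶠ t in 𝓝 0, HasDerivAt y (f (y t) + g (y t)) t) →
      ∀ (S : ℝ → Fin s → (Fin d → ℝ)) (y₁ : ℝ → (Fin d → ℝ)),
        (∀ᶠ h in 𝓝[>] 0, M.IsStep f g h (y 0) (S h) (y₁ h)) →
        (∀ i, Tendsto (fun h => S h i) (𝓝[>] 0) (𝓝 (y 0))) →
        (fun h => y₁ h - y h) =O[𝓝[>] 0] fun h => h ^ (p + 1)

/-- The stability function `R z = 1 + z bᵀ (I - z A)⁻¹ e` of the implicit part. -/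
noncomputable def ImExRK.stabilityFunction {s : ℕ} (M : ImExRK s) (z : ℂ) : ℂ :=
  1 + z * ((fun i => (M.bim i : ℂ)) ⬝ᵥ
    ((1 - z • M.Aim.map (fun a : ℝ => (a : ℂ)))⁻¹.mulVec fun _ => 1))

/-- The space `H^∞(ℝ; ℂ)`: smooth functions all of whose derivatives are square integrable. -/
def HInfty : Set (ℝ → ℂ) :=
  {f | ContDiff ℝ ∞ f ∧ ∀ k, MeasureTheory.MemLp (iteratedDeriv k f) 2 MeasureTheory.volume}

/-- The Sobolev norm of `H^k(ℝ; ℂ)` (used for elements of `HInfty` only). -/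
noncomputable def sobolevNorm (k : ℕ) (f : ℝ → ℂ) : ℝ :=
  Real.sqrt (∑ j ∈ Finset.range (k + 1), ∫ x, ‖iteratedDeriv j f x‖ ^ 2)

/-- States `(q₀, q₁)` of the hyperbolized system. -/
abbrev NLSHState : Type := (ℝ → ℂ) × (ℝ → ℂ)

/-- The explicit part `i κ |u|² u` of the NLS equation. -/
noncomputable def nlsF (κ : ℝ) (u : ℝ → ℂ) : ℝ → ℂ :=
  fun x => Complex.I * κ * (‖u x‖ : ℂ) ^ 2 * u x

/-- The implicit part `i u_xx` of the NLS equation. -/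
noncomputable def nlsG (u : ℝ → ℂ) : ℝ → ℂ :=
  fun x => Complex.I * deriv (deriv u) x

/-- The explicit part `(i κ |q₀|² q₀, 0)` of the hyperbolized system. -/
noncomputable def nlshF (κ : ℝ) (Q : NLSHState) : NLSHState :=
  (fun x => Complex.I * κ * (‖Q.1 x‖ : ℂ) ^ 2 * Q.1 x, fun _ => 0)

/-- The implicit part `(i ∂ₓ q₁, -i τ⁻¹ (∂ₓ q₀ - q₁))` of the hyperbolized system. -/
noncomputable def nlshG (τ : ℝ) (Q : NLSHState) : NLSHState :=
  (fun x => Complex.I * deriv Q.2 x,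
    fun x => -Complex.I * (τ : ℂ)⁻¹ * (deriv Q.1 x - Q.2 x))

/-- `v` is the sequence computed by the method for the split NLS equation from `u₀`. -/
def IsNLSApprox {s : ℕ} (M : ImExRK s) (κ h : ℝ) (u₀ : ℝ → ℂ) (v : ℕ → ℝ → ℂ) : Prop :=
  M.IsNumericalSolution HInfty (nlsF κ) nlsG h v ∧ v 0 = u₀

/-- `q` is the sequence computed by the method for the split hyperbolized system from `Q₀`. -/
def IsNLSHApprox {s : ℕ} (M : ImExRK s) (κ τ h : ℝ) (Q₀ : NLSHState) (q : ℕ → NLSHState) : Prop :=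
  M.IsNumericalSolution (HInfty ×ˢ HInfty) (nlshF κ) (nlshG τ) h q ∧ q 0 = Q₀

/-- Well-prepared initial data: `q₀⁰ = u⁰ + O(τ)` and `q₁⁰ = u⁰_x + O(τ)` as `τ → 0`, in every
Sobolev norm. -/
def IsWellPrepared (u₀ : ℝ → ℂ) (Q₀ : ℝ → NLSHState) : Prop :=
  (∀ τ > 0, Q₀ τ ∈ HInfty ×ˢ HInfty) ∧ ∀ k,
    ((fun τ => sobolevNorm k ((Q₀ τ).1 - u₀)) =O[𝓝[>] 0] fun τ => τ) ∧
    ((fun τ => sobolevNorm k ((Q₀ τ).2 - deriv u₀)) =O[𝓝[>] 0] fun τ => τ)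

/-- `u` is a solution in `C([0, T]; H^∞)` of `i u_t + u_xx + κ |u|² u = 0`. -/
def IsNLSSolution (κ T : ℝ) (u : ℝ → ℝ → ℂ) : Prop :=
  (∀ t ∈ Set.Icc 0 T, u t ∈ HInfty) ∧
  (∀ k, ∀ t ∈ Set.Icc 0 T,
    Tendsto (fun r => sobolevNorm k (u r - u t)) (𝓝[Set.Icc 0 T] t) (𝓝 0)) ∧
  ∀ t ∈ Set.Icc 0 T, ∀ x, ∃ ut : ℂ,
    HasDerivWithinAt (fun r => u r x) ut (Set.Icc 0 T) t ∧
    Complex.I * ut + deriv (deriv (u t)) x + κ * (‖u t x‖ : ℂ) ^ 2 * u t x = 0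

/-- Asymptotic preservation with respect to `q₀`, for the numerical solutions `q h τ` started from
data with limit `u₀`: for every fixed step `h`, `q₀ⁿ → vⁿ` as `τ → 0`, where `v` is the numerical
solution of the NLS equation by the same method. -/
def IsAPq₀ {s : ℕ} (M : ImExRK s) (κ : ℝ) (u₀ : ℝ → ℂ) (q : ℝ → ℝ → ℕ → NLSHState) : Prop :=
  ∀ h > 0, ∀ v, IsNLSApprox M κ h u₀ v → ∀ n k,
    Tendsto (fun τ => sobolevNorm k ((q h τ n).1 - v n)) (𝓝[>] 0) (𝓝 0)

/-- Asymptotic preservation with respect to `q₁`: `q₁ⁿ → vⁿ_x` as `τ → 0`. -/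
def IsAPq₁ {s : ℕ} (M : ImExRK s) (κ : ℝ) (u₀ : ℝ → ℂ) (q : ℝ → ℝ → ℕ → NLSHState) : Prop :=
  ∀ h > 0, ∀ v, IsNLSApprox M κ h u₀ v → ∀ n k,
    Tendsto (fun τ => sobolevNorm k ((q h τ n).2 - deriv (v n))) (𝓝[>] 0) (𝓝 0)

/-! Three objects are compared: the solution of NLS, the method applied to NLS, and the method
applied to NLSH.

Stiff limit. In an implicit stage of NLSH with coefficient `c = h * M.Aim i i ≠ 0` the second
component can be eliminated (`sub_smul_hypL_eq_iff`). What remains is an equation `q₀ - μ ∂ₓ² q₀ =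
...` with `Re μ ≥ 0` and `μ = c i + O(τ)`. An energy estimate shows that the resolvent is a
contraction in every Sobolev norm for all such `μ`, hence uniformly in `τ`, so `q₀` is within `O(τ)`
of the NLS stage. The invariant carried through the computation is `IsRelaxed`: `q₀` is `O(τ)`-close
to its limit, and the defect `-i τ⁻¹ (∂ₓ q₀ - q₁)` stays bounded, which also makes `q₁` close to `∂ₓ
q₀`. Well-prepared data have this property, the trivial first stage of a type II method copies it,
the later stages reproduce it, and global stiff accuracy passes it to the next step because the
update is the last stage.

Local error for NLS. The operator `i ∂ₓ²` is unbounded, but on `H^∞` the loss of derivatives is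
harmless as long as all norms are treated at once. Both the stages and the exact solution have
Taylor polynomials in the step size with remainder `O(h ^ (p + 1))` (`stage_expansion`,
`exact_expansion`). The coefficients come from algebraic recursions in a trilinear and a linear map,
and only finitely many vectors occur up to index `p`. Compressing the maps to the span of these
vectors gives an ordinary differential equation with the same coefficients, so the order hypothesis
applies (`stageSeries_eq_exactSeries`).

Propagation. Invertibility of the implicit matrix without its first row and column bounds the linear
stages independently of `h` and without loss of derivatives (`p_linearStage_le`); hence a step is
Lipschitz on bounded sets, which suffices for a fixed number of steps. On a whole time interval the
Lipschitz constant must be `1 + C h`. Here `|R(iy)| ≤ 1` makes the linear step a contraction. This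
is proved without a Fourier transform: a real polynomial that is nonnegative on the line is a
squared modulus, so the inequality passes to polynomials in the symmetric operator `-h ∂ₓ²`
(`norm_aeval_negLap_le`). A discrete Gronwall argument then sums the local errors. Finally, for
given `h` and `n`, a small enough `τ` makes the relaxation error smaller than the power of `h` in
question. -/

/-! ### Estimates in all seminorms of a family -/

/-- `a = O(φ)` along the filter `l` with respect to every seminorm of the family `N`. -/
def TameBigO {E Ω : Type*} [AddCommGroup E] [Module ℝ E] (N : ℕ → Seminorm ℝ E) (l : Filter Ω)
    (a : Ω → E) (φ : Ω → ℝ) : Prop :=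
  ∀ k, (fun z => N k (a z)) =O[l] φ

namespace TameBigO

variable {E Ω : Type*} [AddCommGroup E] [Module ℝ E] {N : ℕ → Seminorm ℝ E} {l : Filter Ω}
  {a b : Ω → E} {φ ψ : Ω → ℝ}

theorem congr' (h : a =ᶠ[l] b) (ha : TameBigO N l a φ) : TameBigO N l b φ := fun k =>
  (ha k).congr' (h.mono fun z hz => by simp only [hz]) EventuallyEq.rfl

theorem zero : TameBigO N l (fun _ => (0 : E)) φ := fun k => by
  simpa using Asymptotics.isBigO_zero φ l

theorem add (ha : TameBigO N l a φ) (hb : TameBigO N l b φ) :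
    TameBigO N l (fun z => a z + b z) φ := fun k => by
  refine (Asymptotics.IsBigO.of_bound 1 (Eventually.of_forall fun z => ?_)).trans
    ((ha k).add (hb k))
  rw [one_mul, Real.norm_of_nonneg (apply_nonneg _ _),
    Real.norm_of_nonneg (add_nonneg (apply_nonneg _ _) (apply_nonneg _ _))]
  exact map_add_le_add _ _ _

theorem smul {c : Ω → ℝ} (hc : c =O[l] ψ) (ha : TameBigO N l a φ) :
    TameBigO N l (fun z => c z • a z) (fun z => ψ z * φ z) := fun k => by
  refine (hc.norm_left.mul (ha k)).congr_left fun z => ?_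
  rw [map_smul_eq_mul]

theorem const_smul (c : ℝ) (ha : TameBigO N l a φ) : TameBigO N l (fun z => c • a z) φ := fun k => by
  refine ((ha k).const_mul_left ‖c‖).congr_left fun z => ?_
  rw [map_smul_eq_mul]

theorem neg (ha : TameBigO N l a φ) : TameBigO N l (fun z => - a z) φ := fun k => by
  simpa using ha k

theorem sub (ha : TameBigO N l a φ) (hb : TameBigO N l b φ) :
    TameBigO N l (fun z => a z - b z) φ := by
  simpa only [sub_eq_add_neg] using ha.add hb.neg

theorem sum {ι : Type*} {s : Finset ι} {a : ι → Ω → E} (ha : ∀ i ∈ s, TameBigO N l (a i) φ) :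
    TameBigO N l (fun z => ∑ i ∈ s, a i z) φ := by
  classical
  induction s using Finset.induction_on with
  | empty => simpa using zero
  | insert i s hi ih =>
    simp only [Finset.sum_insert hi]
    exact (ha i (Finset.mem_insert_self _ _)).add
      (ih fun j hj => ha j (Finset.mem_insert_of_mem hj))

theorem trans (ha : TameBigO N l a φ) (h : φ =O[l] ψ) : TameBigO N l a ψ := fun k => (ha k).trans h

theorem comp_tendsto {Ω' : Type*} {l' : Filter Ω'} {m : Ω' → Ω} (ha : TameBigO N l a φ)
    (h : Tendsto m l' l) : TameBigO N l' (fun z => a (m z)) (fun z => φ (m z)) :=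
  fun k => (ha k).comp_tendsto h

end TameBigO

/-! ### Systems with a cubic and a linear part -/

/-- A map that is linear in each of its three arguments. -/
structure IsTrilinear {E : Type*} [AddCommGroup E] [Module ℝ E] (T : E → E → E → E) : Prop where
  left : ∀ b c, IsLinearMap ℝ fun a => T a b c
  mid : ∀ a c, IsLinearMap ℝ fun b => T a b c
  right : ∀ a b, IsLinearMap ℝ fun c => T a b c

namespace IsTrilinear

variable {E : Type*} [AddCommGroup E] [Module ℝ E] {T : E → E → E → E}

theorem sum_left (hT : IsTrilinear T) {ι : Type*} (s : Finset ι) (c : ι → ℝ) (v : ι → E) (b d : E) :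
    T (∑ i ∈ s, c i • v i) b d = ∑ i ∈ s, c i • T (v i) b d := by
  exact (map_sum (IsLinearMap.mk' _ (hT.left b d)) (fun i => c i • v i) s).trans
    (Finset.sum_congr rfl fun i _ => (hT.left b d).map_smul _ _)

theorem sum_mid (hT : IsTrilinear T) {ι : Type*} (s : Finset ι) (c : ι → ℝ) (v : ι → E) (a d : E) :
    T a (∑ i ∈ s, c i • v i) d = ∑ i ∈ s, c i • T a (v i) d := by
  exact (map_sum (IsLinearMap.mk' _ (hT.mid a d)) (fun i => c i • v i) s).trans
    (Finset.sum_congr rfl fun i _ => (hT.mid a d).map_smul _ _)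

theorem sum_right (hT : IsTrilinear T) {ι : Type*} (s : Finset ι) (c : ι → ℝ) (v : ι → E)
    (a b : E) : T a b (∑ i ∈ s, c i • v i) = ∑ i ∈ s, c i • T a b (v i) := by
  exact (map_sum (IsLinearMap.mk' _ (hT.right a b)) (fun i => c i • v i) s).trans
    (Finset.sum_congr rfl fun i _ => (hT.right a b).map_smul _ _)

theorem diag_sub_diag (hT : IsTrilinear T) (v w : E) :
    T v v v - T w w w = T (v - w) v v + T w (v - w) v + T w w (v - w) := by
  rw [(hT.left v v).map_sub, (hT.mid w v).map_sub, (hT.right w w).map_sub]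
  abel

end IsTrilinear

/-- The coefficient of `h ^ k` in `T W W W`, where `W = ∑ k ≤ p, h ^ k • V k`. -/
def cubicCoeff {E : Type*} [AddCommGroup E] (T : E → E → E → E) (p k : ℕ) (V : ℕ → E) : E :=
  ∑ a ∈ Finset.range (p + 1), ∑ b ∈ Finset.range (p + 1), ∑ c ∈ Finset.range (p + 1),
    if a + b + c = k then T (V a) (V b) (V c) else 0

theorem cubicCoeff_congr {E : Type*} [AddCommGroup E] (T : E → E → E → E) {p k : ℕ} {V V' : ℕ → E}
    (h : ∀ j ≤ k, V j = V' j) : cubicCoeff T p k V = cubicCoeff T p k V' := by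
  refine Finset.sum_congr rfl fun a _ => Finset.sum_congr rfl fun b _ => Finset.sum_congr rfl
    fun c _ => ?_
  split_ifs with habc
  · rw [h a (by omega), h b (by omega), h c (by omega)]
  · rfl

theorem IsTrilinear.diag_sum {E : Type*} [AddCommGroup E] [Module ℝ E] {T : E → E → E → E}
    (hT : IsTrilinear T) (p : ℕ) (V : ℕ → E) (h : ℝ) :
    T (∑ k ∈ Finset.range (p + 1), h ^ k • V k) (∑ k ∈ Finset.range (p + 1), h ^ k • V k)
      (∑ k ∈ Finset.range (p + 1), h ^ k • V k) =
      ∑ k ∈ Finset.range (3 * p + 1), h ^ k • cubicCoeff T p k V := by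
  rw [hT.sum_left]
  simp_rw [hT.sum_mid, hT.sum_right, cubicCoeff, Finset.smul_sum]
  symm
  rw [Finset.sum_comm]
  refine Finset.sum_congr rfl fun a ha => ?_
  rw [Finset.sum_comm]
  refine Finset.sum_congr rfl fun b hb => ?_
  rw [Finset.sum_comm]
  refine Finset.sum_congr rfl fun c hc => ?_
  simp only [Finset.mem_range] at ha hb hc
  simp_rw [smul_ite, smul_zero]
  rw [Finset.sum_ite_eq, if_pos (Finset.mem_range.2 (by omega)), smul_smul, smul_smul]
  congr 1
  ring

/-- Separation of the diagonal term of a row of a lower triangular matrix. -/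
theorem ImExRK.sum_Aim_smul {s : ℕ} {E : Type*} [AddCommGroup E] [Module ℝ E] (M : ImExRK s)
    (i : Fin s) (x : Fin s → E) :
    ∑ j, M.Aim i j • x j = M.Aim i i • x i + ∑ j, (if j < i then M.Aim i j else 0) • x j := by
  have h : ∀ j, M.Aim i j • x j =
      (if j = i then M.Aim i i • x i else 0) + (if j < i then M.Aim i j else 0) • x j := by
    intro j
    rcases lt_trichotomy j i with h | rfl | h
    · simp [h, h.ne]
    · simp
    · simp [h.ne', not_lt.2 h.le, M.Aim_lower i j h]
  rw [Finset.sum_congr rfl fun j _ => h j, Finset.sum_add_distrib, Finset.sum_ite_eq' _ i]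
  simp

/-- A vector space with a family of seminorms, a trilinear map `T`, a linear map `g` and a family
`ev` of linear functionals, in terms of which curves are differentiated. It is the setting for the
evolution equation `y' = T y y y + g y`. -/
structure TameSystem (E X F : Type*) [AddCommGroup E] [Module ℝ E] [NormedAddCommGroup F]
    [NormedSpace ℝ F] where
  N : ℕ → Seminorm ℝ E
  T : E → E → E → E
  g : E →ₗ[ℝ] E
  ev : X → E →ₗ[ℝ] F
  trilinear : IsTrilinear T
  T_le : ∀ k, ∃ C l, ∀ a b c, N k (T a b c) ≤ C * (N l a * N l b * N l c)
  g_le : ∀ k, ∃ C l, ∀ a, N k (g a) ≤ C * N l a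
  -- Only small `c` is required, so that every linear map on `ℝ ^ d` qualifies as well as `i ∂ₓ²`.
  resolvent_le : ∃ r : ℝ, 0 < r ∧ ∀ k, ∃ C, ∀ c, |c| ≤ r → ∀ a, N k a ≤ C * N k (a - c • g a)
  -- Differentiability is only tested through `ev`. Boundedness of `d` in all seminorms is a
  -- qualitative assumption and does not enter the constant.
  mean_value : ∀ k, ∃ C, ∀ s ≥ 0, ∀ e d : ℝ → E,
    (∀ x, ∀ r ∈ Set.Icc 0 s,
      HasDerivWithinAt (fun r => ev x (e r)) (ev x (d r)) (Set.Icc 0 s) r) → e 0 = 0 →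
    (∀ j, ∃ B, ∀ r ∈ Set.Icc 0 s, N j (d r) ≤ B) →
    ∀ B, (∀ r ∈ Set.Icc 0 s, N k (d r) ≤ B) → N k (e s) ≤ C * s * B

namespace TameSystem

variable {E X F : Type*} [AddCommGroup E] [Module ℝ E] [NormedAddCommGroup F] [NormedSpace ℝ F]
  (Y : TameSystem E X F) {Ω : Type*} {l : Filter Ω}

/-- The cubic part of the vector field. -/
def f (v : E) : E := Y.T v v v

theorem tameBigO_T {a b c : Ω → E} {φ₁ φ₂ φ₃ : Ω → ℝ} (ha : TameBigO Y.N l a φ₁)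
    (hb : TameBigO Y.N l b φ₂) (hc : TameBigO Y.N l c φ₃) :
    TameBigO Y.N l (fun z => Y.T (a z) (b z) (c z)) (fun z => φ₁ z * φ₂ z * φ₃ z) := fun k => by
  obtain ⟨C, j, hC⟩ := Y.T_le k
  refine (Asymptotics.IsBigO.of_bound C (Eventually.of_forall fun z => ?_)).trans
    (((ha j).mul (hb j)).mul (hc j))
  rw [Real.norm_of_nonneg (apply_nonneg _ _), Real.norm_of_nonneg (by positivity)]
  exact hC _ _ _

theorem tameBigO_g {a : Ω → E} {φ : Ω → ℝ} (ha : TameBigO Y.N l a φ) :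
    TameBigO Y.N l (fun z => Y.g (a z)) φ := fun k => by
  obtain ⟨C, j, hC⟩ := Y.g_le k
  refine (Asymptotics.IsBigO.of_bound C (Eventually.of_forall fun z => ?_)).trans (ha j)
  rw [Real.norm_of_nonneg (apply_nonneg _ _), Real.norm_of_nonneg (by positivity)]
  exact hC _

theorem tameBigO_f_sub {a b : Ω → E} {φ : Ω → ℝ} (hab : TameBigO Y.N l (fun z => a z - b z) φ)
    (ha : TameBigO Y.N l a fun _ => 1) (hb : TameBigO Y.N l b fun _ => 1) :
    TameBigO Y.N l (fun z => Y.f (a z) - Y.f (b z)) φ := by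
  have h1 := Y.tameBigO_T hab ha ha
  have h2 := Y.tameBigO_T hb hab ha
  have h3 := Y.tameBigO_T hb hb hab
  simp only [mul_one, one_mul] at h1 h2 h3
  exact ((h1.add h2).add h3).congr' (Eventually.of_forall fun z =>
    (Y.trilinear.diag_sub_diag _ _).symm)

theorem tameBigO_cubicCoeff {V : Ω → ℕ → E} {p k : ℕ}
    (hV : ∀ j ≤ k, TameBigO Y.N l (fun z => V z j) fun _ => 1) :
    TameBigO Y.N l (fun z => cubicCoeff Y.T p k (V z)) fun _ => 1 := by
  refine TameBigO.sum fun a _ => TameBigO.sum fun b _ => TameBigO.sum fun c _ => ?_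
  by_cases h : a + b + c = k
  · simpa only [h, if_true, mul_one] using
      Y.tameBigO_T (hV a (by omega)) (hV b (by omega)) (hV c (by omega))
  · simpa only [h, if_false] using TameBigO.zero

/-- Truncated power series. -/
def trunc (p : ℕ) (V : ℕ → E) (h : ℝ) : E := ∑ k ∈ Finset.range (p + 1), h ^ k • V k

theorem tameBigO_trunc {p : ℕ} {V : Ω → ℕ → E} {h : Ω → ℝ} (hh : h =O[l] fun _ => (1 : ℝ))
    (hV : ∀ k ≤ p, TameBigO Y.N l (fun z => V z k) fun _ => 1) :
    TameBigO Y.N l (fun z => trunc p (V z) (h z)) fun _ => 1 := by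
  refine TameBigO.sum fun k hk => ?_
  have := TameBigO.smul (hh.pow k) (hV k (by simpa [Nat.lt_succ_iff] using hk))
  simpa using this

theorem isBigO_pow_of_le {h : Ω → ℝ} (hh : h =O[l] fun _ => (1 : ℝ)) {p k : ℕ} (hpk : p ≤ k) :
    (fun z => h z ^ k) =O[l] fun z => h z ^ p := by
  obtain ⟨j, rfl⟩ := Nat.exists_eq_add_of_le hpk
  have := (Asymptotics.isBigO_refl (fun z => h z ^ p) l).mul (hh.pow j)
  simpa [pow_add] using this

/-- The split at degree `p` separates the coefficients that cancel by the recursion for the series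
from a remainder `O(h ^ p)`, to which the step size or an integration adds one more power. -/
theorem f_trunc (p : ℕ) (V : ℕ → E) (h : ℝ) :
    Y.f (trunc p V h) = ∑ k ∈ Finset.range p, h ^ k • cubicCoeff Y.T p k V +
      ∑ k ∈ Finset.Ico p (3 * p + 1), h ^ k • cubicCoeff Y.T p k V := by
  rw [f, trunc, Y.trilinear.diag_sum, Finset.sum_range_add_sum_Ico _ (by omega)]

theorem g_trunc (p : ℕ) (V : ℕ → E) (h : ℝ) :
    Y.g (trunc p V h) = ∑ k ∈ Finset.range p, h ^ k • Y.g (V k) + h ^ p • Y.g (V p) := by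
  rw [trunc, map_sum, Finset.sum_range_succ]
  simp

theorem tameBigO_tail {p : ℕ} {V : Ω → ℕ → E} {h : Ω → ℝ} (hh : h =O[l] fun _ => (1 : ℝ))
    (hV : ∀ k, TameBigO Y.N l (fun z => V z k) fun _ => 1) :
    TameBigO Y.N l (fun z => ∑ k ∈ Finset.Ico p (3 * p + 1),
      h z ^ k • cubicCoeff Y.T p k (V z)) fun z => h z ^ p := by
  refine TameBigO.sum fun k hk => ?_
  have := TameBigO.smul (isBigO_pow_of_le hh (Finset.mem_Ico.1 hk).1)
    (Y.tameBigO_cubicCoeff (p := p) (k := k) fun j _ => hV j)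
  simpa using this

/-! ### Power series of the stages and of the exact solution -/

/-- `V i` is the sequence of Taylor coefficients of the `i`-th stage started from `u`. -/
def IsStageSeries {s : ℕ} (M : ImExRK s) (p : ℕ) (u : E) (V : Fin s → ℕ → E) : Prop :=
  ∀ i, V i 0 = u ∧ ∀ k, V i (k + 1) =
    ∑ j, M.Aex i j • cubicCoeff Y.T p k (V j) + ∑ j, M.Aim i j • Y.g (V j k)

/-- `U` is the sequence of Taylor coefficients of the exact solution started from `u`. -/
def IsExactSeries (p : ℕ) (u : E) (U : ℕ → E) : Prop :=
  U 0 = u ∧ ∀ k : ℕ, ((k : ℝ) + 1) • U (k + 1) = cubicCoeff Y.T p k U + Y.g (U k)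

/-- Recursive definition of a sequence in which every term depends on all earlier ones. -/
theorem exists_seq_of_rec {A : Type*} (Ψ : ℕ → (ℕ → A) → A)
    (hΨ : ∀ k V V', (∀ j ≤ k, V j = V' j) → Ψ k V = Ψ k V') (u : A) :
    ∃ V : ℕ → A, V 0 = u ∧ ∀ k, V (k + 1) = Ψ k V := by
  -- `W n` arises by applying the recursion `n` times to a constant sequence. Its entries up to
  -- index `n` no longer change afterwards, so the diagonal is the desired sequence.
  let W : ℕ → ℕ → A := fun n => n.rec (fun _ => u) fun _ W k => k.casesOn u fun k => Ψ k W
  have hW : ∀ k n, k ≤ n → W n k = W k k := by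
    intro k
    induction k using Nat.strong_induction_on with
    | _ k ih =>
      rintro (_ | n) hk
      · obtain rfl : k = 0 := by omega
        rfl
      · rcases k with _ | k
        · rfl
        · change Ψ k (W n) = Ψ k (W k)
          refine hΨ _ _ _ fun j hj => ?_
          rw [ih j (by omega) n (by omega), ih j (by omega) k hj]
  refine ⟨fun k => W k k, rfl, fun k => ?_⟩
  exact hΨ _ _ _ fun j hj => (hW _ _ hj)

theorem exists_isStageSeries {s : ℕ} (M : ImExRK s) (p : ℕ) (u : E) :
    ∃ V, Y.IsStageSeries M p u V := by
  obtain ⟨V, hV0, hV⟩ := exists_seq_of_rec (A := Fin s → E)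
    (fun k V i => ∑ j, M.Aex i j • cubicCoeff Y.T p k (fun n => V n j) +
      ∑ j, M.Aim i j • Y.g (V k j))
    (fun k V V' h => by
      funext i
      rw [h k le_rfl]
      congr 1
      refine Finset.sum_congr rfl fun j _ => ?_
      rw [cubicCoeff_congr _ fun n hn => congrFun (h n hn) j]) (fun _ => u)
  exact ⟨fun i k => V k i, fun i => ⟨by simp only [hV0], fun k => by simp only [hV]⟩⟩

theorem exists_isExactSeries (p : ℕ) (u : E) : ∃ U, Y.IsExactSeries p u U := by
  obtain ⟨U, hU0, hU⟩ := exists_seq_of_rec (A := E)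
    (fun k U => ((k : ℝ) + 1)⁻¹ • (cubicCoeff Y.T p k U + Y.g (U k)))
    (fun k V V' h => by rw [h k le_rfl, cubicCoeff_congr _ h]) u
  refine ⟨U, hU0, fun k => ?_⟩
  rw [hU, smul_inv_smul₀ (by positivity)]

/-- Each coefficient is a fixed polynomial expression in `u`, formed with `T` and `g`. It may cost
derivatives, but `u` is bounded in all seminorms. -/
theorem tameBigO_stageSeries {s : ℕ} {M : ImExRK s} {p : ℕ} {u : Ω → E}
    (hu : TameBigO Y.N l u fun _ => 1) {V : Ω → Fin s → ℕ → E}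
    (hV : ∀ z, Y.IsStageSeries M p (u z) (V z)) (i : Fin s) (k : ℕ) :
    TameBigO Y.N l (fun z => V z i k) fun _ => 1 := by
  induction k using Nat.strong_induction_on generalizing i with
  | _ k ih =>
    rcases k with _ | k
    · simpa only [(hV _ i).1] using hu
    · simp only [(hV _ i).2]
      exact (TameBigO.sum fun j _ => (Y.tameBigO_cubicCoeff fun n hn =>
        ih n (by omega) j).const_smul _).add
          (TameBigO.sum fun j _ => (Y.tameBigO_g (ih k (by omega) j)).const_smul _)

theorem tameBigO_exactSeries {p : ℕ} {u : Ω → E} (hu : TameBigO Y.N l u fun _ => 1)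
    {U : Ω → ℕ → E} (hU : ∀ z, Y.IsExactSeries p (u z) (U z)) (k : ℕ) :
    TameBigO Y.N l (fun z => U z k) fun _ => 1 := by
  induction k using Nat.strong_induction_on with
  | _ k ih =>
    rcases k with _ | k
    · simpa only [(hU _).1] using hu
    · have h : ∀ z, U z (k + 1) = ((k : ℝ) + 1)⁻¹ • (cubicCoeff Y.T p k (U z) + Y.g (U z k)) := by
        intro z
        rw [← (hU z).2, inv_smul_smul₀ (by positivity)]
      simp only [h]
      exact ((Y.tameBigO_cubicCoeff fun n hn => ih n (by omega)).add
        (Y.tameBigO_g (ih k (by omega)))).const_smul _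

/-- The residual of the truncated series in the stage equations. -/
theorem stage_residual {s : ℕ} {M : ImExRK s} {p : ℕ} {u : E} {V : Fin s → ℕ → E}
    (hV : Y.IsStageSeries M p u V) (h : ℝ) (i : Fin s) :
    u + h • (∑ j, M.Aex i j • Y.f (trunc p (V j) h) + ∑ j, M.Aim i j • Y.g (trunc p (V j) h)) -
      trunc p (V i) h = h • (∑ j, M.Aex i j • (∑ k ∈ Finset.Ico p (3 * p + 1),
        h ^ k • cubicCoeff Y.T p k (V j)) + ∑ j, M.Aim i j • (h ^ p • Y.g (V j p))) := by
  have h1 : trunc p (V i) h = u + h • (∑ j, M.Aex i j • (∑ k ∈ Finset.range p,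
      h ^ k • cubicCoeff Y.T p k (V j)) + ∑ j, M.Aim i j • ∑ k ∈ Finset.range p,
        h ^ k • Y.g (V j k)) := by
    rw [trunc, Finset.sum_range_succ', (hV i).1]
    simp only [(hV i).2, pow_zero, one_smul, add_comm u]
    congr 1
    simp only [smul_add, Finset.smul_sum, Finset.sum_add_distrib]
    congr 1
    · rw [Finset.sum_comm]
      refine Finset.sum_congr rfl fun j _ => Finset.sum_congr rfl fun k _ => ?_
      simp only [smul_smul]
      congr 1
      ring
    · rw [Finset.sum_comm]
      refine Finset.sum_congr rfl fun j _ => Finset.sum_congr rfl fun k _ => ?_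
      simp only [smul_smul]
      congr 1
      ring
  rw [h1]
  simp only [f_trunc, g_trunc, smul_add, Finset.sum_add_distrib]
  abel

/-- The stages of the method agree with their truncated series up to `O(h ^ (p + 1))`. -/
theorem stage_expansion {s : ℕ} {M : ImExRK s} {p : ℕ} {u : Ω → E} {h : Ω → ℝ}
    (hh : Tendsto h l (𝓝 0)) (hu : TameBigO Y.N l u fun _ => 1) {V : Ω → Fin s → ℕ → E}
    (hV : ∀ z, Y.IsStageSeries M p (u z) (V z)) {S : Ω → Fin s → E}
    (hS : ∀ᶠ z in l, ∀ i, S z i = u z + h z • (∑ j, M.Aex i j • Y.f (S z j) +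
      ∑ j, M.Aim i j • Y.g (S z j))) (i : Fin s) :
    TameBigO Y.N l (fun z => S z i - trunc p (V z i) (h z)) fun z => h z ^ (p + 1) := by
  have hh1 : h =O[l] fun _ => (1 : ℝ) := hh.isBigO_one ℝ
  have hVk := Y.tameBigO_stageSeries hu hV
  have hW : ∀ j, TameBigO Y.N l (fun z => trunc p (V z j) (h z)) fun _ => 1 := fun j =>
    Y.tameBigO_trunc hh1 fun k _ => hVk j k
  have hpow : (fun z => h z ^ (p + 1)) =O[l] fun _ => (1 : ℝ) := by
    simpa using hh1.pow (p + 1)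
  have hmul : (fun z => h z * h z ^ (p + 1)) =O[l] fun z => h z ^ (p + 1) := by
    simpa using hh1.mul (Asymptotics.isBigO_refl (fun z => h z ^ (p + 1)) l)
  -- Stage by stage: the explicit terms and the off-diagonal implicit terms involve only earlier
  -- stages, already expanded, and the diagonal term is inverted at the end.
  induction i using WellFoundedLT.induction with
  | _ i ih =>
  have hSj : ∀ j < i, TameBigO Y.N l (fun z => S z j) fun _ => 1 := fun j hj =>
    (((ih j hj).trans hpow).add (hW j)).congr' (Eventually.of_forall fun z => by simp)
  have hf : TameBigO Y.N l (fun z => ∑ j, M.Aex i j • (Y.f (S z j) - Y.f (trunc p (V z j) (h z))))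
      fun z => h z ^ (p + 1) := by
    refine TameBigO.sum fun j _ => ?_
    rcases lt_or_ge j i with hj | hj
    · exact (Y.tameBigO_f_sub (ih j hj) (hSj j hj) (hW j)).const_smul _
    · simpa only [M.Aex_strict i j hj, zero_smul] using TameBigO.zero
  have hg : TameBigO Y.N l (fun z => ∑ j, (if j < i then M.Aim i j else 0) •
      Y.g (S z j - trunc p (V z j) (h z))) fun z => h z ^ (p + 1) := by
    refine TameBigO.sum fun j _ => ?_
    by_cases hj : j < i
    · exact (Y.tameBigO_g (ih j hj)).const_smul _
    · simpa only [hj, if_false, zero_smul] using TameBigO.zero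
  have hres : TameBigO Y.N l (fun z => h z • (∑ j, M.Aex i j • (∑ k ∈ Finset.Ico p (3 * p + 1),
        h z ^ k • cubicCoeff Y.T p k (V z j)) + ∑ j, M.Aim i j • (h z ^ p • Y.g (V z j p))))
      fun z => h z ^ (p + 1) := by
    have h1 : TameBigO Y.N l (fun z => ∑ j, M.Aex i j • (∑ k ∈ Finset.Ico p (3 * p + 1),
        h z ^ k • cubicCoeff Y.T p k (V z j))) fun z => h z ^ p :=
      TameBigO.sum fun j _ => (Y.tameBigO_tail hh1 fun k => hVk j k).const_smul _
    have h2 : TameBigO Y.N l (fun z => ∑ j, M.Aim i j • (h z ^ p • Y.g (V z j p)))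
        fun z => h z ^ p := by
      refine TameBigO.sum fun j _ => TameBigO.const_smul _ ?_
      simpa using TameBigO.smul (Asymptotics.isBigO_refl (fun z => h z ^ p) l)
        (Y.tameBigO_g (hVk j p))
    refine (TameBigO.smul (Asymptotics.isBigO_refl h l) (h1.add h2)).trans ?_
    simpa only [pow_succ'] using Asymptotics.isBigO_refl (fun z => h z * h z ^ p) l
  -- The stage error solves the implicit equation of the stage with right-hand side `O(h ^ (p +
  -- 1))`; since `h * M.Aim i i → 0`, the resolvent bound removes the operator.
  have hR : TameBigO Y.N l (fun z => (S z i - trunc p (V z i) (h z)) -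
      (h z * M.Aim i i) • Y.g (S z i - trunc p (V z i) (h z))) fun z => h z ^ (p + 1) := by
    have h1 := (TameBigO.smul (Asymptotics.isBigO_refl h l) (hf.add hg)).trans hmul
    refine (h1.add hres).congr' ?_
    filter_upwards [hS] with z hz
    rw [← Y.stage_residual (hV z)]
    have e := hz i
    rw [M.sum_Aim_smul i fun j => Y.g (S z j)] at e
    rw [M.sum_Aim_smul i fun j => Y.g (trunc p (V z j) (h z))]
    simp only [smul_sub, map_sub, Finset.sum_sub_distrib]
    linear_combination (norm := module) (-1 : ℝ) • e
  intro k
  obtain ⟨r, hr, hres⟩ := Y.resolvent_le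
  obtain ⟨C, hC⟩ := hres k
  refine (Asymptotics.IsBigO.of_bound C ?_).trans (hR k)
  have hsmall : ∀ᶠ z in l, |h z * M.Aim i i| < r := by
    have : Tendsto (fun z => |h z * M.Aim i i|) l (𝓝 0) := by
      simpa using (hh.mul_const (M.Aim i i)).abs
    exact this.eventually (gt_mem_nhds hr)
  filter_upwards [hsmall] with z hz
  rw [Real.norm_of_nonneg (apply_nonneg _ _), Real.norm_of_nonneg (apply_nonneg _ _)]
  exact hC _ hz.le _

/-- The exact solution agrees with its truncated series up to `O(r ^ (p + 1))`, uniformly for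
bounded families of solutions. -/
theorem exact_expansion {I : Type*} {σ : I → ℝ} {c : ℝ} (hσ : ∀ i, σ i ≤ c) {y : I → ℝ → E} {p : ℕ}
    (hy : ∀ i, ∀ x, ∀ r ∈ Set.Icc 0 (σ i), HasDerivWithinAt (fun r => Y.ev x (y i r))
      (Y.ev x (Y.f (y i r) + Y.g (y i r))) (Set.Icc 0 (σ i)) r)
    (hb : ∀ k, ∃ C, ∀ i, ∀ r ∈ Set.Icc 0 (σ i), Y.N k (y i r) ≤ C)
    {U : I → ℕ → E} (hU : ∀ i, Y.IsExactSeries p (y i 0) (U i)) (k : ℕ) :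
    ∃ C, ∀ i, ∀ r ∈ Set.Icc 0 (σ i), Y.N k (y i r - trunc p (U i) r) ≤ C * r ^ (p + 1) := by
  -- Along the principal filter of all admissible pairs (solution, time), a `TameBigO` statement is
  -- a uniform bound.
  let A : Set (I × ℝ) := {z | z.2 ∈ Set.Icc 0 (σ z.1)}
  let l : Filter (I × ℝ) := 𝓟 A
  have hA : ∀ z ∈ A, (z.1, (0 : ℝ)) ∈ A := fun z hz => ⟨le_rfl, hz.1.trans hz.2⟩
  have hh1 : (fun z : I × ℝ => z.2) =O[l] fun _ => (1 : ℝ) := by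
    refine Asymptotics.isBigO_principal.2 ⟨c, fun z hz => ?_⟩
    rw [Real.norm_of_nonneg hz.1]
    simpa using hz.2.trans (hσ _)
  have hyb : TameBigO Y.N l (fun z => y z.1 z.2) fun _ => 1 := fun k => by
    obtain ⟨C, hC⟩ := hb k
    refine Asymptotics.isBigO_principal.2 ⟨C, fun z hz => ?_⟩
    rw [Real.norm_of_nonneg (apply_nonneg _ _)]
    simpa using hC _ _ hz
  have hy0 : TameBigO Y.N l (fun z => y z.1 0) fun _ => 1 := by
    have : Tendsto (fun z : I × ℝ => (z.1, (0 : ℝ))) l l :=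
      tendsto_principal_principal.2 hA
    exact hyb.comp_tendsto this
  have hUk : ∀ k, TameBigO Y.N l (fun z => U z.1 k) fun _ => 1 :=
    Y.tameBigO_exactSeries hy0 (fun z => hU z.1)
  have hW : TameBigO Y.N l (fun z => trunc p (U z.1) z.2) fun _ => 1 :=
    Y.tameBigO_trunc hh1 fun k _ => hUk k
  let tail : I × ℝ → E := fun z => ∑ k ∈ Finset.Ico p (3 * p + 1),
      z.2 ^ k • cubicCoeff Y.T p k (U z.1) + z.2 ^ p • Y.g (U z.1 p)
  have htail : TameBigO Y.N l tail fun z => z.2 ^ p := by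
    refine (Y.tameBigO_tail hh1 hUk).add ?_
    simpa using TameBigO.smul (Asymptotics.isBigO_refl (fun z : I × ℝ => z.2 ^ p) l)
      (Y.tameBigO_g (hUk p))
  let d : I → ℝ → E := fun i r => (Y.f (y i r) - Y.f (trunc p (U i) r)) +
    Y.g (y i r - trunc p (U i) r) + tail (i, r)
  -- The factor `k + 1` from differentiating `r ^ (k + 1)` is the one on the left of the recursion
  -- for the exact series.
  have hdW : ∀ i x r, HasDerivAt (fun r => Y.ev x (trunc p (U i) r))
      (Y.ev x (∑ k ∈ Finset.range p, r ^ k • (cubicCoeff Y.T p k (U i) + Y.g (U i k)))) r := by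
    intro i x r
    have h1 : ∀ r, Y.ev x (trunc p (U i) r) =
        ∑ k ∈ Finset.range p, r ^ (k + 1) • Y.ev x (U i (k + 1)) + Y.ev x (U i 0) := by
      intro r
      rw [trunc, Finset.sum_range_succ', map_add, map_sum]
      simp
    simp only [h1]
    refine HasDerivAt.add_const _ ?_
    rw [map_sum]
    refine HasDerivAt.fun_sum fun k _ => ?_
    rw [← (hU i).2]
    have := (hasDerivAt_pow (k + 1) r).smul_const (Y.ev x (U i (k + 1)))
    convert this using 1
    simp only [map_smul, smul_smul]
    congr 1
    push_cast
    simp [mul_comm]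
  have hd : ∀ i, ∀ x, ∀ r ∈ Set.Icc 0 (σ i),
      HasDerivWithinAt (fun r => Y.ev x (y i r - trunc p (U i) r)) (Y.ev x (d i r))
        (Set.Icc 0 (σ i)) r := by
    intro i x r hr
    have := (hy i x r hr).fun_sub (hdW i x r).hasDerivWithinAt
    simp only [map_sub]
    convert this using 1
    rw [← map_sub]
    congr 1
    simp only [d, tail, f_trunc, g_trunc, map_sub, smul_add, Finset.sum_add_distrib]
    abel
  -- Bootstrap instead of Gronwall, which the derivative loss in `g` would defeat: if the error is
  -- `O(r ^ j)` in all seminorms with `j ≤ p`, so is its time derivative, and integration gains one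
  -- power.
  have key : ∀ j ≤ p + 1, TameBigO Y.N l (fun z => y z.1 z.2 - trunc p (U z.1) z.2)
      fun z => z.2 ^ j := by
    intro j
    induction j with
    | zero => intro _; simpa using hyb.sub hW
    | succ j ih =>
      intro hj
      have ih := ih (by omega)
      have hdO : TameBigO Y.N l (fun z => d z.1 z.2) fun z => z.2 ^ j :=
        ((Y.tameBigO_f_sub ih hyb hW).add (Y.tameBigO_g ih)).add
          (htail.trans (isBigO_pow_of_le hh1 (by omega)))
      intro k
      obtain ⟨C, hC⟩ := Y.mean_value k
      obtain ⟨B, hB⟩ := Asymptotics.isBigO_principal.1 (hdO k)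
      refine Asymptotics.isBigO_principal.2 ⟨C * |B|, fun z hz => ?_⟩
      obtain ⟨i, r⟩ := z
      have hsub : Set.Icc 0 r ⊆ Set.Icc 0 (σ i) := Set.Icc_subset_Icc_right hz.2
      have hbd : ∀ m (B : ℝ), (∀ z ∈ A, ‖Y.N m (d z.1 z.2)‖ ≤ B * ‖z.2 ^ j‖) →
          ∀ r' ∈ Set.Icc 0 r, Y.N m (d i r') ≤ |B| * r ^ j := by
        intro m B hB r' hr'
        have h1 := hB (i, r') (hsub hr')
        rw [Real.norm_of_nonneg (apply_nonneg _ _)] at h1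
        refine h1.trans ?_
        have : ‖r' ^ j‖ ≤ r ^ j := by
          rw [norm_pow, Real.norm_of_nonneg hr'.1]
          exact pow_le_pow_left₀ hr'.1 hr'.2 j
        exact mul_le_mul (le_abs_self B) this (norm_nonneg _) (abs_nonneg _)
      have := hC r hz.1 (fun r => y i r - trunc p (U i) r) (d i)
        (fun x r' hr' => (hd i x r' (hsub hr')).mono hsub)
        (by simp [trunc, Finset.sum_range_succ', (hU i).1])
        (fun m => by
          obtain ⟨B, hB⟩ := Asymptotics.isBigO_principal.1 (hdO m)
          exact ⟨_, hbd m B hB⟩) _ (hbd k B hB)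
      rw [Real.norm_of_nonneg (apply_nonneg _ _), norm_pow, Real.norm_of_nonneg hz.1]
      calc _ ≤ C * r * (|B| * r ^ j) := this
        _ = C * |B| * r ^ (j + 1) := by ring
  obtain ⟨C, hC⟩ := Asymptotics.isBigO_principal.1 (key (p + 1) le_rfl k)
  refine ⟨C, fun i r hr => ?_⟩
  have := hC (i, r) hr
  rwa [Real.norm_of_nonneg (apply_nonneg _ _), norm_pow, Real.norm_of_nonneg hr.1] at this

end TameSystem

/-! ### Solvability of the stage equations -/

/-- Forward substitution: row `i` determines `S i` from the earlier entries, and changing later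
entries does not disturb the rows already solved. -/
theorem exists_unique_lowerTriangular {s : ℕ} {E : Type*} [Inhabited E] (B : Fin s → E → E)
    (hB : ∀ i, Function.Bijective (B i)) (rhs : Fin s → (Fin s → E) → E)
    (hrhs : ∀ i S S', (∀ j < i, S j = S' j) → rhs i S = rhs i S') :
    ∃! S : Fin s → E, ∀ i, B i (S i) = rhs i S := by
  have hex : ∀ n : ℕ, ∃ S : Fin s → E, ∀ i : Fin s, (i : ℕ) < n → B i (S i) = rhs i S := by
    intro n
    induction n with
    | zero => exact ⟨fun _ => default, fun i hi => absurd hi (Nat.not_lt_zero _)⟩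
    | succ n ih =>
      obtain ⟨S, hS⟩ := ih
      by_cases hn : n < s
      · obtain ⟨w, hw⟩ := (hB ⟨n, hn⟩).2 (rhs ⟨n, hn⟩ S)
        refine ⟨Function.update S ⟨n, hn⟩ w, fun i hi => ?_⟩
        have hne : ∀ j : Fin s, (j : ℕ) < n → Function.update S ⟨n, hn⟩ w j = S j := fun j hj =>
          Function.update_of_ne (fun h => by simp [h] at hj) _ _
        have hr : rhs i (Function.update S ⟨n, hn⟩ w) = rhs i S :=
          hrhs _ _ _ fun j hj => hne j (by have := Fin.lt_def.1 hj; omega)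
        rw [hr]
        rcases Nat.lt_succ_iff_lt_or_eq.1 hi with h | h
        · rw [hne i h, hS i h]
        · obtain rfl : i = ⟨n, hn⟩ := Fin.ext h
          rw [Function.update_self, hw]
      · exact ⟨S, fun i _ => hS i (by omega)⟩
  obtain ⟨S, hS⟩ := hex s
  refine ⟨S, fun i => hS i i.2, fun S' hS' => ?_⟩
  funext i
  induction i using WellFoundedLT.induction with
  | _ i ih =>
    refine (hB i).1 ?_
    rw [hS' i, hS i i.2]
    exact hrhs _ _ _ ih

namespace ImExRK

variable {s : ℕ} {E : Type*} [AddCommGroup E] [Module ℝ E]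

/-- The stage equations, solved for the implicit contribution of the current stage. -/
theorem stage_iff (M : ImExRK s) (f : E → E) (g : E →ₗ[ℝ] E) (h : ℝ) (Q : E) (S : Fin s → E)
    (i : Fin s) :
    S i = Q + h • (∑ j, M.Aex i j • f (S j) + ∑ j, M.Aim i j • g (S j)) ↔
      S i - (h * M.Aim i i) • g (S i) = Q + h • (∑ j, (if j < i then M.Aex i j else 0) • f (S j) +
        ∑ j, (if j < i then M.Aim i j else 0) • g (S j)) := by
  have h1 : ∑ j, M.Aex i j • f (S j) = ∑ j, (if j < i then M.Aex i j else 0) • f (S j) := by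
    refine Finset.sum_congr rfl fun j _ => ?_
    split_ifs with hj
    · rfl
    · rw [M.Aex_strict i j (not_lt.1 hj)]
  rw [h1, M.sum_Aim_smul i fun j => g (S j)]
  constructor <;> intro e
  · linear_combination (norm := module) e
  · linear_combination (norm := module) e

theorem exists_unique_stages (M : ImExRK s) (f : E → E) (g : E →ₗ[ℝ] E) (h : ℝ)
    (hbij : ∀ i, Function.Bijective fun x => x - (h * M.Aim i i) • g x) (Q : E) :
    ∃! S : Fin s → E,
      ∀ i, S i = Q + h • (∑ j, M.Aex i j • f (S j) + ∑ j, M.Aim i j • g (S j)) := by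
  simp only [M.stage_iff f g h Q]
  have : Inhabited E := ⟨0⟩
  refine exists_unique_lowerTriangular _ hbij (fun i S =>
    Q + h • (∑ j, (if j < i then M.Aex i j else 0) • f (S j) +
        ∑ j, (if j < i then M.Aim i j else 0) • g (S j))) fun i S S' hS => ?_
  congr 3 <;>
  · refine Finset.sum_congr rfl fun j _ => ?_
    split_ifs with hj
    · rw [hS j hj]
    · simp

/-- The update of a globally stiffly accurate method is its last stage. -/
theorem IsGSA.isStep_iff {m : ℕ} {M : ImExRK (m + 1)} (hM : M.IsGSA) {f g : E → E} {h : ℝ}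
    {Q : E} {S : Fin (m + 1) → E} {Q' : E} :
    M.IsStep f g h Q S Q' ↔
      (∀ i, S i = Q + h • (∑ j, M.Aex i j • f (S j) + ∑ j, M.Aim i j • g (S j))) ∧
        Q' = S (Fin.last m) := by
  unfold IsStep
  refine and_congr_right fun hS => ?_
  rw [hS (Fin.last m)]
  simp only [hM.1, hM.2]

end ImExRK

/-! ### Order conditions -/

theorem IsTrilinear.pi_expansion {d : ℕ} {T : (Fin d → ℝ) → (Fin d → ℝ) → (Fin d → ℝ) → Fin d → ℝ}
    (hT : IsTrilinear T) (a b c : Fin d → ℝ) : T a b c = ∑ i, ∑ j, ∑ k, a i • b j • c k •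
      T (Pi.single i 1) (Pi.single j 1) (Pi.single k 1) := by
  conv_lhs => rw [pi_eq_sum_univ' a, pi_eq_sum_univ' b, pi_eq_sum_univ' c]
  rw [hT.sum_left]
  simp_rw [hT.sum_mid, hT.sum_right, Finset.smul_sum]

theorem IsTrilinear.exists_bound_pi {d : ℕ}
    {T : (Fin d → ℝ) → (Fin d → ℝ) → (Fin d → ℝ) → Fin d → ℝ} (hT : IsTrilinear T) :
    ∃ C, ∀ a b c, ‖T a b c‖ ≤ C * (‖a‖ * ‖b‖ * ‖c‖) := by
  refine ⟨∑ i, ∑ j, ∑ k, ‖T (Pi.single i 1) (Pi.single j 1) (Pi.single k 1)‖, fun a b c => ?_⟩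
  rw [hT.pi_expansion, Finset.sum_mul]
  refine norm_sum_le_of_le _ fun i _ => ?_
  rw [Finset.sum_mul]
  refine norm_sum_le_of_le _ fun j _ => ?_
  rw [Finset.sum_mul]
  refine norm_sum_le_of_le _ fun k _ => ?_
  rw [norm_smul, norm_smul, norm_smul]
  calc ‖a i‖ * (‖b j‖ * (‖c k‖ * ‖T (Pi.single i 1) (Pi.single j 1) (Pi.single k 1)‖))
      ≤ ‖a‖ * (‖b‖ * (‖c‖ * ‖T (Pi.single i 1) (Pi.single j 1) (Pi.single k 1)‖)) := by
        gcongr <;> exact norm_le_pi_norm _ _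
    _ = _ := by ring

theorem IsTrilinear.contDiff_diag_pi {d : ℕ}
    {T : (Fin d → ℝ) → (Fin d → ℝ) → (Fin d → ℝ) → Fin d → ℝ} (hT : IsTrilinear T) :
    ContDiff ℝ ∞ fun v => T v v v := by
  simp_rw [fun v => hT.pi_expansion v v v]
  fun_prop

/-- Letting `r → 0` kills the constant term; dividing by `r` reduces the degree. -/
theorem eq_zero_of_sum_pow_smul_isBigO {E : Type*} [NormedAddCommGroup E] [NormedSpace ℝ E] {n : ℕ}
    {a : ℕ → E} (h : (fun r : ℝ => ∑ k ∈ Finset.range n, r ^ k • a k) =O[𝓝[>] 0] fun r => r ^ n) :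
    ∀ k < n, a k = 0 := by
  induction n generalizing a with
  | zero => intro k hk; omega
  | succ n ih =>
    have h0 : a 0 = 0 := by
      have h1 : Tendsto (fun r : ℝ => ∑ k ∈ Finset.range (n + 1), r ^ k • a k) (𝓝[>] 0) (𝓝 0) := by
        refine h.trans_tendsto (tendsto_nhdsWithin_of_tendsto_nhds ?_)
        exact (continuous_pow (n + 1)).tendsto' _ _ (by simp)
      have h2 : Tendsto (fun r : ℝ => ∑ k ∈ Finset.range (n + 1), r ^ k • a k) (𝓝[>] 0)
          (𝓝 (a 0)) := by
        refine tendsto_nhdsWithin_of_tendsto_nhds (Continuous.tendsto' (by fun_prop) _ _ ?_)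
        simp [Finset.sum_range_succ']
      exact tendsto_nhds_unique h2 h1
    have h1 : (fun r : ℝ => ∑ k ∈ Finset.range n, r ^ k • a (k + 1)) =O[𝓝[>] 0]
        fun r => r ^ n := by
      have h2 := (Asymptotics.isBigO_refl (fun r : ℝ => r⁻¹) (𝓝[>] 0)).smul h
      refine h2.congr' ?_ ?_
      · filter_upwards [self_mem_nhdsWithin] with r hr
        have hr : r ≠ 0 := ne_of_gt hr
        rw [Finset.sum_range_succ', h0, smul_zero, add_zero, Finset.smul_sum]
        refine Finset.sum_congr rfl fun k _ => ?_
        rw [smul_smul, pow_succ']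
        field_simp
      · filter_upwards [self_mem_nhdsWithin] with r hr
        have hr : r ≠ 0 := ne_of_gt hr
        rw [smul_eq_mul, pow_succ']
        field_simp
    rintro (_ | k) hk
    · exact h0
    · exact ih (a := fun k => a (k + 1)) h1 k (by omega)

namespace TameSystem

/-- The system on `ℝ ^ d` given by a trilinear and a linear map. -/
noncomputable def ofPi {d : ℕ} (T : (Fin d → ℝ) → (Fin d → ℝ) → (Fin d → ℝ) → Fin d → ℝ)
    (hT : IsTrilinear T) (g : (Fin d → ℝ) →ₗ[ℝ] (Fin d → ℝ)) :
    TameSystem (Fin d → ℝ) Unit (Fin d → ℝ) where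
  N _ := normSeminorm ℝ _
  T := T
  g := g
  ev _ := LinearMap.id
  trilinear := hT
  T_le _ := by
    obtain ⟨C, hC⟩ := hT.exists_bound_pi
    exact ⟨C, 0, hC⟩
  g_le _ := ⟨‖LinearMap.toContinuousLinearMap g‖, 0, (LinearMap.toContinuousLinearMap g).le_opNorm⟩
  resolvent_le := by
    set G := LinearMap.toContinuousLinearMap g
    -- With this radius `c • g` has norm at most `1 / 2`, whence the constant `2`; the summand `1`
    -- covers `G = 0`.
    refine ⟨(2 * (‖G‖ + 1))⁻¹, by positivity, fun _ => ⟨2, fun c hc a => ?_⟩⟩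
    have h1 : ‖c • g a‖ ≤ 2⁻¹ * ‖a‖ := by
      rw [norm_smul]
      calc ‖c‖ * ‖g a‖ ≤ (2 * (‖G‖ + 1))⁻¹ * ((‖G‖ + 1) * ‖a‖) := by
            refine mul_le_mul hc ((G.le_opNorm a).trans ?_) (norm_nonneg _) (by positivity)
            gcongr
            linarith
        _ = 2⁻¹ * ‖a‖ := by field_simp
    have h2 : ‖a‖ - ‖c • g a‖ ≤ ‖a - c • g a‖ := norm_sub_norm_le _ _
    change ‖a‖ ≤ 2 * ‖a - c • g a‖
    linarith
  mean_value _ := by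
    refine ⟨1, fun s hs e d hd he _ B hB => ?_⟩
    have := norm_image_sub_le_of_norm_deriv_le_segment' (fun r hr => hd () r hr)
      (fun r hr => hB r (Set.Ico_subset_Icc_self hr)) s (Set.right_mem_Icc.2 hs)
    simp only [LinearMap.id_coe, id_eq, he, sub_zero] at this
    change ‖e s‖ ≤ 1 * s * B
    linarith

/-- The numerical and the exact value after one step agree up to `O(h ^ (p + 1))` by the order
hypothesis, and each agrees to that accuracy with its Taylor polynomial of degree `p`. Two such
polynomials must coincide. -/
theorem stageSeries_eq_exactSeries_pi {m p d : ℕ} {M : ImExRK (m + 1)} (hM : M.IsGSA)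
    (hord : M.HasOrder p) {T : (Fin d → ℝ) → (Fin d → ℝ) → (Fin d → ℝ) → Fin d → ℝ}
    (hT : IsTrilinear T) (g : (Fin d → ℝ) →ₗ[ℝ] (Fin d → ℝ)) {u : Fin d → ℝ}
    {V : Fin (m + 1) → ℕ → Fin d → ℝ} (hV : (ofPi T hT g).IsStageSeries M p u V)
    {U : ℕ → Fin d → ℝ} (hU : (ofPi T hT g).IsExactSeries p u U) :
    ∀ k ≤ p, V (Fin.last m) k = U k := by
  set Y := ofPi T hT g with hY
  have hf : ContDiff ℝ ∞ Y.f := hT.contDiff_diag_pi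
  have hg : ContDiff ℝ ∞ Y.g := (LinearMap.toContinuousLinearMap g).contDiff
  obtain ⟨y, hy0, ε, hε, hy⟩ :=
    ContDiffAt.exists_forall_mem_closedBall_exists_eq_forall_mem_Ioo_hasDerivAt₀
      (((hf.add hg).of_le (by norm_cast)).contDiffAt (x := u)) 0
  simp only [zero_sub, zero_add] at hy
  have hstage : ∀ᶠ h : ℝ in 𝓝[>] 0, ∃ S : Fin (m + 1) → Fin d → ℝ,
      ∀ i, S i = u + h • (∑ j, M.Aex i j • Y.f (S j) + ∑ j, M.Aim i j • Y.g (S j)) := by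
    obtain ⟨r, hr, hres⟩ := Y.resolvent_le
    obtain ⟨C, hC⟩ := hres 0
    have hsmall : ∀ᶠ h : ℝ in 𝓝 0, ∀ i, |h * M.Aim i i| < r := by
      refine eventually_all.2 fun i => ?_
      have : Tendsto (fun h : ℝ => |h * M.Aim i i|) (𝓝 0) (𝓝 0) :=
        Continuous.tendsto' (by fun_prop) _ _ (by simp)
      exact this.eventually (gt_mem_nhds hr)
    filter_upwards [nhdsWithin_le_nhds hsmall] with h hh
    refine (M.exists_unique_stages Y.f Y.g h (fun i => ?_) u).exists
    have hinj : Function.Injective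
        (LinearMap.id - (h * M.Aim i i) • Y.g : (Fin d → ℝ) →ₗ[ℝ] Fin d → ℝ) := by
      refine (injective_iff_map_eq_zero _).2 fun a ha => ?_
      have h1 := hC _ (hh i).le a
      have h2 : a - (h * M.Aim i i) • Y.g a = 0 := ha
      rw [h2, map_zero, mul_zero] at h1
      exact norm_le_zero_iff.1 h1
    exact ⟨hinj, LinearMap.injective_iff_surjective.1 hinj⟩
  obtain ⟨S, hS⟩ := hstage.choice
  have hexp := Y.stage_expansion (Ω := ℝ) (l := 𝓝[>] (0 : ℝ)) (h := fun h => h)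
    (u := fun _ => u) (V := fun _ => V) (S := S) (p := p) (M := M) (tendsto_nhdsWithin_of_tendsto_nhds tendsto_id)
    (fun k => Asymptotics.isBigO_const_const _ one_ne_zero _) (fun _ => hV)
    hS
  have hexpN : ∀ i, (fun h => S h i - trunc p (V i) h) =O[𝓝[>] (0 : ℝ)] fun h => h ^ (p + 1) :=
    fun i => Asymptotics.IsBigO.of_norm_left (hexp i 0)
  have hpow : Tendsto (fun h : ℝ => h ^ (p + 1)) (𝓝[>] 0) (𝓝 0) :=
    tendsto_nhdsWithin_of_tendsto_nhds ((continuous_pow (p + 1)).tendsto' _ _ (by simp))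
  have hSlim : ∀ i, Tendsto (fun h => S h i) (𝓝[>] 0) (𝓝 (y 0)) := by
    intro i
    have h1 := (hexpN i).trans_tendsto hpow
    have h2 : Tendsto (fun h : ℝ => trunc p (V i) h) (𝓝[>] 0) (𝓝 u) := by
      refine tendsto_nhdsWithin_of_tendsto_nhds
        (Continuous.tendsto' (by unfold trunc; fun_prop) _ _ ?_)
      simp [trunc, Finset.sum_range_succ', (hV i).1]
    simpa [hy0] using h1.add h2
  have hord' := hord d Y.f Y.g hf hg y
    (eventually_of_mem (Ioo_mem_nhds (neg_lt_zero.2 hε) hε) fun t ht => hy t ht) S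
    (fun h => S h (Fin.last m))
    (hS.mono fun h hh => (hM.isStep_iff).2 ⟨by simpa only [hy0] using hh, rfl⟩) hSlim
  -- Half of the existence interval is compact inside it, so the local solution is bounded there, as
  -- the expansion of the exact solution demands.
  have hycont : ContinuousOn y (Set.Icc 0 (ε / 2)) := fun t ht =>
    (hy t ⟨by linarith [ht.1], by linarith [ht.2]⟩).continuousAt.continuousWithinAt
  obtain ⟨K, hK⟩ := isCompact_Icc.exists_bound_of_continuousOn hycont
  obtain ⟨C, hC⟩ := Y.exact_expansion (I := Unit) (σ := fun _ => ε / 2) (c := ε / 2)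
    (fun _ => le_rfl) (y := fun _ => y) (p := p)
    (fun _ _ r hr => (hy r ⟨by linarith [hr.1], by linarith [hr.2]⟩).hasDerivWithinAt)
    (fun _ => ⟨K, fun _ => hK⟩) (U := fun _ => U) (fun _ => by simpa only [hy0] using hU) 0
  have hexact : (fun h => y h - trunc p U h) =O[𝓝[>] (0 : ℝ)] fun h => h ^ (p + 1) := by
    refine Asymptotics.IsBigO.of_bound C ?_
    filter_upwards [Ioo_mem_nhdsGT (half_pos hε)] with h hh
    have := hC () h (Set.Ioo_subset_Icc_self hh)
    rwa [norm_pow, Real.norm_of_nonneg hh.1.le]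
  have hdiff : (fun h : ℝ => ∑ k ∈ Finset.range (p + 1), h ^ k • (V (Fin.last m) k - U k))
      =O[𝓝[>] (0 : ℝ)] fun h => h ^ (p + 1) := by
    refine ((hord'.sub (hexpN (Fin.last m))).add hexact).congr_left fun h => ?_
    simp only [trunc, smul_sub, Finset.sum_sub_distrib]
    abel
  intro k hk
  exact sub_eq_zero.1 (eq_zero_of_sum_pow_smul_isBigO hdiff k (by omega))

/-- The order of a method, defined through ordinary differential equations, determines the Taylor
coefficients of its last stage also for systems on infinite-dimensional spaces. -/
theorem stageSeries_eq_exactSeries {E X F : Type*} [AddCommGroup E] [Module ℝ E]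
    [NormedAddCommGroup F] [NormedSpace ℝ F] (Y : TameSystem E X F) {m p : ℕ} {M : ImExRK (m + 1)}
    (hM : M.IsGSA) (hord : M.HasOrder p) {u : E} {V : Fin (m + 1) → ℕ → E}
    (hV : Y.IsStageSeries M p u V) {U : ℕ → E} (hU : Y.IsExactSeries p u U) :
    ∀ k ≤ p, V (Fin.last m) k = U k := by
  -- Up to index `p` both recursions stay in the finite-dimensional span of these vectors. Replacing
  -- `T` and `g` by their compressions to it therefore changes none of the coefficients.
  let s : Set E := (⋃ k ∈ Set.Iic p, Set.range fun i => V i k) ∪ U '' Set.Iic p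
  have hs : s.Finite :=
    ((Set.finite_Iic p).biUnion fun k _ => Set.finite_range _).union ((Set.finite_Iic p).image _)
  let W : Submodule ℝ E := Submodule.span ℝ s
  have hVW : ∀ k ≤ p, ∀ i, V i k ∈ W := fun k hk i => Submodule.subset_span <| Or.inl <| by
    simp only [Set.mem_iUnion]
    exact ⟨k, hk, i, rfl⟩
  have hUW : ∀ k ≤ p, U k ∈ W := fun k hk => Submodule.subset_span <| Or.inr ⟨k, hk, rfl⟩
  have : FiniteDimensional ℝ W := FiniteDimensional.span_of_finite ℝ hs
  obtain ⟨P, hP⟩ := W.exists_isCompl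
  -- An algebraic projection onto `W` is enough, because only identities between coefficients are
  -- transported; no continuity is needed.
  obtain ⟨π₀, hπ₀⟩ := W.subtype.exists_leftInverse_of_injective W.ker_subtype
  let e : W ≃ₗ[ℝ] (Fin (Module.finrank ℝ W) → ℝ) := (Module.finBasis ℝ W).equivFun
  let ι : (Fin (Module.finrank ℝ W) → ℝ) →ₗ[ℝ] E := W.subtype ∘ₗ e.symm.toLinearMap
  let π : E →ₗ[ℝ] (Fin (Module.finrank ℝ W) → ℝ) := e.toLinearMap ∘ₗ π₀
  have hιπ : ∀ w ∈ W, ι (π w) = w := by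
    intro w hw
    have h1 : π₀ w = ⟨w, hw⟩ := LinearMap.congr_fun hπ₀ ⟨w, hw⟩
    simp [ι, π, h1]
  let T' := fun a b c => π (Y.T (ι a) (ι b) (ι c))
  have hT' : IsTrilinear T' :=
    { left := fun b c => (π ∘ₗ IsLinearMap.mk' _ (Y.trilinear.left (ι b) (ι c)) ∘ₗ ι).isLinear
      mid := fun a c => (π ∘ₗ IsLinearMap.mk' _ (Y.trilinear.mid (ι a) (ι c)) ∘ₗ ι).isLinear
      right := fun a b => (π ∘ₗ IsLinearMap.mk' _ (Y.trilinear.right (ι a) (ι b)) ∘ₗ ι).isLinear }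
  let g' := π ∘ₗ Y.g ∘ₗ ι
  let Y' := ofPi T' hT' g'
  have hcub : ∀ {k : ℕ} {A : ℕ → E} {A' : ℕ → Fin (Module.finrank ℝ W) → ℝ}, k ≤ p →
      (∀ j ≤ k, A j ∈ W ∧ A' j = π (A j)) →
      cubicCoeff T' p k A' = π (cubicCoeff Y.T p k A) := by
    intro k A A' _ h
    simp only [cubicCoeff, map_sum]
    refine Finset.sum_congr rfl fun a _ => Finset.sum_congr rfl fun b _ => Finset.sum_congr rfl
      fun c _ => ?_
    split_ifs with habc
    · simp only [T', (h a (by omega)).2, (h b (by omega)).2, (h c (by omega)).2]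
      rw [hιπ _ (h a (by omega)).1, hιπ _ (h b (by omega)).1, hιπ _ (h c (by omega)).1]
    · simp
  obtain ⟨V', hV'⟩ := Y'.exists_isStageSeries M p (π u)
  obtain ⟨U', hU'⟩ := Y'.exists_isExactSeries p (π u)
  have hVV' : ∀ k ≤ p, ∀ i, V' i k = π (V i k) := by
    intro k
    induction k using Nat.strong_induction_on with
    | _ k ih =>
      intro hk i
      rcases k with _ | k
      · rw [(hV' i).1, (hV i).1]
      · rw [(hV' i).2, (hV i).2, map_add, map_sum, map_sum]
        congr 1
        · refine Finset.sum_congr rfl fun j _ => ?_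
          rw [map_smul, ← hcub (by omega) fun n hn => ⟨hVW n (by omega) j, ih n (by omega) (by omega) j⟩]
          rfl
        · refine Finset.sum_congr rfl fun j _ => ?_
          rw [map_smul, ih k (by omega) (by omega) j]
          change M.Aim i j • π (Y.g (ι (π (V j k)))) = _
          rw [hιπ _ (hVW k (by omega) j)]
  have hUU' : ∀ k ≤ p, U' k = π (U k) := by
    intro k
    induction k using Nat.strong_induction_on with
    | _ k ih =>
      intro hk
      rcases k with _ | k
      · rw [hU'.1, hU.1]
      · have h1 := hU'.2 k
        have h2 := congrArg π (hU.2 k)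
        have h3 : Y'.g (U' k) = π (Y.g (U k)) := by
          rw [ih k (by omega) (by omega)]
          change π (Y.g (ι (π (U k)))) = _
          rw [hιπ _ (hUW k (by omega))]
        have h4 : cubicCoeff Y'.T p k U' = π (cubicCoeff Y.T p k U) :=
          hcub (by omega) fun n hn => ⟨hUW n (by omega), ih n (by omega) (by omega)⟩
        rw [h3, h4, ← map_add, ← h2, map_smul] at h1
        exact smul_right_injective _ (by positivity : (k : ℝ) + 1 ≠ 0) h1
  intro k hk
  have := stageSeries_eq_exactSeries_pi hM hord hT' g' hV' hU' k hk
  rw [hVV' k hk, hUU' k hk] at this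
  rw [← hιπ _ (hVW k hk (Fin.last m)), this, hιπ _ (hUW k hk)]

end TameSystem

/-! ### The space `H^∞`: algebra, integration by parts and Sobolev norms. -/

open MeasureTheory in
/-- A set of differentiable square integrable functions that is closed under differentiation is
contained in `H^∞`. -/
theorem mem_HInfty_of_deriv_mem (A : Set (ℝ → ℂ)) (hd : ∀ f ∈ A, Differentiable ℝ f)
    (hL : ∀ f ∈ A, MemLp f 2 volume) (hA : ∀ f ∈ A, deriv f ∈ A) : A ⊆ HInfty := by
  have h : ∀ k : ℕ, ∀ f ∈ A, iteratedDeriv k f ∈ A := by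
    intro k
    induction k with
    | zero => intro f hf; rwa [iteratedDeriv_zero]
    | succ k ih => intro f hf; rw [iteratedDeriv_succ']; exact ih _ (hA f hf)
  exact fun f hf => ⟨contDiff_of_differentiable_iteratedDeriv fun k _ => hd _ (h k f hf),
    fun k => hL _ (h k f hf)⟩

namespace HInfty

open MeasureTheory

theorem differentiable {f : ℝ → ℂ} (hf : f ∈ HInfty) : Differentiable ℝ f :=
  hf.1.differentiable (by simp)

theorem memLp {f : ℝ → ℂ} (hf : f ∈ HInfty) : MemLp f 2 volume := by
  simpa using hf.2 0

theorem deriv_mem {f : ℝ → ℂ} (hf : f ∈ HInfty) : deriv f ∈ HInfty :=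
  ⟨(contDiff_infty_iff_deriv.1 hf.1).2, fun k => by
    rw [← iteratedDeriv_succ']; exact hf.2 (k + 1)⟩

/-- For this and the following closure properties it suffices to name a class of functions that is
stable under `deriv`. -/
theorem zero_mem : (0 : ℝ → ℂ) ∈ HInfty :=
  mem_HInfty_of_deriv_mem {0} (by rintro _ rfl; exact differentiable_const 0)
    (by rintro _ rfl; exact MemLp.zero) (by rintro _ rfl; exact deriv_const' 0) rfl

theorem add_mem {f g : ℝ → ℂ} (hf : f ∈ HInfty) (hg : g ∈ HInfty) : f + g ∈ HInfty :=
  mem_HInfty_of_deriv_mem {w | ∃ f ∈ HInfty, ∃ g ∈ HInfty, w = f + g}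
    (by rintro _ ⟨f, hf, g, hg, rfl⟩; exact (differentiable hf).add (differentiable hg))
    (by rintro _ ⟨f, hf, g, hg, rfl⟩; exact (memLp hf).add (memLp hg))
    (by
      rintro _ ⟨f, hf, g, hg, rfl⟩
      exact ⟨_, deriv_mem hf, _, deriv_mem hg, funext fun x =>
        deriv_add (differentiable hf x) (differentiable hg x)⟩)
    ⟨f, hf, g, hg, rfl⟩

theorem smul_mem (c : ℂ) {f : ℝ → ℂ} (hf : f ∈ HInfty) : c • f ∈ HInfty :=
  mem_HInfty_of_deriv_mem {w | ∃ f ∈ HInfty, w = c • f}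
    (by rintro _ ⟨f, hf, rfl⟩; exact (differentiable hf).const_smul c)
    (by rintro _ ⟨f, hf, rfl⟩; exact (memLp hf).const_smul c)
    (by
      rintro _ ⟨f, hf, rfl⟩
      exact ⟨_, deriv_mem hf, funext fun x => deriv_const_smul c (differentiable hf x)⟩)
    ⟨f, hf, rfl⟩

theorem conj_mem {f : ℝ → ℂ} (hf : f ∈ HInfty) : (fun x => star (f x)) ∈ HInfty :=
  mem_HInfty_of_deriv_mem {w | ∃ f ∈ HInfty, w = fun x => star (f x)}
    (by rintro _ ⟨f, hf, rfl⟩; exact (differentiable hf).star)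
    (by rintro _ ⟨f, hf, rfl⟩; exact (memLp hf).star)
    (by
      rintro _ ⟨f, hf, rfl⟩
      exact ⟨_, deriv_mem hf, funext fun x => deriv.star⟩)
    ⟨f, hf, rfl⟩

end HInfty

/-- The space `H^∞(ℝ; ℂ)` as a complex vector space. -/
def hInf : Submodule ℂ (ℝ → ℂ) where
  carrier := HInfty
  add_mem' := HInfty.add_mem
  zero_mem' := HInfty.zero_mem
  smul_mem' := HInfty.smul_mem

/-- The type of elements of `H^∞(ℝ; ℂ)`. -/
abbrev HInf : Type := hInf

namespace HInf

open MeasureTheory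

theorem differentiable (f : HInf) : Differentiable ℝ f.1 := HInfty.differentiable f.2

theorem continuous (f : HInf) : Continuous f.1 := f.differentiable.continuous

theorem memLp (f : HInf) : MemLp f.1 2 volume := HInfty.memLp f.2

/-- The derivative. -/
noncomputable def D : HInf →ₗ[ℂ] HInf where
  toFun f := ⟨deriv f.1, HInfty.deriv_mem f.2⟩
  map_add' f g := Subtype.ext <| funext fun x => deriv_add (f.differentiable x) (g.differentiable x)
  map_smul' c f := Subtype.ext <| funext fun x => deriv_const_smul c (f.differentiable x)

theorem coe_D (f : HInf) : (D f).1 = deriv f.1 := rfl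

theorem hasDerivAt (f : HInf) (x : ℝ) : HasDerivAt f.1 ((D f).1 x) x :=
  (f.differentiable x).hasDerivAt

theorem coe_D_pow (j : ℕ) (f : HInf) : ((D ^ j) f).1 = iteratedDeriv j f.1 := by
  induction j generalizing f with
  | zero => simp
  | succ j ih => rw [pow_succ, iteratedDeriv_succ', ← coe_D, ← ih]; rfl

/-- The embedding into `L²`. -/
noncomputable def toL2 : HInf →ₗ[ℂ] Lp ℂ 2 (volume : Measure ℝ) where
  toFun f := f.memLp.toLp f.1
  map_add' f g := MemLp.toLp_add f.memLp g.memLp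
  map_smul' c f := MemLp.toLp_const_smul c f.memLp

theorem coeFn_toL2 (f : HInf) : toL2 f =ᵐ[volume] f.1 := MemLp.coeFn_toLp f.memLp

theorem inner_toL2 (f g : HInf) : inner ℂ (toL2 f) (toL2 g) = ∫ x, star (f.1 x) * g.1 x := by
  rw [L2.inner_def]
  refine integral_congr_ae ?_
  filter_upwards [coeFn_toL2 f, coeFn_toL2 g] with x hf hg
  rw [hf, hg]
  simp [mul_comm]

theorem norm_toL2_sq (f : HInf) : ‖toL2 f‖ ^ 2 = ∫ x, ‖f.1 x‖ ^ 2 := by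
  have h := inner_toL2 f f
  rw [inner_self_eq_norm_sq_to_K] at h
  have h2 : ∫ x, star (f.1 x) * f.1 x = ((∫ x, ‖f.1 x‖ ^ 2 : ℝ) : ℂ) := by
    rw [← integral_complex_ofReal]
    congr 1
    ext x
    simp [← Complex.normSq_eq_conj_mul_self, Complex.normSq_eq_norm_sq]
  rw [h2] at h
  exact Complex.ofReal_injective (by rw [← h]; simp)

theorem integrable_norm_sq (f : HInf) : Integrable fun x => ‖f.1 x‖ ^ 2 :=
  (memLp_two_iff_integrable_sq_norm f.memLp.1).1 f.memLp

theorem integrable_mul (f g : HInf) : Integrable fun x => f.1 x * g.1 x :=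
  f.memLp.integrable_mul g.memLp

/-- The Sobolev embedding in one dimension: `|f|²` vanishes at `-∞`, and its derivative is at most
`|f|² + |f'|²` in absolute value. -/
theorem norm_apply_le (f : HInf) (x : ℝ) : ‖f.1 x‖ ≤ ‖toL2 f‖ + ‖toL2 (D f)‖ := by
  have hd : ∀ y, HasDerivAt (fun y => ‖f.1 y‖ ^ 2) (2 * inner ℝ (f.1 y) ((D f).1 y)) y :=
    fun y => (f.hasDerivAt y).norm_sq
  have hle : ∀ y, ‖2 * inner ℝ (f.1 y) ((D f).1 y)‖ ≤ ‖f.1 y‖ ^ 2 + ‖(D f).1 y‖ ^ 2 := by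
    intro y
    rw [norm_mul, Real.norm_ofNat]
    have := norm_inner_le_norm (𝕜 := ℝ) (f.1 y) ((D f).1 y)
    nlinarith [sq_nonneg (‖f.1 y‖ - ‖(D f).1 y‖)]
  have hsum := f.integrable_norm_sq.add (D f).integrable_norm_sq
  have hint : Integrable fun y => 2 * inner ℝ (f.1 y) ((D f).1 y) := by
    refine hsum.mono' ?_ (Eventually.of_forall hle)
    exact (continuous_const.mul (f.continuous.inner (D f).continuous)).aestronglyMeasurable
  have hlim : Tendsto (fun y => ‖f.1 y‖ ^ 2) atBot (𝓝 0) :=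
    tendsto_zero_of_hasDerivAt_of_integrableOn_Iic (a := x) (fun y _ => hd y) hint.integrableOn
      f.integrable_norm_sq.integrableOn
  have h1 := integral_Iic_of_hasDerivAt_of_tendsto' (a := x) (fun y _ => hd y) hint.integrableOn hlim
  have h2 : ∫ y in Set.Iic x, 2 * inner ℝ (f.1 y) ((D f).1 y) ≤
      ∫ y, (‖f.1 y‖ ^ 2 + ‖(D f).1 y‖ ^ 2) := by
    refine (setIntegral_mono hint.integrableOn hsum.integrableOn fun y =>
      (le_abs_self _).trans (hle y)).trans
      (setIntegral_le_integral hsum (Eventually.of_forall fun y => ?_))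
    exact add_nonneg (sq_nonneg _) (sq_nonneg _)
  rw [integral_add f.integrable_norm_sq (D f).integrable_norm_sq, ← norm_toL2_sq,
    ← norm_toL2_sq] at h2
  refine abs_le_of_sq_le_sq' (b := ‖toL2 f‖ + ‖toL2 (D f)‖) ?_ (by positivity) |>.2
  nlinarith [mul_nonneg (norm_nonneg (toL2 f)) (norm_nonneg (toL2 (D f)))]

/-- Integration by parts. -/
theorem inner_D (f g : HInf) : inner ℂ (toL2 (D f)) (toL2 g) = - inner ℂ (toL2 f) (toL2 (D g)) := by
  rw [inner_toL2, inner_toL2]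
  let f' : HInf := ⟨_, HInfty.conj_mem f.2⟩
  have hf' : (D f').1 = fun x => star ((D f).1 x) := funext fun x => deriv.star
  have h := integral_mul_deriv_eq_deriv_mul_of_integrable (u := f'.1) (v := g.1)
    (u' := (D f').1) (v' := (D g).1) (fun x _ => f'.hasDerivAt x) (fun x _ => g.hasDerivAt x)
    (f'.integrable_mul (D g)) ((D f').integrable_mul g) (f'.integrable_mul g)
  rw [hf'] at h
  rw [show (∫ x, star (f.1 x) * (D g).1 x) = ∫ x, f'.1 x * (D g).1 x from rfl, h, neg_neg]

/-- Pointwise complex conjugation. -/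
def conj (f : HInf) : HInf := ⟨fun x => star (f.1 x), HInfty.conj_mem f.2⟩

theorem D_conj (f : HInf) : D (conj f) = conj (D f) :=
  Subtype.ext <| funext fun _ => deriv.star

theorem memLp_mul (f g : HInf) : MemLp (fun x => f.1 x * g.1 x) 2 volume := by
  refine MemLp.of_le_mul (c := ‖toL2 f‖ + ‖toL2 (D f)‖) g.memLp
    (f.continuous.mul g.continuous).aestronglyMeasurable (Eventually.of_forall fun x => ?_)
  rw [norm_mul]
  gcongr
  exact f.norm_apply_le x

/-- The pointwise product. -/
def mul (f g : HInf) : HInf := ⟨fun x => f.1 x * g.1 x, by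
  refine ⟨f.2.1.mul g.2.1, fun k => ?_⟩
  induction k generalizing f g with
  | zero => simpa using memLp_mul f g
  | succ k ih =>
    have h : deriv (fun x => f.1 x * g.1 x) =
        (fun x => (D f).1 x * g.1 x) + fun x => f.1 x * (D g).1 x :=
      funext fun x => deriv_fun_mul (f.differentiable x) (g.differentiable x)
    have h2 : iteratedDeriv k ((fun x => (D f).1 x * g.1 x) + fun x => f.1 x * (D g).1 x) =
        iteratedDeriv k (fun x => (D f).1 x * g.1 x) + iteratedDeriv k fun x => f.1 x * (D g).1 x :=
      funext fun x => iteratedDeriv_add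
        (((D f).2.1.mul g.2.1).contDiffAt.of_le (by exact_mod_cast le_top))
        ((f.2.1.mul (D g).2.1).contDiffAt.of_le (by exact_mod_cast le_top))
    rw [iteratedDeriv_succ', h, h2]
    exact (ih _ _).add (ih _ _)⟩

theorem D_mul (f g : HInf) : D (mul f g) = mul (D f) g + mul f (D g) :=
  Subtype.ext <| funext fun x => deriv_fun_mul (f.differentiable x) (g.differentiable x)

theorem norm_toL2_conj (f : HInf) : ‖toL2 (conj f)‖ = ‖toL2 f‖ := by
  have h : ‖toL2 (conj f)‖ ^ 2 = ‖toL2 f‖ ^ 2 := by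
    rw [norm_toL2_sq, norm_toL2_sq]
    simp [conj]
  exact (sq_eq_sq₀ (norm_nonneg _) (norm_nonneg _)).1 h

theorem norm_toL2_le_of_norm_le {f g : HInf} {c : ℝ} (h : ∀ x, ‖f.1 x‖ ≤ c * ‖g.1 x‖) :
    ‖toL2 f‖ ≤ c * ‖toL2 g‖ := by
  refine Lp.norm_le_mul_norm_of_ae_le_mul ?_
  filter_upwards [coeFn_toL2 f, coeFn_toL2 g] with x hf hg
  rw [hf, hg]
  exact h x

/-- The norm `f ↦ ∑ j ≤ k, ‖f⁽ʲ⁾‖_{L²}`, equivalent to the Sobolev norm of `H^k`. -/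
noncomputable def p (k : ℕ) : Seminorm ℂ HInf :=
  Seminorm.of (fun f => ∑ j ∈ Finset.range (k + 1), ‖toL2 ((D ^ j) f)‖)
    (fun f g => by
      rw [← Finset.sum_add_distrib]
      refine Finset.sum_le_sum fun j _ => ?_
      rw [map_add, map_add]
      exact norm_add_le _ _)
    (fun c f => by
      rw [Finset.mul_sum]
      refine Finset.sum_congr rfl fun j _ => ?_
      rw [map_smul, map_smul, norm_smul])

theorem p_apply (k : ℕ) (f : HInf) :
    p k f = ∑ j ∈ Finset.range (k + 1), ‖toL2 ((D ^ j) f)‖ := rfl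

theorem p_zero (f : HInf) : p 0 f = ‖toL2 f‖ := by simp [p_apply]

theorem p_succ (k : ℕ) (f : HInf) : p (k + 1) f = ‖toL2 f‖ + p k (D f) := by
  rw [p_apply, Finset.sum_range_succ', p_apply, add_comm]
  rfl

theorem norm_toL2_D_pow_le_p {j k : ℕ} (h : j ≤ k) (f : HInf) : ‖toL2 ((D ^ j) f)‖ ≤ p k f :=
  Finset.single_le_sum (f := fun j => ‖toL2 ((D ^ j) f)‖) (fun _ _ => norm_nonneg _)
    (Finset.mem_range.2 (by omega))

theorem norm_toL2_le_p (k : ℕ) (f : HInf) : ‖toL2 f‖ ≤ p k f :=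
  norm_toL2_D_pow_le_p (Nat.zero_le k) f

theorem p_mono {k l : ℕ} (h : k ≤ l) (f : HInf) : p k f ≤ p l f :=
  Finset.sum_le_sum_of_subset_of_nonneg (Finset.range_mono (by omega)) fun _ _ _ => norm_nonneg _

theorem p_D_le (k : ℕ) (f : HInf) : p k (D f) ≤ p (k + 1) f := by
  rw [p_succ]
  exact le_add_of_nonneg_left (norm_nonneg _)

theorem p_conj (k : ℕ) (f : HInf) : p k (conj f) = p k f := by
  induction k generalizing f with
  | zero => rw [p_zero, p_zero, norm_toL2_conj]
  | succ k ih => rw [p_succ, p_succ, norm_toL2_conj, D_conj, ih]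

theorem norm_apply_le_p (f : HInf) (x : ℝ) : ‖f.1 x‖ ≤ p 1 f := by
  rw [p_succ, p_zero]
  exact f.norm_apply_le x

theorem norm_toL2_mul_le (f g : HInf) : ‖toL2 (mul f g)‖ ≤ p 1 f * ‖toL2 g‖ :=
  norm_toL2_le_of_norm_le fun x => by
    simp only [mul, norm_mul]
    gcongr
    exact norm_apply_le_p f x

theorem mul_comm' (f g : HInf) : mul f g = mul g f :=
  Subtype.ext <| funext fun _ => _root_.mul_comm _ _

/-- An auxiliary product rule that allows one factor an extra derivative, which leaves room for the
sup bound in the base case. In `p_mul_le` it handles the Leibniz terms, where one factor has just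
been differentiated. -/
theorem p_mul_le_of_succ (k : ℕ) : ∃ C, 0 ≤ C ∧ ∀ f g, p k (mul f g) ≤ C * (p k f * p (k + 1) g) := by
  induction k with
  | zero =>
    refine ⟨1, zero_le_one, fun f g => ?_⟩
    rw [p_zero, p_zero, mul_comm', one_mul, _root_.mul_comm]
    exact norm_toL2_mul_le g f
  | succ k ih =>
    obtain ⟨C, hC, h⟩ := ih
    refine ⟨1 + C + C, by positivity, fun f g => ?_⟩
    have h0 : ‖toL2 (mul f g)‖ ≤ p (k + 1) f * p (k + 2) g := by
      rw [mul_comm', _root_.mul_comm]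
      refine (norm_toL2_mul_le g f).trans ?_
      gcongr
      · exact p_mono (by omega) g
      · exact norm_toL2_le_p _ f
    have h1 : p k (mul (D f) g) ≤ C * (p (k + 1) f * p (k + 2) g) := by
      refine (h _ _).trans ?_
      gcongr
      · exact p_D_le k f
      · exact p_mono (by omega) g
    have h2 : p k (mul f (D g)) ≤ C * (p (k + 1) f * p (k + 2) g) := by
      refine (h _ _).trans ?_
      gcongr
      · exact p_mono (by omega) f
      · exact p_D_le _ g
    rw [p_succ, D_mul]
    have := map_add_le_add (p k) (mul (D f) g) (mul f (D g))
    linarith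

/-- `H^k` is an algebra for `k ≥ 1`. -/
theorem p_mul_le (k : ℕ) :
    ∃ C, 0 ≤ C ∧ ∀ f g, p (k + 1) (mul f g) ≤ C * (p (k + 1) f * p (k + 1) g) := by
  obtain ⟨C, hC, h⟩ := p_mul_le_of_succ k
  refine ⟨1 + C + C, by positivity, fun f g => ?_⟩
  have h0 : ‖toL2 (mul f g)‖ ≤ p (k + 1) f * p (k + 1) g := by
    refine (norm_toL2_mul_le f g).trans ?_
    gcongr
    · exact p_mono (by omega) f
    · exact norm_toL2_le_p _ g
  have h1 : p k (mul (D f) g) ≤ C * (p (k + 1) f * p (k + 1) g) := by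
    refine (h _ _).trans ?_
    gcongr
    exact p_D_le k f
  have h2 : p k (mul f (D g)) ≤ C * (p (k + 1) f * p (k + 1) g) := by
    rw [mul_comm', _root_.mul_comm (p (k + 1) f)]
    refine (h _ _).trans ?_
    gcongr
    exact p_D_le _ g
  rw [p_succ, D_mul]
  have := map_add_le_add (p k) (mul (D f) g) (mul f (D g))
  linarith

theorem sobolevNorm_coe (k : ℕ) (f : HInf) :
    sobolevNorm k f.1 = Real.sqrt (∑ j ∈ Finset.range (k + 1), ‖toL2 ((D ^ j) f)‖ ^ 2) := by
  simp only [sobolevNorm, norm_toL2_sq, coe_D_pow]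

theorem sobolevNorm_le_p (k : ℕ) (f : HInf) : sobolevNorm k f.1 ≤ p k f := by
  rw [sobolevNorm_coe, p_apply]
  refine Real.sqrt_le_iff.2 ⟨Finset.sum_nonneg fun _ _ => norm_nonneg _, ?_⟩
  exact Finset.sum_sq_le_sq_sum_of_nonneg fun _ _ => norm_nonneg _

theorem p_le_sobolevNorm (k : ℕ) (f : HInf) : p k f ≤ (k + 1) * sobolevNorm k f.1 := by
  rw [sobolevNorm_coe, p_apply]
  have h : ∀ j ∈ Finset.range (k + 1), ‖toL2 ((D ^ j) f)‖ ≤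
      Real.sqrt (∑ j ∈ Finset.range (k + 1), ‖toL2 ((D ^ j) f)‖ ^ 2) := fun j hj =>
    Real.le_sqrt_of_sq_le (Finset.single_le_sum (f := fun j => ‖toL2 ((D ^ j) f)‖ ^ 2)
      (fun _ _ => sq_nonneg _) hj)
  simpa using Finset.sum_le_card_nsmul _ _ _ h

end HInf

/-! ### The resolvent of the second derivative -/

namespace HInf

open MeasureTheory

theorem D_pow_D (j : ℕ) (f : HInf) : (D ^ j) (D f) = D ((D ^ j) f) := by
  rw [← Module.End.mul_apply, ← pow_succ, pow_succ']
  rfl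

theorem inner_D_D (f : HInf) : inner ℂ (toL2 f) (toL2 (D (D f))) = -((‖toL2 (D f)‖ ^ 2 : ℝ) : ℂ) := by
  have h := inner_D f (D f)
  rw [inner_self_eq_norm_sq_to_K] at h
  rw [← neg_eq_iff_eq_neg.2 h.symm.symm]
  simp

/-- Integration by parts gives `Re ⟨f, f - μ f''⟩ = ‖f‖² + Re μ ‖f'‖²`; then Cauchy-Schwarz. The
bound is uniform over the closed half-plane, so it covers both the imaginary `μ` of NLS and the
`τ`-dependent `μ` of the hyperbolized system. -/
theorem norm_toL2_le_sub_smul_D_D {μ : ℂ} (hμ : 0 ≤ μ.re) (f : HInf) :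
    ‖toL2 f‖ ≤ ‖toL2 (f - μ • D (D f))‖ := by
  have h1 : (inner ℂ (toL2 f) (toL2 (f - μ • D (D f)))).re =
      ‖toL2 f‖ ^ 2 + μ.re * ‖toL2 (D f)‖ ^ 2 := by
    rw [map_sub, map_smul, inner_sub_right, inner_smul_right, inner_D_D,
      inner_self_eq_norm_sq_to_K]
    simp [← Complex.ofReal_pow]
  have h2 : (inner ℂ (toL2 f) (toL2 (f - μ • D (D f)))).re ≤
      ‖toL2 f‖ * ‖toL2 (f - μ • D (D f))‖ :=
    (Complex.re_le_norm _).trans (norm_inner_le_norm _ _)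
  have h3 : 0 ≤ μ.re * ‖toL2 (D f)‖ ^ 2 := by positivity
  rcases (norm_nonneg (toL2 f)).eq_or_lt with h | h
  · rw [← h]; exact norm_nonneg _
  · exact le_of_mul_le_mul_left (by nlinarith) h

theorem p_le_p_sub_smul_D_D {μ : ℂ} (hμ : 0 ≤ μ.re) (k : ℕ) (f : HInf) :
    p k f ≤ p k (f - μ • D (D f)) := by
  rw [p_apply, p_apply]
  refine Finset.sum_le_sum fun j _ => ?_
  have := norm_toL2_le_sub_smul_D_D hμ ((D ^ j) f)
  rwa [← D_pow_D, ← D_pow_D, ← map_smul, ← map_sub] at this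

theorem eq_zero_of_p_zero {f : HInf} (h : p 1 f = 0) : f = 0 :=
  Subtype.ext <| funext fun x => norm_le_zero_iff.1 <| (norm_apply_le_p f x).trans h.le

/-- Convolution with the exponential kernel of a half-line. -/
noncomputable def expConv (c : ℂ) (e : ℝ) (r : HInf) (x : ℝ) : ℂ :=
  ∫ s in Set.Ioi (0 : ℝ), Complex.exp (-c * s) * r.1 (x - e * s)

theorem norm_exp_mul_le (c : ℂ) (e : ℝ) (r : HInf) (x s : ℝ) :
    ‖Complex.exp (-c * s) * r.1 (x - e * s)‖ ≤ Real.exp (-c.re * s) * p 1 r := by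
  rw [norm_mul, Complex.norm_exp]
  gcongr
  · simp
  · exact norm_apply_le_p r _

theorem continuous_exp_mul (c : ℂ) (e : ℝ) (r : HInf) (x : ℝ) :
    Continuous fun s : ℝ => Complex.exp (-c * s) * r.1 (x - e * s) := by
  have := r.continuous
  fun_prop

theorem integrableOn_exp_mul {c : ℂ} (hc : 0 < c.re) (e : ℝ) (r : HInf) (x : ℝ) :
    IntegrableOn (fun s : ℝ => Complex.exp (-c * s) * r.1 (x - e * s)) (Set.Ioi 0) :=
  ((exp_neg_integrableOn_Ioi 0 hc).mul_const (p 1 r)).mono'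
    (continuous_exp_mul c e r x).aestronglyMeasurable
    (Eventually.of_forall fun s => norm_exp_mul_le c e r x s)

theorem norm_expConv_le (c : ℂ) (hc : 0 < c.re) (e : ℝ) (r : HInf) (x : ℝ) :
    ‖expConv c e r x‖ ≤ ∫ s in Set.Ioi (0 : ℝ), Real.exp (-c.re * s) * p 1 r :=
  norm_integral_le_of_norm_le ((exp_neg_integrableOn_Ioi 0 hc).mul_const (p 1 r))
    (Eventually.of_forall fun s => norm_exp_mul_le c e r x s)

theorem hasDerivAt_expConv {c : ℂ} (hc : 0 < c.re) (e : ℝ) (r : HInf) (x : ℝ) :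
    HasDerivAt (expConv c e r) (expConv c e (D r) x) x := by
  refine (hasDerivAt_integral_of_dominated_loc_of_deriv_le (s := Set.univ)
    (bound := fun s => Real.exp (-c.re * s) * p 1 (D r)) univ_mem
    (Eventually.of_forall fun y => (continuous_exp_mul c e r y).aestronglyMeasurable)
    (integrableOn_exp_mul hc e r x) (continuous_exp_mul c e (D r) x).aestronglyMeasurable
    (Eventually.of_forall fun s y _ => norm_exp_mul_le c e (D r) y s)
    ((exp_neg_integrableOn_Ioi 0 hc).mul_const (p 1 (D r)))
    (Eventually.of_forall fun s y _ => ?_)).2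
  exact ((r.hasDerivAt (y - e * s)).comp_sub_const y (e * s)).const_mul _

/-- The convolution solves `e w' + c w = r`. -/
theorem expConv_eq {c : ℂ} (hc : 0 < c.re) (e : ℝ) (r : HInf) (x : ℝ) :
    e * expConv c e (D r) x + c * expConv c e r x = r.1 x := by
  have hd : ∀ s ∈ Set.Ici (0 : ℝ), HasDerivAt
      (fun s : ℝ => Complex.exp (-c * s) * r.1 (x - e * s))
      (-c * (Complex.exp (-c * s) * r.1 (x - e * s)) -
        e * (Complex.exp (-c * s) * (D r).1 (x - e * s))) s := by
    intro s _
    have h1 : HasDerivAt (fun s : ℝ => Complex.exp (-c * s)) (Complex.exp (-c * s) * (-c * 1)) s :=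
      ((Complex.ofRealCLM.hasDerivAt (x := s)).const_mul (-c)).cexp
    have h2 : HasDerivAt (fun s : ℝ => r.1 (x - e * s)) (-(e * 1) • (D r).1 (x - e * s)) s :=
      HasDerivAt.scomp s (r.hasDerivAt (x - e * s)) (((hasDerivAt_id s).const_mul e).const_sub x)
    refine (h1.fun_mul h2).congr_deriv ?_
    rw [Complex.real_smul]
    push_cast
    ring
  have h1 := (integrableOn_exp_mul hc e r x).const_mul (-c)
  have h2 := (integrableOn_exp_mul hc e (D r) x).const_mul (e : ℂ)
  have hlim : Tendsto (fun s : ℝ => Complex.exp (-c * s) * r.1 (x - e * s)) atTop (𝓝 0) := by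
    refine squeeze_zero_norm (fun s => norm_exp_mul_le c e r x s) ?_
    have h3 : Tendsto (fun s : ℝ => -c.re * s) atTop atBot :=
      tendsto_id.const_mul_atTop_of_neg (by linarith)
    simpa using (Real.tendsto_exp_atBot.comp h3).mul_const (p 1 r)
  have h := integral_Ioi_of_hasDerivAt_of_tendsto' hd (h1.sub h2) hlim
  rw [integral_sub h1 h2, integral_const_mul, integral_const_mul] at h
  simp only [mul_zero, Complex.ofReal_zero, Complex.exp_zero, one_mul, sub_zero, zero_sub] at h
  unfold expConv
  linear_combination -h

/-- An energy estimate in place of Young's inequality: pairing `e w' + c w = r` with `w` bounds `Re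
c |w|²` by `(Re c)⁻¹ |r|²` minus `e` times the derivative of `|w|²`. Integrated over `[-n, n]`, the
boundary terms are controlled by the sup bound on `w`. -/
theorem memLp_expConv {c : ℂ} (hc : 0 < c.re) {e : ℝ} (he : |e| = 1) (r : HInf) :
    MemLp (expConv c e r) 2 volume := by
  set w := expConv c e r with hw
  set K := ∫ s in Set.Ioi (0 : ℝ), Real.exp (-c.re * s) * p 1 r with hK
  have hwd : ∀ x, HasDerivAt w (expConv c e (D r) x) x := hasDerivAt_expConv hc e r
  have hcont : Continuous w := continuous_iff_continuousAt.2 fun x => (hwd x).continuousAt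
  have hcont' : Continuous (expConv c e (D r)) :=
    continuous_iff_continuousAt.2 fun x => (hasDerivAt_expConv hc e (D r) x).continuousAt
  rw [memLp_two_iff_integrable_sq_norm hcont.aestronglyMeasurable]
  have hee : e * e = 1 := by rw [← abs_mul_abs_self, he, one_mul]
  have hsq : ∀ x, HasDerivAt (fun x => ‖w x‖ ^ 2) (2 * inner ℝ (w x) (expConv c e (D r) x)) x :=
    fun x => (hwd x).norm_sq
  have hpt : ∀ x, c.re * ‖w x‖ ^ 2 ≤ c.re⁻¹ * ‖r.1 x‖ ^ 2 -
      e * (2 * inner ℝ (w x) (expConv c e (D r) x)) := by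
    intro x
    have h1 : (e : ℂ) * expConv c e (D r) x = r.1 x - c * w x := by
      linear_combination expConv_eq hc e r x
    have h2 : e * inner ℝ (w x) (expConv c e (D r) x) =
        inner ℝ (w x) (r.1 x) - c.re * ‖w x‖ ^ 2 := by
      rw [← real_inner_smul_right, Complex.real_smul, h1, inner_sub_right]
      congr 1
      rw [Complex.inner, ← Complex.normSq_eq_norm_sq, Complex.normSq_apply]
      simp
      ring
    have h3 : inner ℝ (w x) (r.1 x) ≤ ‖w x‖ * ‖r.1 x‖ := real_inner_le_norm _ _
    have h4 : 2 * (‖w x‖ * ‖r.1 x‖) ≤ c.re * ‖w x‖ ^ 2 + c.re⁻¹ * ‖r.1 x‖ ^ 2 := by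
      have : 0 ≤ c.re⁻¹ * (c.re * ‖w x‖ - ‖r.1 x‖) ^ 2 := by positivity
      have h5 : c.re⁻¹ * (c.re * ‖w x‖ - ‖r.1 x‖) ^ 2 =
          c.re * ‖w x‖ ^ 2 + c.re⁻¹ * ‖r.1 x‖ ^ 2 - 2 * (‖w x‖ * ‖r.1 x‖) := by
        field_simp
        ring
      linarith
    linarith
  have hK0 : ∀ x, ‖w x‖ ≤ K := norm_expConv_le c hc e r
  have hbound : ∀ n : ℕ, ∫ x in (-(n : ℝ))..n, ‖‖w x‖ ^ 2‖ ≤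
      c.re⁻¹ * (c.re⁻¹ * ‖toL2 r‖ ^ 2 + 2 * K ^ 2) := by
    intro n
    have hnn : -(n : ℝ) ≤ n := by have : (0 : ℝ) ≤ n := n.cast_nonneg; linarith
    have hi1 : IntervalIntegrable (fun x => c.re * ‖w x‖ ^ 2) volume (-(n : ℝ)) n :=
      Continuous.intervalIntegrable (by fun_prop) _ _
    have hi2 : IntervalIntegrable (fun x => c.re⁻¹ * ‖r.1 x‖ ^ 2) volume (-(n : ℝ)) n := by
      have := r.continuous
      exact Continuous.intervalIntegrable (by fun_prop) _ _
    have hi3 : IntervalIntegrable (fun x => 2 * inner ℝ (w x) (expConv c e (D r) x)) volume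
        (-(n : ℝ)) n :=
      Continuous.intervalIntegrable (continuous_const.mul (hcont.inner hcont')) _ _
    have h1 := intervalIntegral.integral_mono_on hnn hi1 (hi2.sub (hi3.const_mul e))
      fun x _ => hpt x
    rw [intervalIntegral.integral_sub hi2 (hi3.const_mul e), intervalIntegral.integral_const_mul,
      intervalIntegral.integral_const_mul, intervalIntegral.integral_const_mul,
      intervalIntegral.integral_eq_sub_of_hasDerivAt (fun x _ => hsq x) hi3] at h1
    have h2 : ∫ x in (-(n : ℝ))..n, ‖r.1 x‖ ^ 2 ≤ ‖toL2 r‖ ^ 2 := by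
      rw [norm_toL2_sq, intervalIntegral.integral_of_le hnn]
      exact setIntegral_le_integral r.integrable_norm_sq
        (Eventually.of_forall fun x => sq_nonneg _)
    have h3 : -(e * (‖w n‖ ^ 2 - ‖w (-n)‖ ^ 2)) ≤ 2 * K ^ 2 := by
      have a1 : ‖w n‖ ^ 2 ≤ K ^ 2 := pow_le_pow_left₀ (norm_nonneg _) (hK0 _) 2
      have a2 : ‖w (-n)‖ ^ 2 ≤ K ^ 2 := pow_le_pow_left₀ (norm_nonneg _) (hK0 _) 2
      calc -(e * (‖w n‖ ^ 2 - ‖w (-n)‖ ^ 2)) ≤ |e * (‖w n‖ ^ 2 - ‖w (-n)‖ ^ 2)| := neg_le_abs _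
        _ = |‖w n‖ ^ 2 - ‖w (-n)‖ ^ 2| := by rw [abs_mul, he, one_mul]
        _ ≤ 2 * K ^ 2 := by
          rw [abs_le]
          constructor <;> nlinarith [sq_nonneg ‖w n‖, sq_nonneg ‖w (-n)‖]
    have h4 : c.re * ∫ x in (-(n : ℝ))..n, ‖‖w x‖ ^ 2‖ ≤ c.re⁻¹ * ‖toL2 r‖ ^ 2 + 2 * K ^ 2 := by
      simp only [norm_pow, norm_norm]
      have := mul_le_mul_of_nonneg_left h2 (inv_nonneg.2 hc.le)
      linarith
    calc _ = c.re⁻¹ * (c.re * ∫ x in (-(n : ℝ))..n, ‖‖w x‖ ^ 2‖) := by field_simp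
      _ ≤ _ := mul_le_mul_of_nonneg_left h4 (inv_nonneg.2 hc.le)
  refine integrable_of_intervalIntegral_norm_bounded _ (fun n : ℕ => ?_)
    (tendsto_neg_atTop_atBot.comp tendsto_natCast_atTop_atTop) tendsto_natCast_atTop_atTop
    (Eventually.of_forall hbound)
  exact (Continuous.integrableOn_Icc (by fun_prop)).mono_set Set.Ioc_subset_Icc_self

theorem expConv_mem {c : ℂ} (hc : 0 < c.re) {e : ℝ} (he : |e| = 1) (r : HInf) :
    expConv c e r ∈ HInfty :=
  mem_HInfty_of_deriv_mem {w | ∃ r, w = expConv c e r}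
    (by rintro _ ⟨r, rfl⟩ x; exact (hasDerivAt_expConv hc e r x).differentiableAt)
    (by rintro _ ⟨r, rfl⟩; exact memLp_expConv hc he r)
    (by rintro _ ⟨r, rfl⟩; exact ⟨D r, funext fun x => (hasDerivAt_expConv hc e r x).deriv⟩)
    ⟨r, rfl⟩

theorem exists_smul_D_add_smul_eq {c : ℂ} (hc : 0 < c.re) {e : ℝ} (he : |e| = 1) (r : HInf) :
    ∃ w : HInf, (e : ℂ) • D w + c • w = r := by
  refine ⟨⟨_, expConv_mem hc he r⟩, Subtype.ext <| funext fun x => ?_⟩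
  change (e : ℂ) * deriv (expConv c e r) x + c * expConv c e r x = r.1 x
  rw [(hasDerivAt_expConv hc e r x).deriv, expConv_eq hc]

/-- With `c² = μ⁻¹` the operator factors as `μ⁻¹ - D² = (c - D) (c + D)`, and for `Re c > 0` each
first-order factor is inverted by convolution with an exponential on a half-line. -/
theorem exists_sub_smul_D_D_eq {μ : ℂ} (hμ : 0 ≤ μ.re) (hμ0 : μ ≠ 0) (r : HInf) :
    ∃ w : HInf, w - μ • D (D w) = r := by
  have hre : 0 ≤ (μ⁻¹).re := by
    rw [Complex.inv_re]
    exact div_nonneg hμ (Complex.normSq_nonneg _)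
  -- A square root of `μ⁻¹` is not purely imaginary, as its square would then be real and
  -- nonpositive, against `Re μ⁻¹ ≥ 0` and `μ⁻¹ ≠ 0`. Its sign is free.
  obtain ⟨c, hc, hc2⟩ : ∃ c : ℂ, 0 < c.re ∧ c * c = μ⁻¹ := by
    obtain ⟨c, hc⟩ := IsAlgClosed.exists_pow_nat_eq μ⁻¹ (n := 2) (by norm_num)
    have hre' : c.re ≠ 0 := by
      intro h0
      rw [← hc, sq, Complex.mul_re, h0] at hre
      have him : c.im = 0 := by nlinarith
      have : c = 0 := Complex.ext h0 him
      rw [this] at hc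
      exact inv_ne_zero hμ0 (by rw [← hc]; simp)
    rcases lt_or_gt_of_ne hre' with h | h
    · exact ⟨-c, by simpa using h, by rw [← hc]; ring⟩
    · exact ⟨c, h, by rw [← hc]; ring⟩
  obtain ⟨v, hv⟩ := exists_smul_D_add_smul_eq hc (e := -1) (by simp) (μ⁻¹ • r)
  obtain ⟨w, hw⟩ := exists_smul_D_add_smul_eq hc (e := 1) (by simp) v
  refine ⟨w, ?_⟩
  rw [← hw] at hv
  simp only [map_add, map_smul, Complex.ofReal_one, Complex.ofReal_neg] at hv
  have h1 : μ⁻¹ • w - D (D w) = μ⁻¹ • r := by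
    rw [← hv, ← hc2]
    module
  calc w - μ • D (D w) = μ • (μ⁻¹ • w - D (D w)) := by rw [smul_sub, smul_inv_smul₀ hμ0]
    _ = r := by rw [h1, smul_inv_smul₀ hμ0]

theorem bijective_sub_smul_D_D {μ : ℂ} (hμ : 0 ≤ μ.re) :
    Function.Bijective fun w : HInf => w - μ • D (D w) := by
  constructor
  · intro v w h
    have h1 : (v - w) - μ • D (D (v - w)) = 0 := by
      simp only [map_sub, smul_sub] at h ⊢
      rw [sub_sub_sub_comm, h, sub_self]
    have h2 := p_le_p_sub_smul_D_D hμ 1 (v - w)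
    rw [h1, map_zero] at h2
    exact sub_eq_zero.1 (eq_zero_of_p_zero (le_antisymm h2 (apply_nonneg _ _)))
  · intro r
    by_cases hμ0 : μ = 0
    · exact ⟨r, by simp [hμ0]⟩
    · exact exists_sub_smul_D_D_eq hμ hμ0 r

end HInf

/-! ### Curves in `H^∞` that are differentiable pointwise -/

open MeasureTheory in
theorem HInfty.mem_of_hasCompactSupport {f : ℝ → ℂ} (hf : ContDiff ℝ ∞ f)
    (hc : HasCompactSupport f) : f ∈ HInfty :=
  mem_HInfty_of_deriv_mem {f | ContDiff ℝ ∞ f ∧ HasCompactSupport f}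
    (fun _ h => h.1.differentiable (by simp))
    (fun _ h => h.1.continuous.memLp_of_hasCompactSupport h.2)
    (fun _ h => ⟨(contDiff_infty_iff_deriv.1 h.1).2, h.2.deriv⟩) ⟨hf, hc⟩

namespace HInf

open MeasureTheory

theorem hasCompactSupport_D_pow {f : HInf} (hf : HasCompactSupport f.1) (m : ℕ) :
    HasCompactSupport ((D ^ m) f).1 := by
  induction m generalizing f with
  | zero => simpa using hf
  | succ m ih => rw [pow_succ]; exact ih (f := D f) hf.deriv

theorem inner_D_pow (m : ℕ) (f g : HInf) :
    inner ℂ (toL2 ((D ^ m) f)) (toL2 g) = (-1) ^ m * inner ℂ (toL2 f) (toL2 ((D ^ m) g)) := by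
  induction m generalizing f with
  | zero => simp
  | succ m ih =>
    rw [pow_succ D, Module.End.mul_apply, Module.End.mul_apply, ih, inner_D, D_pow_D]
    ring

theorem exists_cutoff (f : HInf) (n : ℕ) : ∃ w : HInf, HasCompactSupport w.1 ∧ ∃ χ : ℝ → ℝ,
    (∀ x, w.1 x = χ x * f.1 x) ∧ Continuous χ ∧ (∀ x, 0 ≤ χ x) ∧ (∀ x, χ x ≤ 1) ∧
      ∀ x : ℝ, |x| ≤ (n : ℝ) → χ x = 1 := by
  let χ : ContDiffBump (0 : ℝ) := ⟨n + 1, n + 2, by positivity, by linarith⟩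
  have hcs : HasCompactSupport fun x => (χ x : ℂ) * f.1 x :=
    HasCompactSupport.mul_right (χ.hasCompactSupport.comp_left Complex.ofReal_zero)
  have hcd : ContDiff ℝ ∞ fun x => (χ x : ℂ) * f.1 x :=
    (Complex.ofRealCLM.contDiff.comp χ.contDiff).mul f.2.1
  refine ⟨⟨_, HInfty.mem_of_hasCompactSupport hcd hcs⟩, hcs, χ, fun x => rfl, χ.continuous,
    fun x => χ.nonneg, fun x => χ.le_one, fun x hx => χ.one_of_mem_closedBall ?_⟩
  rw [mem_closedBall_zero_iff, Real.norm_eq_abs]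
  change |x| ≤ (n : ℝ) + 1
  linarith

/-- Paired with a compactly supported function, a pointwise differentiable curve becomes a
differentiable scalar function by dominated convergence, and the mean value theorem applies to its
real part. The bound `K` serves only as the dominating constant. -/
theorem norm_inner_le_of_hasDerivWithinAt {s : ℝ} (hs : 0 < s) {e d : ℝ → HInf}
    (hd : ∀ x, ∀ r ∈ Set.Icc 0 s,
      HasDerivWithinAt (fun r => (e r).1 x) ((d r).1 x) (Set.Icc 0 s) r) (he : e 0 = 0) {K : ℝ}
    (hK : ∀ r ∈ Set.Icc 0 s, p 1 (d r) ≤ K) {f : HInf} (hf : HasCompactSupport f.1) {B : ℝ}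
    (hB : ∀ r ∈ Set.Icc 0 s, ‖inner ℂ (toL2 f) (toL2 (d r))‖ ≤ B) :
    |(inner ℂ (toL2 f) (toL2 (e s))).re| ≤ s * B := by
  have hdK : ∀ x, ∀ r ∈ Set.Icc 0 s, ‖(d r).1 x‖ ≤ K := fun x r hr =>
    (norm_apply_le_p _ x).trans (hK r hr)
  have hK0 : 0 ≤ K := (norm_nonneg _).trans (hdK 0 0 (Set.left_mem_Icc.2 hs.le))
  have heK : ∀ x, ∀ r ∈ Set.Icc 0 s, ‖(e r).1 x‖ ≤ K * s := by
    intro x r hr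
    have h := norm_image_sub_le_of_norm_deriv_le_segment' (fun r hr => hd x r hr)
      (fun r hr => hdK x r (Set.Ico_subset_Icc_self hr)) r hr
    rw [he] at h
    simp only [ZeroMemClass.coe_zero, Pi.zero_apply, sub_zero] at h
    exact h.trans (mul_le_mul_of_nonneg_left hr.2 hK0)
  have hfi : Integrable fun x => ‖f.1 x‖ :=
    (f.continuous.integrable_of_hasCompactSupport hf).norm
  have hmeas : ∀ g : HInf, AEStronglyMeasurable (fun x => star (f.1 x) * g.1 x) volume := fun g =>
    (f.continuous.star.mul g.continuous).aestronglyMeasurable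
  let θ : ℝ → ℂ := fun r => ∫ x, star (f.1 x) * (e r).1 x
  let θ' : ℝ → ℂ := fun r => ∫ x, star (f.1 x) * (d r).1 x
  have hθc : ContinuousOn θ (Set.Icc 0 s) := by
    refine continuousOn_of_dominated (bound := fun x => ‖f.1 x‖ * (K * s))
      (fun r _ => hmeas (e r)) (fun r hr => Eventually.of_forall fun x => ?_)
      (hfi.mul_const _) (Eventually.of_forall fun x => ?_)
    · rw [norm_mul, norm_star]
      exact mul_le_mul_of_nonneg_left (heK x r hr) (norm_nonneg _)
    · exact continuousOn_const.mul fun r hr => (hd x r hr).continuousWithinAt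
  have hθd : ∀ r ∈ Set.Ioo 0 s, HasDerivAt θ (θ' r) r := by
    intro r hr
    refine (hasDerivAt_integral_of_dominated_loc_of_deriv_le (s := Set.Ioo 0 s)
      (bound := fun x => ‖f.1 x‖ * K) (F' := fun r x => star (f.1 x) * (d r).1 x)
      (isOpen_Ioo.mem_nhds hr) (Eventually.of_forall fun r => hmeas (e r)) ?_ (hmeas (d r))
      (Eventually.of_forall fun x r hr => ?_) (hfi.mul_const _)
      (Eventually.of_forall fun x r hr => ?_)).2
    · exact (conj f).integrable_mul (e r)
    · rw [norm_mul, norm_star]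
      exact mul_le_mul_of_nonneg_left (hdK x r (Set.Ioo_subset_Icc_self hr)) (norm_nonneg _)
    · exact ((hd x r (Set.Ioo_subset_Icc_self hr)).hasDerivAt
        (Icc_mem_nhds hr.1 hr.2)).const_mul _
  obtain ⟨c, hc, hc'⟩ := exists_hasDerivAt_eq_slope (fun r => (θ r).re) (fun r => (θ' r).re) hs
    (Complex.continuous_re.comp_continuousOn hθc) fun r hr =>
      Complex.reCLM.hasFDerivAt.comp_hasDerivAt r (hθd r hr)
  have hθ0 : θ 0 = 0 := by simp [θ, he]
  rw [hθ0, Complex.zero_re, sub_zero, sub_zero, eq_div_iff hs.ne'] at hc'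
  have hb := hB c (Set.Ioo_subset_Icc_self hc)
  rw [inner_toL2] at hb ⊢
  change |(θ s).re| ≤ s * B
  rw [← hc', abs_mul, abs_of_pos hs, mul_comm]
  exact mul_le_mul_of_nonneg_left ((Complex.abs_re_le_norm _).trans hb) hs.le

/-- Duality: with `g = D ^ m (e s)`, test against `D ^ m` of a cutoff of `g` and move the
derivatives onto the curve. Removing the cutoff yields `‖g‖² ≤ s ‖g‖ B`. -/
theorem norm_toL2_D_pow_le_of_hasDerivWithinAt {s : ℝ} (hs : 0 ≤ s) {e d : ℝ → HInf}
    (hd : ∀ x, ∀ r ∈ Set.Icc 0 s,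
      HasDerivWithinAt (fun r => (e r).1 x) ((d r).1 x) (Set.Icc 0 s) r) (he : e 0 = 0) {K : ℝ}
    (hK : ∀ r ∈ Set.Icc 0 s, p 1 (d r) ≤ K) (m : ℕ) {B : ℝ}
    (hB : ∀ r ∈ Set.Icc 0 s, ‖toL2 ((D ^ m) (d r))‖ ≤ B) : ‖toL2 ((D ^ m) (e s))‖ ≤ s * B := by
  have hB0 : 0 ≤ B := (norm_nonneg _).trans (hB 0 (Set.left_mem_Icc.2 hs))
  rcases hs.eq_or_lt with rfl | hs
  · simp [he]
  set g := (D ^ m) (e s)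
  have key : ∀ n : ℕ, ∃ χ : ℝ → ℝ, Continuous χ ∧ (∀ x, 0 ≤ χ x) ∧ (∀ x, χ x ≤ 1) ∧
      (∀ x : ℝ, |x| ≤ (n : ℝ) → χ x = 1) ∧ ∫ x, χ x * ‖g.1 x‖ ^ 2 ≤ s * (‖toL2 g‖ * B) := by
    intro n
    obtain ⟨w, hw, χ, hχ, hχc, hχ0, hχ1, hχn⟩ := exists_cutoff g n
    refine ⟨χ, hχc, hχ0, hχ1, hχn, ?_⟩
    have hwg : ‖toL2 w‖ ≤ ‖toL2 g‖ := by
      have := norm_toL2_le_of_norm_le (f := w) (g := g) (c := 1) fun x => by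
        rw [hχ, norm_mul, Complex.norm_real, Real.norm_of_nonneg (hχ0 x)]
        exact mul_le_mul_of_nonneg_right (hχ1 x) (norm_nonneg _)
      rwa [one_mul] at this
    have h1 := norm_inner_le_of_hasDerivWithinAt hs hd he hK (hasCompactSupport_D_pow hw m)
      (B := ‖toL2 g‖ * B) (fun r hr => by
        rw [inner_D_pow, norm_mul, norm_pow, norm_neg, norm_one, one_pow, one_mul]
        exact (norm_inner_le_norm _ _).trans
          (mul_le_mul hwg (hB r hr) (norm_nonneg _) (norm_nonneg _)))
    have h2 : inner ℂ (toL2 w) (toL2 g) = ((∫ x, χ x * ‖g.1 x‖ ^ 2 : ℝ) : ℂ) := by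
      rw [inner_toL2, ← integral_complex_ofReal]
      congr 1
      ext x
      rw [hχ, star_mul', Complex.star_def, Complex.conj_ofReal, mul_assoc,
        ← Complex.normSq_eq_conj_mul_self, Complex.normSq_eq_norm_sq]
      push_cast
      rfl
    have h3 : |(inner ℂ (toL2 ((D ^ m) w)) (toL2 (e s))).re| = |∫ x, χ x * ‖g.1 x‖ ^ 2| := by
      rw [inner_D_pow, h2]
      rcases neg_one_pow_eq_or ℂ m with h | h <;> rw [h] <;> simp
    rw [h3] at h1
    exact (le_abs_self _).trans h1
  choose χ hχc hχ0 hχ1 hχn hχ using key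
  have hlim : Tendsto (fun n => ∫ x, χ n x * ‖g.1 x‖ ^ 2) atTop (𝓝 (∫ x, ‖g.1 x‖ ^ 2)) := by
    refine tendsto_integral_of_dominated_convergence (fun x => ‖g.1 x‖ ^ 2)
      (fun n => ((hχc n).mul (g.continuous.norm.pow 2)).aestronglyMeasurable) g.integrable_norm_sq
      (fun n => Eventually.of_forall fun x => ?_) (Eventually.of_forall fun x => ?_)
    · rw [norm_mul, Real.norm_of_nonneg (hχ0 n x), norm_pow, norm_norm]
      exact mul_le_of_le_one_left (sq_nonneg _) (hχ1 n x)
    · refine tendsto_const_nhds.congr' ?_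
      filter_upwards [eventually_ge_atTop ⌈|x|⌉₊] with n hn
      rw [hχn n x ((Nat.le_ceil _).trans (by exact_mod_cast hn)), one_mul]
  have h := le_of_tendsto' hlim hχ
  rw [← norm_toL2_sq] at h
  rcases (norm_nonneg (toL2 g)).eq_or_lt with h0 | h0
  · rw [← h0]; positivity
  · exact le_of_mul_le_mul_left (by linarith) h0

theorem p_le_of_hasDerivWithinAt {s : ℝ} (hs : 0 ≤ s) {e d : ℝ → HInf}
    (hd : ∀ x, ∀ r ∈ Set.Icc 0 s,
      HasDerivWithinAt (fun r => (e r).1 x) ((d r).1 x) (Set.Icc 0 s) r) (he : e 0 = 0) {K : ℝ}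
    (hK : ∀ r ∈ Set.Icc 0 s, p 1 (d r) ≤ K) (k : ℕ) {B : ℝ}
    (hB : ∀ r ∈ Set.Icc 0 s, p k (d r) ≤ B) : p k (e s) ≤ (k + 1) * s * B := by
  have h := Finset.sum_le_card_nsmul (Finset.range (k + 1)) (fun j => ‖toL2 ((D ^ j) (e s))‖) (s * B)
    fun j hj => norm_toL2_D_pow_le_of_hasDerivWithinAt hs hd he hK j fun r hr =>
      (norm_toL2_D_pow_le_p (Nat.lt_succ_iff.1 (Finset.mem_range.1 hj)) _).trans (hB r hr)
  rw [Finset.card_range, nsmul_eq_mul] at h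
  rw [p_apply]
  push_cast at h
  linarith

/-! ### The cubic term, the skew-adjoint linear part and its resolvent. -/

/-- The nonlinear Schrödinger equation as a tame system on `H^∞`. -/
noncomputable def nlsT (κ : ℝ) (a b c : HInf) : HInf := (Complex.I * κ) • mul (mul a (conj b)) c

/-- The operator `i ∂ₓ²`. -/
noncomputable def nlsL : HInf →ₗ[ℂ] HInf := Complex.I • (D ∘ₗ D)

theorem nlsL_apply (f : HInf) : nlsL f = Complex.I • D (D f) := rfl

theorem isTrilinear_nlsT (κ : ℝ) : IsTrilinear (nlsT κ) where
  left b c := by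
    constructor <;> intros <;> apply Subtype.ext <;> funext x <;>
      simp [nlsT, mul, conj] <;> ring
  mid a c := by
    constructor <;> intros <;> apply Subtype.ext <;> funext x <;>
      simp [nlsT, mul, conj] <;> ring
  right a b := by
    constructor <;> intros <;> apply Subtype.ext <;> funext x <;>
      simp [nlsT, mul, conj] <;> ring

theorem p_nlsT_le (κ : ℝ) (k : ℕ) : ∃ C, 0 ≤ C ∧ ∀ a b c,
    p (k + 1) (nlsT κ a b c) ≤ C * (p (k + 1) a * p (k + 1) b * p (k + 1) c) := by
  obtain ⟨C, hC, h⟩ := p_mul_le k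
  refine ⟨|κ| * (C * C), by positivity, fun a b c => ?_⟩
  rw [nlsT, map_smul_eq_mul, norm_mul, Complex.norm_I, one_mul, Complex.norm_real,
    Real.norm_eq_abs]
  have h1 := h a (conj b)
  rw [p_conj] at h1
  calc |κ| * p (k + 1) (mul (mul a (conj b)) c)
      ≤ |κ| * (C * (p (k + 1) (mul a (conj b)) * p (k + 1) c)) := by gcongr; exact h _ _
    _ ≤ |κ| * (C * (C * (p (k + 1) a * p (k + 1) b) * p (k + 1) c)) := by gcongr
    _ = _ := by ring

theorem p_nlsL_le (k : ℕ) (a : HInf) : p k (nlsL a) ≤ p (k + 2) a := by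
  rw [nlsL_apply, map_smul_eq_mul, Complex.norm_I, one_mul]
  exact (p_D_le k _).trans (p_D_le (k + 1) a)

theorem re_mul_I (c : ℝ) : 0 ≤ ((c : ℂ) * Complex.I).re := by simp

theorem sub_smul_nlsL (c : ℝ) (a : HInf) :
    a - c • nlsL a = a - ((c : ℂ) * Complex.I) • D (D a) := by
  rw [nlsL_apply, ← smul_smul]
  rfl

/-- The multiplier `c i` has zero real part, so the sign of `c` is irrelevant and negative diagonal
coefficients are admissible. -/
theorem p_le_p_sub_smul_nlsL (k : ℕ) (c : ℝ) (a : HInf) : p k a ≤ p k (a - c • nlsL a) := by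
  rw [sub_smul_nlsL]
  exact p_le_p_sub_smul_D_D (re_mul_I c) k a

theorem bijective_sub_smul_nlsL (c : ℝ) : Function.Bijective fun a : HInf => a - c • nlsL a := by
  simp only [sub_smul_nlsL]
  exact bijective_sub_smul_D_D (re_mul_I c)

/-- Evaluation at a point. -/
def ev (x : ℝ) : HInf →ₗ[ℝ] ℂ where
  toFun f := f.1 x
  map_add' _ _ := rfl
  map_smul' _ _ := rfl

/-- The nonlinear Schrödinger equation as a tame system. -/
noncomputable def nls (κ : ℝ) : TameSystem HInf ℝ ℂ where
  N k := (p k).restrictScalars ℝ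
  T := nlsT κ
  g := nlsL.restrictScalars ℝ
  ev := ev
  trilinear := isTrilinear_nlsT κ
  T_le k := by
    obtain ⟨C, hC, h⟩ := p_nlsT_le κ k
    exact ⟨C, k + 1, fun a b c => (p_mono (by omega) _).trans (h a b c)⟩
  g_le k := ⟨1, k + 2, fun a => by rw [one_mul]; exact p_nlsL_le k a⟩
  resolvent_le := ⟨1, one_pos, fun k => ⟨1, fun c _ a => by
    rw [one_mul]
    exact p_le_p_sub_smul_nlsL k c a⟩⟩
  mean_value k := ⟨k + 1, fun s hs e d hd he hb B hB => by
    obtain ⟨K, hK⟩ := hb 1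
    exact p_le_of_hasDerivWithinAt hs hd he hK k hB⟩

end HInf

/-! ### Nonnegative polynomials and stability -/

namespace Polynomial

/-- A real polynomial that is nonnegative on the real line is the squared modulus of a complex
polynomial. -/
theorem exists_mul_map_conj_of_nonneg (f : Polynomial ℝ) (hf : ∀ x, 0 ≤ f.eval x) :
    ∃ q : Polynomial ℂ, f.map Complex.ofRealHom = q.map (starRingEnd ℂ) * q := by
  induction hn : f.natDegree using Nat.strong_induction_on generalizing f with
  | _ n ih =>
  by_cases hdeg : f.natDegree = 0
  · obtain ⟨a, ha⟩ := natDegree_eq_zero.1 hdeg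
    have ha0 : 0 ≤ a := by simpa [← ha] using hf 0
    refine ⟨C (Real.sqrt a : ℂ), ?_⟩
    rw [← ha, map_C, map_C, ← C_mul]
    congr 1
    rw [Complex.conj_ofReal, ← Complex.ofReal_mul, Real.mul_self_sqrt ha0]
    rfl
  have hf0 : f ≠ 0 := by rintro rfl; simp at hdeg
  obtain ⟨z, hz⟩ := Complex.exists_root (f := f.map Complex.ofRealHom)
    (by rw [degree_map]; exact natDegree_pos_iff_degree_pos.1 (Nat.pos_of_ne_zero hdeg))
  have hz' : aeval z f = 0 := by
    rw [IsRoot, eval_map] at hz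
    exact hz
  -- A real root of a nonnegative polynomial is at least double, and a nonreal root comes with its
  -- conjugate. In both cases `(X - z̄) (X - z)` splits off with a nonnegative quotient of smaller
  -- degree.
  by_cases him : z.im = 0
  · have hzre : (z.re : ℂ) = z := Complex.ext rfl him.symm
    have hroot : f.IsRoot z.re := by
      rw [← hzre] at hz
      have : ((f.eval z.re : ℝ) : ℂ) = 0 := by
        rw [← hz.eq_zero]
        exact (eval_map_apply (f := Complex.ofRealHom) (p := f) z.re).symm
      exact_mod_cast this
    obtain ⟨r, hr⟩ := dvd_iff_isRoot.2 hroot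
    have heval : ∀ x, f.eval x = (x - z.re) * r.eval x := fun x => by rw [hr]; simp
    -- The quotient by `X - z.re` is nonpositive to the left of the root and nonnegative to the
    -- right, so it vanishes there.
    have hr0 : r.IsRoot z.re := by
      have hlim : ∀ s : Set ℝ, Tendsto (fun x => r.eval x) (𝓝[s] z.re) (𝓝 (r.eval z.re)) :=
        fun s => r.continuous.continuousAt.mono_left nhdsWithin_le_nhds
      refine le_antisymm (le_of_tendsto (hlim (Set.Iio z.re)) ?_)
        (ge_of_tendsto (hlim (Set.Ioi z.re)) ?_)
      · filter_upwards [self_mem_nhdsWithin] with x hx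
        have h1 := hf x
        rw [heval] at h1
        exact nonpos_of_mul_nonneg_right h1 (sub_neg.2 hx)
      · filter_upwards [self_mem_nhdsWithin] with x hx
        have h1 := hf x
        rw [heval] at h1
        exact nonneg_of_mul_nonneg_right h1 (sub_pos.2 hx)
    obtain ⟨t, ht⟩ := dvd_iff_isRoot.2 hr0
    have ht0 : t ≠ 0 := by rintro rfl; exact hf0 (by rw [hr, ht]; simp)
    have htn : ∀ x, 0 ≤ t.eval x := by
      have h1 : ∀ x ≠ z.re, 0 ≤ t.eval x := by
        intro x hx
        have h2 := hf x
        rw [heval, ht, eval_mul, eval_sub, eval_X, eval_C, ← mul_assoc] at h2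
        exact nonneg_of_mul_nonneg_right h2 (mul_self_pos.2 (sub_ne_zero.2 hx))
      intro x
      by_cases hx : x = z.re
      · rw [hx]
        exact ge_of_tendsto (t.continuous.continuousAt.mono_left nhdsWithin_le_nhds)
          (eventually_mem_nhdsWithin.mono fun x (hx : x ∈ ({z.re}ᶜ : Set ℝ)) => h1 x hx)
      · exact h1 x hx
    obtain ⟨q, hq⟩ := ih t.natDegree (by
      rw [← hn, hr, ht, natDegree_mul (X_sub_C_ne_zero _) (mul_ne_zero (X_sub_C_ne_zero _) ht0),
        natDegree_mul (X_sub_C_ne_zero _) ht0, natDegree_X_sub_C]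
      omega) t htn rfl
    refine ⟨(X - C z) * q, ?_⟩
    have hzc : (starRingEnd ℂ) z = z := Complex.conj_eq_iff_im.2 him
    rw [hr, ht]
    simp only [Polynomial.map_mul, Polynomial.map_sub, map_X, map_C, hq, hzc]
    rw [show Complex.ofRealHom z.re = z from hzre]
    ring
  · obtain ⟨r, hr⟩ := f.quadratic_dvd_of_aeval_eq_zero_im_ne_zero hz' him
    have hr0 : r ≠ 0 := by rintro rfl; exact hf0 (by rw [hr]; simp)
    set d : Polynomial ℝ := X ^ 2 - C (2 * z.re) * X + C (‖z‖ ^ 2) with hd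
    have hd2 : d.natDegree = 2 := by
      rw [hd]
      compute_degree!
    have hd0 : d ≠ 0 := by intro h; rw [h] at hd2; simp at hd2
    have hrn : ∀ x, 0 ≤ r.eval x := by
      intro x
      have h1 := hf x
      rw [hr, eval_mul] at h1
      refine nonneg_of_mul_nonneg_right h1 ?_
      have h2 : d.eval x = (x - z.re) ^ 2 + z.im ^ 2 := by
        rw [hd, ← Complex.normSq_eq_norm_sq, Complex.normSq_apply]
        simp
        ring
      rw [h2]
      positivity
    obtain ⟨q, hq⟩ := ih r.natDegree (by
      rw [← hn, hr, natDegree_mul hd0 hr0, hd2]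
      omega) r hrn rfl
    refine ⟨(X - C z) * q, ?_⟩
    have hdm : d.map Complex.ofRealHom = (X - C ((starRingEnd ℂ) z)) * (X - C z) := by
      have h1 : ((2 * z.re : ℝ) : ℂ) = z + (starRingEnd ℂ) z := (Complex.add_conj z).symm
      have h2 : ((‖z‖ ^ 2 : ℝ) : ℂ) = z * (starRingEnd ℂ) z := by
        rw [Complex.mul_conj, Complex.normSq_eq_norm_sq]
      rw [hd]
      simp only [Polynomial.map_mul, Polynomial.map_sub, Polynomial.map_add, Polynomial.map_pow,
        map_X, map_C, Complex.ofRealHom_eq_coe, h1, h2]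
      simp only [C_add, C_mul]
      ring
    rw [hr]
    simp only [Polynomial.map_mul, Polynomial.map_sub, map_X, map_C, hq, hdm]
    ring

theorem eval_map_conj (q : Polynomial ℂ) (x : ℝ) :
    (q.map (starRingEnd ℂ)).eval (x : ℂ) = (starRingEnd ℂ) (q.eval (x : ℂ)) := by
  have := eval₂_at_apply (p := q) (starRingEnd ℂ) (x : ℂ)
  rwa [Complex.conj_ofReal, ← eval_map] at this

/-- If `‖P y‖ ≤ ‖Q y‖` for all real `y`, the difference of the squared moduli is a squared modulus. -/
theorem exists_mul_map_conj_of_norm_eval_le (P Q : Polynomial ℂ)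
    (h : ∀ y : ℝ, ‖P.eval (y : ℂ)‖ ≤ ‖Q.eval (y : ℂ)‖) : ∃ q : Polynomial ℂ,
      Q.map (starRingEnd ℂ) * Q - P.map (starRingEnd ℂ) * P = q.map (starRingEnd ℂ) * q := by
  have hconj : ∀ R : Polynomial ℂ, (R.map (starRingEnd ℂ) * R).map (starRingEnd ℂ) =
      R.map (starRingEnd ℂ) * R := by
    intro R
    have : (starRingEnd ℂ).comp (starRingEnd ℂ) = RingHom.id ℂ := RingHom.ext Complex.conj_conj
    rw [Polynomial.map_mul, Polynomial.map_map, this, Polynomial.map_id, mul_comm]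
  -- The coefficients of `Q̄ Q - P̄ P` are invariant under conjugation, hence real.
  obtain ⟨E, hE⟩ : ∃ E : Polynomial ℝ, E.map Complex.ofRealHom =
      Q.map (starRingEnd ℂ) * Q - P.map (starRingEnd ℂ) * P := by
    refine (mem_lifts _).1 ((lifts_iff_coeff_lifts _).2 fun n => ?_)
    have h1 : (starRingEnd ℂ) ((Q.map (starRingEnd ℂ) * Q - P.map (starRingEnd ℂ) * P).coeff n) =
        (Q.map (starRingEnd ℂ) * Q - P.map (starRingEnd ℂ) * P).coeff n := by
      rw [← coeff_map, Polynomial.map_sub, hconj, hconj]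
    obtain ⟨r, hr⟩ := Complex.conj_eq_iff_real.1 h1
    exact ⟨r, hr.symm⟩
  have hEn : ∀ x, 0 ≤ E.eval x := by
    intro x
    have h1 : ((E.eval x : ℝ) : ℂ) = ((‖Q.eval (x : ℂ)‖ ^ 2 - ‖P.eval (x : ℂ)‖ ^ 2 : ℝ) : ℂ) := by
      rw [show ((E.eval x : ℝ) : ℂ) = (E.map Complex.ofRealHom).eval (x : ℂ) by
        rw [eval_map]; exact (eval₂_at_apply Complex.ofRealHom x).symm, hE]
      simp only [eval_sub, eval_mul, eval_map_conj, ← Complex.normSq_eq_conj_mul_self,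
        Complex.normSq_eq_norm_sq]
      push_cast
      rfl
    rw [Complex.ofReal_injective h1]
    have := pow_le_pow_left₀ (norm_nonneg _) (h x) 2
    linarith
  obtain ⟨q, hq⟩ := exists_mul_map_conj_of_nonneg E hEn
  exact ⟨q, by rw [← hE, hq]⟩

end Polynomial

/-! ### Polynomials in `-h ∂ₓ²` and the stability function. -/

namespace HInf

open Polynomial

/-- The operator `-h ∂ₓ²`. -/
noncomputable def negLap (h : ℝ) : Module.End ℂ HInf := (-(h : ℂ)) • (D * D)

theorem negLap_apply (h : ℝ) (f : HInf) : negLap h f = (-(h : ℂ)) • D (D f) := rfl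

theorem inner_negLap (h : ℝ) (f g : HInf) :
    inner ℂ (toL2 (negLap h f)) (toL2 g) = inner ℂ (toL2 f) (toL2 (negLap h g)) := by
  rw [negLap_apply, negLap_apply, map_smul, map_smul, inner_smul_left, inner_smul_right, inner_D,
    inner_D]
  simp

theorem inner_aeval_negLap (h : ℝ) (q : Polynomial ℂ) (f g : HInf) :
    inner ℂ (toL2 (aeval (negLap h) q f)) (toL2 g) =
      inner ℂ (toL2 f) (toL2 (aeval (negLap h) (q.map (starRingEnd ℂ)) g)) := by
  induction q using Polynomial.induction_on generalizing g with
  | C a =>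
    rw [map_C, aeval_C, aeval_C, Module.algebraMap_end_apply, Module.algebraMap_end_apply,
      map_smul, map_smul, inner_smul_left, inner_smul_right]
  | add p q hp hq =>
    simp only [Polynomial.map_add, map_add, LinearMap.add_apply, inner_add_left, inner_add_right,
      hp, hq]
  | monomial n a ih =>
    have h1 : aeval (negLap h) (C a * X ^ (n + 1)) f =
        negLap h (aeval (negLap h) (C a * X ^ n) f) := by
      rw [pow_succ, ← mul_assoc, mul_comm, map_mul, aeval_X]
      rfl
    rw [h1, inner_negLap, ih, Polynomial.map_mul, Polynomial.map_mul, Polynomial.map_pow,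
      Polynomial.map_pow, map_X, pow_succ, ← mul_assoc, map_mul _ _ X, aeval_X]
    rfl

theorem inner_aeval_negLap_self (h : ℝ) (q : Polynomial ℂ) (f : HInf) :
    inner ℂ (toL2 f) (toL2 (aeval (negLap h) (q.map (starRingEnd ℂ) * q) f)) =
      ((‖toL2 (aeval (negLap h) q f)‖ ^ 2 : ℝ) : ℂ) := by
  have h1 := inner_aeval_negLap h q f (aeval (negLap h) q f)
  rw [inner_self_eq_norm_sq_to_K] at h1
  rw [map_mul, Module.End.mul_apply, ← h1]
  simp

/-- An algebraic substitute for the Fourier multiplier bound. By symmetry of the operator, `‖Q f‖² -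
‖P f‖²` is the quadratic form of `Q̄ Q - P̄ P = q̄ q`, which equals `‖q f‖² ≥ 0`. -/
theorem norm_aeval_negLap_le (h : ℝ) {P Q : Polynomial ℂ}
    (hPQ : ∀ y : ℝ, ‖P.eval (y : ℂ)‖ ≤ ‖Q.eval (y : ℂ)‖) (f : HInf) :
    ‖toL2 (aeval (negLap h) P f)‖ ≤ ‖toL2 (aeval (negLap h) Q f)‖ := by
  obtain ⟨q, hq⟩ := exists_mul_map_conj_of_norm_eval_le P Q hPQ
  have h1 := inner_aeval_negLap_self h q f
  rw [← hq, map_sub, LinearMap.sub_apply, map_sub, inner_sub_right, inner_aeval_negLap_self,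
    inner_aeval_negLap_self, ← Complex.ofReal_sub] at h1
  have h2 := Complex.ofReal_injective h1
  exact (sq_le_sq₀ (norm_nonneg _) (norm_nonneg _)).1 (by nlinarith [sq_nonneg ‖toL2 (aeval (negLap h) q f)‖])

/-- Each factor becomes `1 - i h a ∂ₓ²`, which is a bijection of `H^∞`. -/
theorem bijective_aeval_negLap_prod (h : ℝ) {ι : Type*} (s : Finset ι) (a : ι → ℝ) :
    Function.Bijective (aeval (negLap h) (∏ i ∈ s, (1 + C (Complex.I * a i) * X))) := by
  classical
  induction s using Finset.induction_on with
  | empty => rw [Finset.prod_empty, map_one]; exact Function.bijective_id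
  | insert i s hi ih =>
    rw [Finset.prod_insert hi, map_mul, Module.End.mul_eq_comp, LinearMap.coe_comp]
    refine Function.Bijective.comp ?_ ih
    convert bijective_sub_smul_D_D (re_mul_I (h * a i)) using 2 with f
    simp only [map_add, map_one, map_mul, aeval_C, aeval_X, LinearMap.add_apply,
      Module.End.one_apply, Module.End.mul_apply, Module.algebraMap_end_apply, negLap_apply]
    push_cast
    module

/-- The matrix `1 + i X A` of the implicit part. -/
noncomputable def stagePoly {s : ℕ} (M : ImExRK s) : Matrix (Fin s) (Fin s) (Polynomial ℂ) :=
  1 + (X : Polynomial ℂ) • M.Aim.map fun a => C (Complex.I * (a : ℂ))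

theorem stagePoly_apply {s : ℕ} (M : ImExRK s) (i j : Fin s) :
    stagePoly M i j = (if i = j then 1 else 0) + X * C (Complex.I * (M.Aim i j : ℂ)) := by
  simp [stagePoly, Matrix.one_apply]

theorem det_stagePoly {s : ℕ} (M : ImExRK s) :
    (stagePoly M).det = ∏ i, (1 + C (Complex.I * (M.Aim i i : ℂ)) * X) := by
  rw [Matrix.det_of_isLowerTriangular]
  · refine Finset.prod_congr rfl fun i _ => ?_
    rw [stagePoly_apply, if_pos rfl, mul_comm]
  · intro i j hij
    have hij : i < j := hij
    rw [stagePoly_apply, if_neg hij.ne, M.Aim_lower i j hij]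
    simp

theorem eval_det_stagePoly_ne_zero {s : ℕ} (M : ImExRK s) (y : ℝ) :
    (stagePoly M).det.eval (y : ℂ) ≠ 0 := by
  rw [det_stagePoly, eval_prod]
  refine Finset.prod_ne_zero_iff.2 fun i _ h => ?_
  have := congrArg Complex.re h
  simp at this

/-- The numerator of the stability function. -/
theorem eval_stagePoly_adjugate {m : ℕ} {M : ImExRK (m + 1)} (hM : M.IsGSA) (y : ℝ) :
    (∑ j, (stagePoly M).adjugate (Fin.last m) j).eval (y : ℂ) =
      (stagePoly M).det.eval (y : ℂ) * M.stabilityFunction (Complex.I * ((-y : ℝ) : ℂ)) := by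
  set B : Matrix (Fin (m + 1)) (Fin (m + 1)) ℂ :=
    1 - (Complex.I * ((-y : ℝ) : ℂ)) • M.Aim.map (fun a : ℝ => (a : ℂ)) with hB
  have hBmap : (evalRingHom (y : ℂ)).mapMatrix (stagePoly M) = B := by
    ext i j
    rw [RingHom.mapMatrix_apply, Matrix.map_apply, stagePoly_apply, hB]
    simp [Matrix.one_apply]
    split_ifs <;> simp <;> ring
  have hdet : (stagePoly M).det.eval (y : ℂ) = B.det := by
    rw [← hBmap, ← RingHom.map_det]
    rfl
  have hadj : ∀ i j, ((stagePoly M).adjugate i j).eval (y : ℂ) = B.adjugate i j := by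
    intro i j
    rw [← hBmap, ← RingHom.map_adjugate]
    rfl
  have hdet0 : B.det ≠ 0 := hdet ▸ eval_det_stagePoly_ne_zero M y
  have hunit : IsUnit B.det := isUnit_iff_ne_zero.2 hdet0
  set w : Fin (m + 1) → ℂ := B⁻¹.mulVec fun _ => 1 with hw
  have hBw : B.mulVec w = fun _ => 1 := by
    rw [hw, Matrix.mulVec_mulVec, Matrix.mul_nonsing_inv _ hunit, Matrix.one_mulVec]
  have h1 : B.det * w (Fin.last m) = ∑ j, B.adjugate (Fin.last m) j := by
    rw [hw, Matrix.inv_def, Matrix.smul_mulVec, Pi.smul_apply, smul_eq_mul, Ring.inverse_eq_inv',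
      mul_inv_cancel_left₀ hdet0]
    simp [Matrix.mulVec, dotProduct]
  -- Since the last row of the implicit matrix is `bim`, the last row of the linear system says
  -- exactly that `R(z)` is the last entry of `(I - z A)⁻¹ e`.
  have h2 : M.stabilityFunction (Complex.I * ((-y : ℝ) : ℂ)) = w (Fin.last m) := by
    have h3 := congrFun hBw (Fin.last m)
    rw [hB, Matrix.sub_mulVec, Matrix.one_mulVec, Matrix.smul_mulVec, Pi.sub_apply,
      Pi.smul_apply, smul_eq_mul] at h3
    have h4 : ((M.Aim.map (fun a : ℝ => (a : ℂ))).mulVec w) (Fin.last m) =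
        (fun i => (M.bim i : ℂ)) ⬝ᵥ w := by
      simp only [Matrix.mulVec, dotProduct, Matrix.map_apply, hM.2]
    rw [h4] at h3
    rw [ImExRK.stabilityFunction, ← hB, ← hw]
    linear_combination -h3
  rw [eval_finsetSum, hdet, h2, h1]
  exact Finset.sum_congr rfl fun j _ => hadj _ _

/-- The linear part of a linearly stable method is a contraction. -/
theorem norm_toL2_linearStage_last_le {m : ℕ} {M : ImExRK (m + 1)} (hM : M.IsGSA)
    (hstab : ∀ y : ℝ, ‖M.stabilityFunction (Complex.I * y)‖ ≤ 1) (h : ℝ) {δ : HInf}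
    {L : Fin (m + 1) → HInf} (hL : ∀ i, L i = δ + h • ∑ j, M.Aim i j • nlsL (L j)) :
    ‖toL2 (L (Fin.last m))‖ ≤ ‖toL2 δ‖ := by
  set B := stagePoly M with hB
  set Q := B.det with hQ
  set P := ∑ j, B.adjugate (Fin.last m) j with hP
  -- The linear stage equations as a linear system over polynomials in `-h ∂ₓ²`.
  have hrow : ∀ i, ∑ j, aeval (negLap h) (B i j) (L j) = δ := by
    intro i
    have h1 : ∀ j, aeval (negLap h) (B i j) (L j) =
        (if i = j then L j else 0) - h • (M.Aim i j • nlsL (L j)) := by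
      intro j
      rw [hB, stagePoly_apply]
      simp only [map_add, map_mul, aeval_C, aeval_X, LinearMap.add_apply, Module.End.mul_apply,
        Module.algebraMap_end_apply, negLap_apply, nlsL_apply, map_smul]
      have h2 : (aeval (negLap h)) (if i = j then (1 : Polynomial ℂ) else 0) (L j) =
          if i = j then L j else 0 := by split_ifs <;> simp
      rw [h2, sub_eq_add_neg]
      congr 1
      simp only [← Complex.coe_smul, smul_smul, ← neg_smul]
      congr 1
      push_cast
      ring
    simp only [h1]
    rw [Finset.sum_sub_distrib, Finset.sum_ite_eq, if_pos (Finset.mem_univ _), ← Finset.smul_sum]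
    exact sub_eq_of_eq_add (hL i)
  -- Cramer's rule: multiply the system by the last row of the adjugate.
  have hmain : aeval (negLap h) Q (L (Fin.last m)) = aeval (negLap h) P δ := by
    have h1 : ∀ i, aeval (negLap h) (B.adjugate (Fin.last m) i) δ =
        ∑ j, aeval (negLap h) (B.adjugate (Fin.last m) i * B i j) (L j) := by
      intro i
      rw [← hrow i, map_sum]
      simp only [map_mul, Module.End.mul_apply]
    rw [hP, map_sum, LinearMap.sum_apply]
    simp only [h1]
    rw [Finset.sum_comm]
    have h2 : ∀ j, ∑ i, aeval (negLap h) (B.adjugate (Fin.last m) i * B i j) (L j) =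
        if Fin.last m = j then aeval (negLap h) Q (L j) else 0 := by
      intro j
      rw [← LinearMap.sum_apply, ← map_sum, ← Matrix.mul_apply, Matrix.adjugate_mul,
        Matrix.smul_apply, Matrix.one_apply, smul_ite]
      split_ifs <;> simp [hQ]
    simp only [h2]
    rw [Finset.sum_ite_eq, if_pos (Finset.mem_univ _)]
  have hbij : Function.Bijective (aeval (negLap h) Q) := by
    rw [hQ, hB, det_stagePoly]
    exact bijective_aeval_negLap_prod h _ fun i => M.Aim i i
  -- Writing `δ = Q z` turns the quotient `P / Q` into a comparison of `P z` with `Q z`, where the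
  -- polynomial inequality applies.
  obtain ⟨z, hz⟩ := hbij.2 δ
  have hLz : L (Fin.last m) = aeval (negLap h) P z := by
    apply hbij.1
    rw [hmain, ← hz, ← Module.End.mul_apply, ← Module.End.mul_apply, ← map_mul, ← map_mul,
      mul_comm]
  rw [hLz, ← hz]
  refine norm_aeval_negLap_le h (fun y => ?_) z
  rw [hP, hB, eval_stagePoly_adjugate hM, norm_mul, hQ]
  exact mul_le_of_le_one_right (norm_nonneg _) (hstab _)

theorem p_linearStage_last_le {m : ℕ} {M : ImExRK (m + 1)} (hM : M.IsGSA)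
    (hstab : ∀ y : ℝ, ‖M.stabilityFunction (Complex.I * y)‖ ≤ 1) (h : ℝ) {δ : HInf}
    {L : Fin (m + 1) → HInf} (hL : ∀ i, L i = δ + h • ∑ j, M.Aim i j • nlsL (L j)) (k : ℕ) :
    p k (L (Fin.last m)) ≤ p k δ := by
  rw [p_apply, p_apply]
  refine Finset.sum_le_sum fun n _ => ?_
  refine norm_toL2_linearStage_last_le hM hstab h (L := fun i => (D ^ n) (L i)) fun i => ?_
  have hsm : ∀ (c : ℝ) (f : HInf), (D ^ n) (c • f) = c • (D ^ n) f := fun c f =>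
    map_smul ((D ^ n).restrictScalars ℝ) c f
  have h1 : ∀ f, (D ^ n) (nlsL f) = nlsL ((D ^ n) f) := by
    intro f
    rw [nlsL_apply, nlsL_apply, map_smul, D_pow_D, D_pow_D]
  conv_lhs => rw [hL i]
  simp only [map_add, hsm, map_sum, h1]

end HInf

/-! ### Error of the method for the nonlinear Schrödinger equation -/

theorem ImExRK.IsTypeII.Aim_diag_ne_zero {m : ℕ} {M : ImExRK (m + 1)} (hM : M.IsTypeII)
    {i : Fin (m + 1)} (hi : i ≠ 0) : M.Aim i i ≠ 0 := by
  have h1 := (Matrix.isUnit_iff_isUnit_det _).1 hM.2.2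
  rw [Matrix.det_of_isLowerTriangular (M.Aim.submatrix Fin.succ Fin.succ) fun i j hij =>
    M.Aim_lower _ _ (Fin.succ_lt_succ_iff.2 hij), isUnit_iff_ne_zero,
    Finset.prod_ne_zero_iff] at h1
  obtain ⟨j, rfl⟩ := Fin.exists_succ_eq.2 hi
  exact h1 j (Finset.mem_univ _)

namespace HInf

theorem map_real_smul (k : ℕ) (c : ℝ) (f : HInf) : p k (c • f) = |c| * p k f := by
  have h : c • f = (c : ℂ) • f := (Complex.coe_smul c f).symm
  rw [h, map_smul_eq_mul, Complex.norm_real, Real.norm_eq_abs]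

/-- `S` are the stages of the method for the nonlinear Schrödinger equation started from `v`. -/
def IsStages {s : ℕ} (M : ImExRK s) (κ h : ℝ) (v : HInf) (S : Fin s → HInf) : Prop :=
  ∀ i, S i = v + h • (∑ j, M.Aex i j • (nls κ).f (S j) + ∑ j, M.Aim i j • (nls κ).g (S j))

theorem exists_unique_isStages {s : ℕ} (M : ImExRK s) (κ h : ℝ) (v : HInf) :
    ∃! S, IsStages M κ h v S :=
  M.exists_unique_stages (nls κ).f (nls κ).g h (fun _ => bijective_sub_smul_nlsL _) v

theorem p_sum_smul_le {ι : Type*} (s : Finset ι) (k : ℕ) (c : ι → ℝ) (x : ι → HInf) :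
    p k (∑ i ∈ s, c i • x i) ≤ ∑ i ∈ s, |c i| * p k (x i) :=
  (Finset.le_sum_of_subadditive (p k) (map_zero _).le (map_add_le_add _) _ _).trans (Finset.sum_le_sum fun _ _ => (map_real_smul k _ _).le)

/-- Bounding the terms `h L (x j)` directly, with `L = nlsL`, would cost two derivatives. Instead
put `y = ∑ j < i, (a_ij / a_ii) x_j`; then `x_i + y` solves a single resolvent equation with
right-hand side `r_i + y`, so the contraction gives a constant free of `h` and of `k`. The division
needs `a_ii ≠ 0`, which fails only for the first stage, whose row is zero. -/
theorem p_linearStage_le {m : ℕ} {M : ImExRK (m + 1)} (hM : M.IsTypeII) (i : Fin (m + 1)) :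
    ∃ C, 0 ≤ C ∧ ∀ (k : ℕ) (h : ℝ) (x r : Fin (m + 1) → HInf),
      (∀ i, x i = r i + h • ∑ j, M.Aim i j • nlsL (x j)) → ∀ β, (∀ j ≤ i, p k (r j) ≤ β) →
        p k (x i) ≤ C * β := by
  induction i using WellFoundedLT.induction with
  | _ i ih =>
  by_cases hi : i = 0
  · refine ⟨1, zero_le_one, fun k h x r hx β hβ => ?_⟩
    have h1 : x i = r i := by rw [hx i, hi]; simp [hM.2.1]
    rw [h1, one_mul]
    exact hβ i le_rfl
  have ha := hM.Aim_diag_ne_zero hi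
  have ih' : ∀ j, ∃ C, 0 ≤ C ∧ (j < i → ∀ (k : ℕ) (h : ℝ) (x r : Fin (m + 1) → HInf),
      (∀ i, x i = r i + h • ∑ j, M.Aim i j • nlsL (x j)) → ∀ β, (∀ l ≤ j, p k (r l) ≤ β) →
        p k (x j) ≤ C * β) := by
    intro j
    by_cases hj : j < i
    · obtain ⟨C, hC, h⟩ := ih j hj
      exact ⟨C, hC, fun _ => h⟩
    · exact ⟨0, le_rfl, fun h => absurd h hj⟩
  choose C hC0 hC using ih'
  let a : Fin (m + 1) → ℝ := fun j => if j < i then M.Aim i j / M.Aim i i else 0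
  refine ⟨1 + 2 * ∑ j, |a j| * C j, add_nonneg zero_le_one (mul_nonneg zero_le_two
    (Finset.sum_nonneg fun j _ => mul_nonneg (abs_nonneg _) (hC0 j))), fun k h x r hx β hβ => ?_⟩
  have hxj : ∑ j, |a j| * p k (x j) ≤ (∑ j, |a j| * C j) * β := by
    rw [Finset.sum_mul]
    refine Finset.sum_le_sum fun j _ => ?_
    by_cases hj : j < i
    · rw [mul_assoc]
      exact mul_le_mul_of_nonneg_left (hC j hj k h x r hx β fun l hl => hβ l (hl.trans hj.le))
        (abs_nonneg _)
    · simp [a, hj]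
  set y := ∑ j, a j • x j with hy
  have hpy : p k y ≤ (∑ j, |a j| * C j) * β := (p_sum_smul_le _ k a x).trans hxj
  have hg : nlsL y = ∑ j, a j • nlsL (x j) := by
    rw [hy, map_sum]
    exact Finset.sum_congr rfl fun j _ => map_smul (nlsL.restrictScalars ℝ) _ _
  have hz : (x i + y) - (h * M.Aim i i) • nlsL (x i + y) = r i + y := by
    have e := hx i
    have h2 : ∀ j, (if j < i then M.Aim i j else 0) • nlsL (x j) =
        M.Aim i i • a j • nlsL (x j) := by
      intro j
      simp only [a]
      split_ifs with hj
      · rw [smul_smul, mul_div_cancel₀ _ ha]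
      · simp
    rw [M.sum_Aim_smul i fun j => nlsL (x j), Finset.sum_congr rfl fun j _ => h2 j,
      ← Finset.smul_sum, ← hg] at e
    rw [map_add]
    linear_combination (norm := module) e
  have h1 := p_le_p_sub_smul_nlsL k (h * M.Aim i i) (x i + y)
  rw [hz] at h1
  have h2 : p k (x i) ≤ p k (x i + y) + p k y := by
    have := map_sub_le_add (p k) (x i + y) y
    rwa [add_sub_cancel_right] at this
  have h3 := map_add_le_add (p k) (r i) y
  have h4 := hβ i le_rfl
  linarith

theorem exists_bound_linearStages {m : ℕ} {M : ImExRK (m + 1)} (hM : M.IsTypeII) :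
    ∃ C, 0 ≤ C ∧ ∀ (k : ℕ) (h : ℝ) (x r : Fin (m + 1) → HInf),
      (∀ i, x i = r i + h • ∑ j, M.Aim i j • nlsL (x j)) → ∀ i β, (∀ j ≤ i, p k (r j) ≤ β) →
        p k (x i) ≤ C * β := by
  choose C hC0 hC using p_linearStage_le hM
  refine ⟨∑ i, C i, Finset.sum_nonneg fun i _ => hC0 i, fun k h x r hx i β hβ => ?_⟩
  refine (hC i k h x r hx β hβ).trans ?_
  have hβ0 : 0 ≤ β := (apply_nonneg _ _).trans (hβ i le_rfl)
  gcongr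
  exact Finset.single_le_sum (f := C) (fun j _ => hC0 j) (Finset.mem_univ i)

theorem p_f_sub_le (κ : ℝ) (k : ℕ) : ∃ C, 0 ≤ C ∧ ∀ B a b, p (k + 1) a ≤ B → p (k + 1) b ≤ B →
    p (k + 1) ((nls κ).f a - (nls κ).f b) ≤ C * B ^ 2 * p (k + 1) (a - b) := by
  obtain ⟨C, hC, h⟩ := p_nlsT_le κ k
  refine ⟨3 * C, by positivity, fun B a b ha hb => ?_⟩
  have hB : 0 ≤ B := (apply_nonneg _ _).trans ha
  rw [show (nls κ).f a - (nls κ).f b = _ from (isTrilinear_nlsT κ).diag_sub_diag a b]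
  have h1 : p (k + 1) (nlsT κ (a - b) a a) ≤ C * (p (k + 1) (a - b) * B * B) :=
    (h _ _ _).trans (by gcongr)
  have h2 : p (k + 1) (nlsT κ b (a - b) a) ≤ C * (B * p (k + 1) (a - b) * B) :=
    (h _ _ _).trans (by gcongr)
  have h3 : p (k + 1) (nlsT κ b b (a - b)) ≤ C * (B * B * p (k + 1) (a - b)) :=
    (h _ _ _).trans (by gcongr)
  have h4 := map_add_le_add (p (k + 1)) (nlsT κ (a - b) a a + nlsT κ b (a - b) a)
    (nlsT κ b b (a - b))
  have h5 := map_add_le_add (p (k + 1)) (nlsT κ (a - b) a a) (nlsT κ b (a - b) a)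
  linarith

theorem f_zero (κ : ℝ) : (nls κ).f 0 = 0 :=
  (isTrilinear_nlsT κ).left 0 0 |>.map_zero

/-- Stages are Lipschitz continuous in the initial value. -/
theorem exists_p_stage_sub_le {m : ℕ} {M : ImExRK (m + 1)} (hM : M.IsTypeII) (κ : ℝ) (k : ℕ)
    (B : Fin (m + 1) → ℝ) (i : Fin (m + 1)) :
    ∃ C, 0 ≤ C ∧ ∀ h, 0 < h → h ≤ 1 → ∀ v w S S', IsStages M κ h v S → IsStages M κ h w S' →
      (∀ j < i, p (k + 1) (S j) ≤ B j ∧ p (k + 1) (S' j) ≤ B j) →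
        p (k + 1) (S i - S' i) ≤ C * p (k + 1) (v - w) := by
  obtain ⟨C₀, hC₀, hlin⟩ := exists_bound_linearStages hM
  obtain ⟨K, hK, hlip⟩ := p_f_sub_le κ k
  induction i using WellFoundedLT.induction with
  | _ i ih =>
  have ih' : ∀ j, ∃ C, 0 ≤ C ∧ (j < i → ∀ h, 0 < h → h ≤ 1 → ∀ v w S S', IsStages M κ h v S →
      IsStages M κ h w S' → (∀ l < j, p (k + 1) (S l) ≤ B l ∧ p (k + 1) (S' l) ≤ B l) →
        p (k + 1) (S j - S' j) ≤ C * p (k + 1) (v - w)) := by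
    intro j
    by_cases hj : j < i
    · obtain ⟨C, hC, h⟩ := ih j hj
      exact ⟨C, hC, fun _ => h⟩
    · exact ⟨0, le_rfl, fun h => absurd h hj⟩
  choose C hC0 hC using ih'
  have hD : ∀ j, 0 ≤ ∑ l, |M.Aex j l| * (K * B l ^ 2 * C l) := fun j =>
    Finset.sum_nonneg fun l _ => by have := hC0 l; positivity
  refine ⟨C₀ * (1 + ∑ j, ∑ l, |M.Aex j l| * (K * B l ^ 2 * C l)),
    mul_nonneg hC₀ (add_nonneg zero_le_one (Finset.sum_nonneg fun j _ => hD j)),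
    fun h h0 h1 v w S S' hS hS' hB => ?_⟩
  rw [mul_assoc]
  refine hlin (k + 1) h (fun i => S i - S' i)
    (fun j => (v - w) + h • ∑ l, M.Aex j l • ((nls κ).f (S l) - (nls κ).f (S' l)))
    (fun j => ?_) i _ fun j hj => ?_
  · have e := hS j
    have e' := hS' j
    have hL : ∀ l, nlsL (S l - S' l) = (nls κ).g (S l) - (nls κ).g (S' l) := fun l => map_sub _ _ _
    simp only [hL, smul_sub, Finset.sum_sub_distrib]
    linear_combination (norm := module) e - e'
  · refine (map_add_le_add _ _ _).trans ?_
    rw [add_mul, one_mul]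
    gcongr
    rw [map_real_smul, abs_of_pos h0]
    have hsum : p (k + 1) (∑ l, M.Aex j l • ((nls κ).f (S l) - (nls κ).f (S' l))) ≤
        (∑ l, |M.Aex j l| * (K * B l ^ 2 * C l)) * p (k + 1) (v - w) := by
      refine (p_sum_smul_le _ _ _ _).trans ?_
      rw [Finset.sum_mul]
      refine Finset.sum_le_sum fun l _ => ?_
      rcases lt_or_ge l j with hlj | hlj
      · have hli := hlj.trans_le hj
        rw [mul_assoc]
        gcongr
        refine (hlip _ _ _ (hB l hli).1 (hB l hli).2).trans ?_
        rw [mul_assoc (K * B l ^ 2)]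
        gcongr
        exact hC l hli h h0 h1 v w S S' hS hS' fun n hn => hB n (hn.trans hli)
      · rw [M.Aex_strict j l hlj]
        simp
    calc h * p (k + 1) (∑ l, M.Aex j l • ((nls κ).f (S l) - (nls κ).f (S' l)))
        ≤ 1 * ((∑ l, |M.Aex j l| * (K * B l ^ 2 * C l)) * p (k + 1) (v - w)) := by gcongr
      _ ≤ (∑ j, ∑ l, |M.Aex j l| * (K * B l ^ 2 * C l)) * p (k + 1) (v - w) := by
        rw [one_mul]
        exact mul_le_mul_of_nonneg_right
          (Finset.single_le_sum (f := fun j => ∑ l, |M.Aex j l| * (K * B l ^ 2 * C l))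
            (fun j _ => hD j) (Finset.mem_univ j)) (apply_nonneg _ _)

theorem isStages_zero {s : ℕ} (M : ImExRK s) (κ h : ℝ) : IsStages M κ h 0 fun _ => 0 := fun i => by
  simp [f_zero]

/-- Stages started from a bounded set are bounded. -/
theorem exists_p_stage_le {m : ℕ} {M : ImExRK (m + 1)} (hM : M.IsTypeII) (κ : ℝ) (k : ℕ) (b : ℝ) :
    ∃ B : Fin (m + 1) → ℝ, ∀ h, 0 < h → h ≤ 1 → ∀ v S, IsStages M κ h v S → p (k + 1) v ≤ b →
      ∀ i, p (k + 1) (S i) ≤ B i := by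
  -- The Lipschitz bound for a stage presupposes bounds on the earlier stages only, so comparison
  -- with the zero solution yields the bounds one after the other.
  have key : ∀ n : ℕ, ∃ B : Fin (m + 1) → ℝ, ∀ h, 0 < h → h ≤ 1 → ∀ v S, IsStages M κ h v S →
      p (k + 1) v ≤ b → ∀ i : Fin (m + 1), (i : ℕ) < n → p (k + 1) (S i) ≤ B i := by
    intro n
    induction n with
    | zero => exact ⟨0, fun _ _ _ _ _ _ _ i hi => absurd hi (Nat.not_lt_zero _)⟩
    | succ n ih =>
      obtain ⟨B, hB⟩ := ih
      choose C hC0 hC using exists_p_stage_sub_le hM κ k (fun i => max (B i) 0)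
      refine ⟨fun i => C i * b, fun h h0 h1 v S hS hv i hi => ?_⟩
      have := hC i h h0 h1 v 0 S (fun _ => 0) hS (isStages_zero M κ h) fun j hj =>
        ⟨(hB h h0 h1 v S hS hv j (by have := Fin.lt_def.1 hj; omega)).trans (le_max_left _ _),
          by simp⟩
      rw [sub_zero, sub_zero] at this
      exact this.trans (mul_le_mul_of_nonneg_left hv (hC0 i))
  obtain ⟨B, hB⟩ := key (m + 1)
  exact ⟨B, fun h h0 h1 v S hS hv i => hB h h0 h1 v S hS hv i i.2⟩

/-- Lipschitz continuity of a step on bounded sets. -/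
theorem exists_p_last_sub_le {m : ℕ} {M : ImExRK (m + 1)} (hM : M.IsTypeII) (κ : ℝ) (k : ℕ)
    (b : ℝ) : ∃ C, 0 ≤ C ∧ ∀ h, 0 < h → h ≤ 1 → ∀ v w S S', IsStages M κ h v S →
      IsStages M κ h w S' → p (k + 1) v ≤ b → p (k + 1) w ≤ b →
        ∀ i, p (k + 1) (S i - S' i) ≤ C * p (k + 1) (v - w) := by
  obtain ⟨B, hB⟩ := exists_p_stage_le hM κ k b
  choose C hC0 hC using exists_p_stage_sub_le hM κ k B
  refine ⟨∑ i, C i, Finset.sum_nonneg fun i _ => hC0 i, fun h h0 h1 v w S S' hS hS' hv hw i => ?_⟩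
  refine (hC i h h0 h1 v w S S' hS hS' fun j _ =>
    ⟨hB h h0 h1 v S hS hv j, hB h h0 h1 w S' hS' hw j⟩).trans ?_
  gcongr
  exact Finset.single_le_sum (f := C) (fun j _ => hC0 j) (Finset.mem_univ i)

/-- Stability of a step of a linearly stable method on bounded sets. -/
theorem exists_p_last_sub_le_of_stable {m : ℕ} {M : ImExRK (m + 1)} (hM : M.IsTypeII)
    (hGSA : M.IsGSA) (hstab : ∀ y : ℝ, ‖M.stabilityFunction (Complex.I * y)‖ ≤ 1) (κ : ℝ) (k : ℕ)
    (b : ℝ) : ∃ C, 0 ≤ C ∧ ∀ h, 0 < h → h ≤ 1 → ∀ v w S S', IsStages M κ h v S →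
      IsStages M κ h w S' → p (k + 1) v ≤ b → p (k + 1) w ≤ b →
        p (k + 1) (S (Fin.last m) - S' (Fin.last m)) ≤ (1 + C * h) * p (k + 1) (v - w) := by
  obtain ⟨B, hB⟩ := exists_p_stage_le hM κ k b
  obtain ⟨C, hC0, hC⟩ := exists_p_last_sub_le hM κ k b
  obtain ⟨C₀, hC₀, hlin⟩ := exists_bound_linearStages hM
  obtain ⟨K, hK, hlip⟩ := p_f_sub_le κ k
  have hD : ∀ j, 0 ≤ ∑ l, |M.Aex j l| * (K * B l ^ 2 * C) := fun j =>
    Finset.sum_nonneg fun l _ => by positivity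
  refine ⟨C₀ * ∑ j, ∑ l, |M.Aex j l| * (K * B l ^ 2 * C),
    mul_nonneg hC₀ (Finset.sum_nonneg fun j _ => hD j), fun h h0 h1 v w S S' hS hS' hv hw => ?_⟩
  -- `L` propagates `v - w` by the implicit part alone and is a contraction in its last stage. The
  -- remainder `S - S' - L` is driven only by differences of the cubic term, each with a factor `h`;
  -- this gives `1 + C h`.
  obtain ⟨L, hL, -⟩ := M.exists_unique_stages (fun _ : HInf => 0) (nls κ).g h
    (fun _ => bijective_sub_smul_nlsL _) (v - w)
  have hL' : ∀ i, L i = (v - w) + h • ∑ j, M.Aim i j • nlsL (L j) := fun i => by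
    have := hL i
    simp only [smul_zero, Finset.sum_const_zero, zero_add] at this
    exact this
  have h2 := p_linearStage_last_le hGSA hstab h hL' (k + 1)
  have h3 := hlin (k + 1) h (fun i => S i - S' i - L i)
    (fun j => h • ∑ l, M.Aex j l • ((nls κ).f (S l) - (nls κ).f (S' l))) (fun j => by
      have e := hS j
      have e' := hS' j
      have hg : ∀ l, nlsL (S l - S' l - L l) =
          (nls κ).g (S l) - (nls κ).g (S' l) - nlsL (L l) := fun l => by
        rw [map_sub, map_sub]; rfl
      simp only [hg, smul_sub, Finset.sum_sub_distrib]
      linear_combination (norm := module) e - e' - hL' j) (Fin.last m)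
    (h * ((∑ j, ∑ l, |M.Aex j l| * (K * B l ^ 2 * C)) * p (k + 1) (v - w))) fun j _ => by
      rw [map_real_smul, abs_of_pos h0]
      refine mul_le_mul_of_nonneg_left ?_ h0.le
      calc p (k + 1) (∑ l, M.Aex j l • ((nls κ).f (S l) - (nls κ).f (S' l)))
          ≤ (∑ l, |M.Aex j l| * (K * B l ^ 2 * C)) * p (k + 1) (v - w) := by
            refine (p_sum_smul_le _ _ _ _).trans ?_
            rw [Finset.sum_mul]
            refine Finset.sum_le_sum fun l _ => ?_
            rw [mul_assoc]
            gcongr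
            refine (hlip _ _ _ (hB h h0 h1 v S hS hv l) (hB h h0 h1 w S' hS' hw l)).trans ?_
            rw [mul_assoc (K * B l ^ 2)]
            gcongr
            exact hC h h0 h1 v w S S' hS hS' hv hw l
        _ ≤ _ := by
            exact mul_le_mul_of_nonneg_right
              (Finset.single_le_sum (f := fun j => ∑ l, |M.Aex j l| * (K * B l ^ 2 * C))
                (fun j _ => hD j) (Finset.mem_univ j)) (apply_nonneg _ _)
  have h4 := map_add_le_add (p (k + 1)) (S (Fin.last m) - S' (Fin.last m) - L (Fin.last m))
    (L (Fin.last m))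
  rw [sub_add_cancel] at h4
  linarith

end HInf

/-! ### Convergence for NLS: local error and its accumulation. -/

namespace HInf

/-- A curve in `H^∞`, bounded in all norms, that solves the nonlinear Schrödinger equation pointwise
on `[0, T]`. -/
def IsSolution (κ T : ℝ) (w : ℝ → HInf) : Prop :=
  (∀ k, ∃ C, ∀ t ∈ Set.Icc 0 T, p k (w t) ≤ C) ∧
    ∀ x, ∀ t ∈ Set.Icc 0 T, HasDerivWithinAt (fun r => (w r).1 x)
      (((nls κ).f (w t) + (nls κ).g (w t)).1 x) (Set.Icc 0 T) t

/-- Continuity in each Sobolev norm on a compact interval gives the uniform bounds; the equation,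
multiplied by `-i`, is the evolution form. Values outside `[0, T]` play no role and are set to zero.
-/
theorem exists_isSolution {κ T : ℝ} {u : ℝ → ℝ → ℂ} (hu : IsNLSSolution κ T u) :
    ∃ w : ℝ → HInf, (∀ t ∈ Set.Icc 0 T, (w t).1 = u t) ∧ IsSolution κ T w := by
  classical
  let w : ℝ → HInf := fun t => if h : t ∈ Set.Icc 0 T then ⟨u t, hu.1 t h⟩ else 0
  have hw : ∀ t ∈ Set.Icc 0 T, (w t).1 = u t := fun t ht => by simp only [w, dif_pos ht]
  refine ⟨w, hw, fun k => ?_, fun x t ht => ?_⟩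
  · have hc : ContinuousOn (fun t => p k (w t)) (Set.Icc 0 T) := by
      intro t ht
      have h1 : Tendsto (fun r => ((k : ℝ) + 1) * sobolevNorm k (u r - u t)) (𝓝[Set.Icc 0 T] t)
          (𝓝 0) := by
        simpa using (hu.2.1 k t ht).const_mul ((k : ℝ) + 1)
      refine tendsto_iff_norm_sub_tendsto_zero.2 (squeeze_zero' (Eventually.of_forall fun _ =>
        norm_nonneg _) ?_ h1)
      filter_upwards [self_mem_nhdsWithin] with r hr
      rw [Real.norm_eq_abs]
      refine (abs_sub_map_le_sub (p k) (w r) (w t)).trans ((p_le_sobolevNorm k _).trans ?_)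
      rw [show (w r - w t).1 = (w r).1 - (w t).1 from rfl, hw r hr, hw t ht]
    obtain ⟨C, hC⟩ := isCompact_Icc.exists_bound_of_continuousOn hc
    exact ⟨C, fun t ht => (le_abs_self _).trans (hC t ht)⟩
  · obtain ⟨ut, hd, he⟩ := hu.2.2 t ht x
    have h1 : ((nls κ).f (w t) + (nls κ).g (w t)).1 x = ut := by
      change Complex.I * κ * ((w t).1 x * star ((w t).1 x) * (w t).1 x) +
        Complex.I * deriv (deriv (w t).1) x = ut
      rw [hw t ht, Complex.star_def, Complex.mul_conj, Complex.normSq_eq_norm_sq]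
      push_cast
      linear_combination Complex.I * he - ut * Complex.I_mul_I
    rw [h1]
    exact hd.congr (fun r hr => by rw [hw r hr]) (by rw [hw t ht])

/-- Consistency: the error after one step, started from the exact solution. -/
theorem exists_p_local_error_le {m p' : ℕ} {M : ImExRK (m + 1)} (hGSA : M.IsGSA)
    (hord : M.HasOrder p') {κ T : ℝ} {w : ℝ → HInf} (hw : IsSolution κ T w) (k : ℕ) :
    ∃ C, 0 ≤ C ∧ ∀ᶠ h in 𝓝[>] (0 : ℝ), ∀ t, 0 ≤ t → t + h ≤ T → ∀ S, IsStages M κ h (w t) S →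
      p k (S (Fin.last m) - w (t + h)) ≤ C * h ^ (p' + 1) := by
  -- Along this filter `h → 0` while `t` ranges over all of `[0, T]`, so that the constants are
  -- uniform in the starting time.
  let l : Filter (ℝ × ℝ) := 𝓝[>] 0 ×ˢ 𝓟 (Set.Icc 0 T)
  choose V hV using fun v : HInf => (nls κ).exists_isStageSeries M p' v
  choose U hU using fun v : HInf => (nls κ).exists_isExactSeries p' v
  choose S hS _ using fun z : ℝ × ℝ => exists_unique_isStages M κ z.1 (w z.2)
  have hfst : Tendsto (fun z : ℝ × ℝ => z.1) l (𝓝 0) :=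
    tendsto_fst.mono_right nhdsWithin_le_nhds
  have hbd : TameBigO (nls κ).N l (fun z => w z.2) fun _ => 1 := fun k => by
    obtain ⟨C, hC⟩ := hw.1 k
    refine Asymptotics.IsBigO.of_bound C ?_
    refine (eventually_prod_principal_iff.2 (Eventually.of_forall fun h t ht => ?_))
    rw [Real.norm_of_nonneg (apply_nonneg _ _), norm_one, mul_one]
    exact hC t ht
  have hnum := (nls κ).stage_expansion hfst hbd (fun z => hV (w z.2))
    (Eventually.of_forall hS) (Fin.last m) k
  obtain ⟨C₁, hC₁⟩ := hnum.bound
  have hnum := eventually_prod_principal_iff.1 hC₁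
  obtain ⟨C₂, hC₂⟩ := (nls κ).exact_expansion (I := Set.Icc 0 T) (σ := fun t => T - t) (c := T)
    (fun t => by linarith [t.2.1]) (y := fun t r => w (t + r)) (p := p')
    (fun t x r hr => by
      have h1 := hw.2 x (t + r) ⟨by linarith [t.2.1, hr.1], by linarith [hr.2]⟩
      have h2 : HasDerivWithinAt (fun r : ℝ => (t : ℝ) + r) 1 (Set.Icc 0 (T - t)) r :=
        (hasDerivWithinAt_id r _).const_add _
      have h3 := HasDerivWithinAt.scomp r h1 h2
        (fun r hr => ⟨by linarith [t.2.1, hr.1], by linarith [hr.2]⟩)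
      rw [one_smul] at h3
      exact h3)
    (fun k => by
      obtain ⟨C, hC⟩ := hw.1 k
      exact ⟨C, fun t r hr => hC _ ⟨by linarith [t.2.1, hr.1], by linarith [hr.2]⟩⟩)
    (U := fun t => U (w t)) (fun t => by simpa only [add_zero] using hU (w t)) k
  refine ⟨|C₁| + |C₂|, by positivity, ?_⟩
  filter_upwards [hnum, self_mem_nhdsWithin] with h hh hpos t ht0 htT S' hS'
  have hpos : 0 < h := hpos
  have htI : t ∈ Set.Icc 0 T := ⟨ht0, by linarith⟩
  obtain rfl : S' = S (h, t) := (exists_unique_isStages M κ h (w t)).unique hS' (hS (h, t))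
  have h1 := hh t htI
  have h2 := hC₂ ⟨t, htI⟩ h ⟨hpos.le, by change h ≤ T - t; linarith⟩
  rw [Real.norm_of_nonneg (apply_nonneg _ _), norm_pow, Real.norm_of_nonneg hpos.le] at h1
  -- The order conditions: both Taylor polynomials are the same, and only the two remainders are
  -- left.
  have hVU : TameSystem.trunc p' (V (w t) (Fin.last m)) h = TameSystem.trunc p' (U (w t)) h :=
    Finset.sum_congr rfl fun n hn => by
      rw [(nls κ).stageSeries_eq_exactSeries hGSA hord (hV _) (hU _) n
        (Nat.lt_succ_iff.1 (Finset.mem_range.1 hn))]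
  have h3 : S (h, t) (Fin.last m) - w (t + h) =
      (S (h, t) (Fin.last m) - TameSystem.trunc p' (V (w t) (Fin.last m)) h) -
        (w (t + h) - TameSystem.trunc p' (U (w t)) h) := by
    rw [hVU]; abel
  rw [h3]
  refine (map_sub_le_add _ _ _).trans ?_
  rw [add_mul]
  have hpow : 0 ≤ h ^ (p' + 1) := by positivity
  exact add_le_add (h1.trans (mul_le_mul_of_nonneg_right (le_abs_self _) hpow))
    (h2.trans (mul_le_mul_of_nonneg_right (le_abs_self _) hpow))

/-- `v` is a numerical solution of the nonlinear Schrödinger equation by a globally stiffly accurate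
method. -/
def IsSequence {m : ℕ} (M : ImExRK (m + 1)) (κ h : ℝ) (v : ℕ → HInf) : Prop :=
  ∀ n, ∃ S, IsStages M κ h (v n) S ∧ v (n + 1) = S (Fin.last m)

theorem eventually_mul_pow_le_one (C : ℝ) {n : ℕ} (hn : n ≠ 0) :
    ∀ᶠ h in 𝓝[>] (0 : ℝ), C * h ^ n ≤ 1 := by
  have : Tendsto (fun h : ℝ => C * h ^ n) (𝓝 0) (𝓝 0) :=
    Continuous.tendsto' (by fun_prop) _ _ (by simp [hn])
  exact (this.eventually (ge_mem_nhds one_pos)).filter_mono nhdsWithin_le_nhds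

/-- Error after a fixed number of steps. -/
theorem exists_p_error_le_of_fixed {m p' : ℕ} {M : ImExRK (m + 1)} (hM : M.IsTypeII)
    (hGSA : M.IsGSA) (hord : M.HasOrder p') {κ T : ℝ} (hT : 0 < T) {w : ℝ → HInf}
    (hw : IsSolution κ T w) (k n : ℕ) :
    ∃ C, 0 ≤ C ∧ ∀ᶠ h in 𝓝[>] (0 : ℝ), ∀ v, v 0 = w 0 → IsSequence M κ h v →
      p (k + 1) (v n - w (n * h)) ≤ C * h ^ (p' + 1) := by
  induction n with
  | zero => exact ⟨0, le_rfl, Eventually.of_forall fun h v hv _ => by simp [hv]⟩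
  | succ n ih =>
    obtain ⟨C₁, hC₁0, hC₁⟩ := ih
    obtain ⟨b, hb⟩ := hw.1 (k + 1)
    obtain ⟨C₂, hC₂0, hC₂⟩ := exists_p_last_sub_le hM κ k (b + 1)
    obtain ⟨C₃, hC₃0, hC₃⟩ := exists_p_local_error_le hGSA hord hw (k + 1)
    refine ⟨C₂ * C₁ + C₃, by positivity, ?_⟩
    have hsmall : ∀ᶠ h in 𝓝[>] (0 : ℝ), h < T / (n + 1) :=
      nhdsWithin_le_nhds (gt_mem_nhds (by positivity))
    have hone : ∀ᶠ h in 𝓝[>] (0 : ℝ), h < 1 := nhdsWithin_le_nhds (gt_mem_nhds one_pos)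
    filter_upwards [hC₁, hC₃, hsmall, hone, eventually_mul_pow_le_one C₁ (Nat.add_one_ne_zero p'),
      self_mem_nhdsWithin] with h h1 h3 hT1 h1' hle hpos v hv0 hv
    have hpos : 0 < h := hpos
    rw [lt_div_iff₀ (by positivity)] at hT1
    have htn : 0 ≤ n * h := by positivity
    have htT : n * h + h ≤ T := by linarith
    obtain ⟨S, hS, hSv⟩ := hv n
    obtain ⟨S', hS', -⟩ := exists_unique_isStages M κ h (w (n * h))
    have e1 := h1 v hv0 hv
    have hwb : p (k + 1) (w (n * h)) ≤ b := hb _ ⟨htn, by linarith⟩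
    -- For small `h` the error so far is at most one, which keeps the numerical solution in the ball
    -- where the Lipschitz constant is valid.
    have hvb : p (k + 1) (v n) ≤ b + 1 := by
      have := map_add_le_add (p (k + 1)) (w (n * h)) (v n - w (n * h))
      rw [add_sub_cancel] at this
      linarith
    have e2 := hC₂ h hpos h1'.le _ _ S S' hS hS' hvb (by linarith) (Fin.last m)
    have e3 := h3 (n * h) htn htT S' hS'
    have e4 := map_add_le_add (p (k + 1)) (S (Fin.last m) - S' (Fin.last m))
      (S' (Fin.last m) - w (n * h + h))
    rw [sub_add_sub_cancel] at e4
    rw [hSv, show ((n + 1 : ℕ) : ℝ) * h = n * h + h by push_cast; ring]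
    have e5 := mul_le_mul_of_nonneg_left e1 hC₂0
    linarith

/-- Error of a linearly stable method, uniformly on a time interval. -/
theorem exists_p_error_le_of_stable {m p' : ℕ} {M : ImExRK (m + 1)} (hM : M.IsTypeII)
    (hGSA : M.IsGSA) (hp' : p' ≠ 0) (hord : M.HasOrder p')
    (hstab : ∀ y : ℝ, ‖M.stabilityFunction (Complex.I * y)‖ ≤ 1) {κ T : ℝ} (hT : 0 < T)
    {w : ℝ → HInf} (hw : IsSolution κ T w) (k : ℕ) :
    ∃ C, 0 ≤ C ∧ ∀ᶠ h in 𝓝[>] (0 : ℝ), ∀ v, v 0 = w 0 → IsSequence M κ h v →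
      ∀ n : ℕ, n * h ≤ T → p (k + 1) (v n - w (n * h)) ≤ C * h ^ p' := by
  obtain ⟨b, hb⟩ := hw.1 (k + 1)
  obtain ⟨C₂, hC₂0, hC₂⟩ := exists_p_last_sub_le_of_stable hM hGSA hstab κ k (b + 1)
  obtain ⟨C₃, hC₃0, hC₃⟩ := exists_p_local_error_le hGSA hord hw (k + 1)
  -- Discrete Gronwall: at most `T / h` local errors of size `C₃ h ^ (p' + 1)`, each amplified by at
  -- most `exp (C₂ T)`.
  refine ⟨C₃ * T * Real.exp (C₂ * T), by positivity, ?_⟩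
  have hone : ∀ᶠ h in 𝓝[>] (0 : ℝ), h < 1 := nhdsWithin_le_nhds (gt_mem_nhds one_pos)
  filter_upwards [hC₃, hone, eventually_mul_pow_le_one (C₃ * T * Real.exp (C₂ * T)) hp',
    self_mem_nhdsWithin] with h h3 h1 hle hpos v hv0 hv
  have hpos : 0 < h := hpos
  have hgrow : ∀ n : ℕ, n * h ≤ T → C₃ * h ^ (p' + 1) * n * Real.exp (C₂ * (n * h)) ≤
      C₃ * T * Real.exp (C₂ * T) * h ^ p' := by
    intro n hn
    calc C₃ * h ^ (p' + 1) * n * Real.exp (C₂ * (n * h))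
        = C₃ * (n * h) * Real.exp (C₂ * (n * h)) * h ^ p' := by ring
      _ ≤ _ := by gcongr
  have key : ∀ n : ℕ, n * h ≤ T →
      p (k + 1) (v n - w (n * h)) ≤ C₃ * h ^ (p' + 1) * n * Real.exp (C₂ * (n * h)) := by
    intro n
    induction n with
    | zero => intro _; simp [hv0]
    | succ n ih =>
      intro hnT
      have hsucc : ((n + 1 : ℕ) : ℝ) * h = n * h + h := by push_cast; ring
      rw [hsucc] at hnT ⊢
      have htn : 0 ≤ n * h := by positivity
      have e1 := ih (by linarith)
      obtain ⟨S, hS, hSv⟩ := hv n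
      obtain ⟨S', hS', -⟩ := exists_unique_isStages M κ h (w (n * h))
      have hwb : p (k + 1) (w (n * h)) ≤ b := hb _ ⟨htn, by linarith⟩
      -- The error bound itself closes the bootstrap: it is at most one for small `h`, since `p' ≠
      -- 0`.
      have hvb : p (k + 1) (v n) ≤ b + 1 := by
        have := map_add_le_add (p (k + 1)) (w (n * h)) (v n - w (n * h))
        rw [add_sub_cancel] at this
        linarith [hgrow n (by linarith)]
      have e2 := hC₂ h hpos h1.le _ _ S S' hS hS' hvb (by linarith)
      have e3 := h3 (n * h) htn hnT S' hS'
      have e4 := map_add_le_add (p (k + 1)) (S (Fin.last m) - S' (Fin.last m))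
        (S' (Fin.last m) - w (n * h + h))
      rw [sub_add_sub_cancel] at e4
      rw [hSv]
      have e5 : 1 + C₂ * h ≤ Real.exp (C₂ * h) := by linarith [Real.add_one_le_exp (C₂ * h)]
      have e6 : (1 + C₂ * h) * p (k + 1) (v n - w (n * h)) ≤
          C₃ * h ^ (p' + 1) * n * Real.exp (C₂ * (n * h + h)) := by
        calc (1 + C₂ * h) * p (k + 1) (v n - w (n * h))
            ≤ Real.exp (C₂ * h) * (C₃ * h ^ (p' + 1) * n * Real.exp (C₂ * (n * h))) :=
              mul_le_mul e5 e1 (apply_nonneg _ _) (Real.exp_nonneg _)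
          _ = _ := by rw [mul_add, Real.exp_add]; ring
      have e7 : C₃ * h ^ (p' + 1) * 1 ≤ C₃ * h ^ (p' + 1) * Real.exp (C₂ * (n * h + h)) := by
        have : 1 ≤ Real.exp (C₂ * (n * h + h)) := Real.one_le_exp (by positivity)
        gcongr
      push_cast
      linarith
  exact fun n hn => (key n hn).trans (hgrow n hn)

end HInf

/-! ### Numerical solutions in subspaces -/

namespace ImExRK

variable {s : ℕ} {E E' : Type*} [AddCommGroup E] [Module ℝ E] [AddCommGroup E'] [Module ℝ E']

/-- Transfers steps between plain functions, in which the theorem is phrased, and the vector spaces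
`HInf` and `HInf × HInf`, where the estimates live. -/
theorem isStep_map_iff (M : ImExRK s) {ι : E' →ₗ[ℝ] E} (hι : Function.Injective ι) {f g : E → E}
    {f' g' : E' → E'} (hf : ∀ x, f (ι x) = ι (f' x)) (hg : ∀ x, g (ι x) = ι (g' x)) (h : ℝ)
    (Q : E') (S : Fin s → E') (Q' : E') :
    M.IsStep f g h (ι Q) (fun i => ι (S i)) (ι Q') ↔ M.IsStep f' g' h Q S Q' := by
  have h1 : ∀ a b : Fin s → ℝ, ι Q + h • (∑ j, a j • f (ι (S j)) + ∑ j, b j • g (ι (S j))) =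
      ι (Q + h • (∑ j, a j • f' (S j) + ∑ j, b j • g' (S j))) := by
    intro a b
    simp only [map_add, map_smul, map_sum, hf, hg]
  unfold IsStep
  simp only [h1, hι.eq_iff]

theorem isNumericalSolution_map_iff (M : ImExRK s) {ι : E' →ₗ[ℝ] E} (hι : Function.Injective ι)
    {f g : E → E} {f' g' : E' → E'} (hf : ∀ x, f (ι x) = ι (f' x)) (hg : ∀ x, g (ι x) = ι (g' x))
    (h : ℝ) (Q : ℕ → E) : M.IsNumericalSolution (Set.range ι) f g h Q ↔
      ∃ Q' : ℕ → E', (∀ n, ι (Q' n) = Q n) ∧ ∀ n, ∃ S, M.IsStep f' g' h (Q' n) S (Q' (n + 1)) := by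
  constructor
  · rintro ⟨h1, h2⟩
    choose Q' hQ' using h1
    refine ⟨Q', hQ', fun n => ?_⟩
    obtain ⟨S, hS, hstep⟩ := h2 n
    choose S' hS' using hS
    refine ⟨S', (M.isStep_map_iff hι hf hg h _ _ _).1 ?_⟩
    simpa only [hS', hQ'] using hstep
  · rintro ⟨Q', hQ', h2⟩
    refine ⟨fun n => ⟨Q' n, hQ' n⟩, fun n => ?_⟩
    obtain ⟨S, hS⟩ := h2 n
    refine ⟨fun i => ι (S i), fun i => ⟨S i, rfl⟩, ?_⟩
    rw [← hQ', ← hQ']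
    exact (M.isStep_map_iff hι hf hg h _ _ _).2 hS

theorem exists_unique_numericalSolution (M : ImExRK s) {ι : E' →ₗ[ℝ] E}
    (hι : Function.Injective ι) {f g : E → E} {f' : E' → E'} {g' : E' →ₗ[ℝ] E'}
    (hf : ∀ x, f (ι x) = ι (f' x)) (hg : ∀ x, g (ι x) = ι (g' x)) (h : ℝ)
    (hbij : ∀ c : ℝ, Function.Bijective fun x => x - c • g' x) (Q₀ : E') :
    ∃! Q, M.IsNumericalSolution (Set.range ι) f g h Q ∧ Q 0 = ι Q₀ := by
  have hstep : ∀ Q : E', ∃! Q', ∃ S, M.IsStep f' g' h Q S Q' := by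
    intro Q
    obtain ⟨S, hS, hSu⟩ := M.exists_unique_stages f' g' h (fun _ => hbij _) Q
    refine ⟨_, ⟨S, hS, rfl⟩, ?_⟩
    rintro Q' ⟨S', hS', rfl⟩
    rw [hSu S' hS']
  choose Φ hΦ hΦu using hstep
  refine ⟨fun n => ι (Φ^[n] Q₀), ⟨(M.isNumericalSolution_map_iff hι hf hg h _).2
    ⟨fun n => Φ^[n] Q₀, fun _ => rfl, fun n => ?_⟩, rfl⟩, ?_⟩
  · simp only [Function.iterate_succ_apply']
    exact hΦ _
  · rintro Q ⟨hQ, hQ0⟩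
    obtain ⟨Q', hQ', hs⟩ := (M.isNumericalSolution_map_iff hι hf hg h _).1 hQ
    funext n
    rw [← hQ' n]
    congr 1
    induction n with
    | zero => exact hι ((hQ' 0).trans hQ0)
    | succ n ih =>
      rw [Function.iterate_succ_apply', ← ih]
      exact hΦu _ _ (hs n)

end ImExRK

/-! ### The hyperbolized system -/

namespace HInf

/-- The implicit part of the hyperbolized system. -/
noncomputable def hypL (τ : ℝ) : HInf × HInf →ₗ[ℝ] HInf × HInf where
  toFun Q := (Complex.I • D Q.2, (-Complex.I * (τ : ℂ)⁻¹) • (D Q.1 - Q.2))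
  map_add' Q R := by
    ext1
    · simp only [Prod.fst_add, Prod.snd_add, map_add, smul_add]
    · simp only [Prod.fst_add, Prod.snd_add, map_add]
      module
  map_smul' c Q := by
    have h : ∀ f : HInf, D (c • f) = c • D f := map_smul (D.restrictScalars ℝ) c
    ext1
    · simp only [Prod.smul_fst, Prod.smul_snd, h, RingHom.id_apply]
      module
    · simp only [Prod.smul_fst, Prod.smul_snd, h, RingHom.id_apply]
      module

/-- The explicit part of the hyperbolized system. -/
noncomputable def hypF (κ : ℝ) (Q : HInf × HInf) : HInf × HInf := ((nls κ).f Q.1, 0)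

/-- The defect `-i τ⁻¹ (∂ₓ q₀ - q₁)`. -/
noncomputable def defect (τ : ℝ) (Q : HInf × HInf) : HInf :=
  (-Complex.I * (τ : ℂ)⁻¹) • (D Q.1 - Q.2)

theorem hypL_apply (τ : ℝ) (Q : HInf × HInf) : hypL τ Q = (Complex.I • D Q.2, defect τ Q) := rfl

/-- In this form a bounded defect visibly forces `q₁ - ∂ₓ q₀ = O(τ)`. -/
theorem snd_eq {τ : ℝ} (hτ : τ ≠ 0) (Q : HInf × HInf) :
    Q.2 = D Q.1 - (Complex.I * τ) • defect τ Q := by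
  have hτ' : (τ : ℂ) ≠ 0 := by exact_mod_cast hτ
  rw [defect, smul_smul, show Complex.I * τ * (-Complex.I * (τ : ℂ)⁻¹) = 1 by
    field_simp; simp, one_smul, sub_sub_cancel]

theorem ofReal_add_I_mul_ne_zero {c : ℝ} (hc : c ≠ 0) (τ : ℝ) : (c : ℂ) + Complex.I * τ ≠ 0 := by
  intro h
  have := congrArg Complex.re h
  simp at this
  exact hc this

/-- The factor `c / (c + i τ)`. -/
noncomputable def relaxFactor (c τ : ℝ) : ℂ := c / (c + Complex.I * τ)

theorem relaxFactor_mul {c : ℝ} (hc : c ≠ 0) (τ : ℝ) :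
    relaxFactor c τ * (c + Complex.I * τ) = c :=
  div_mul_cancel₀ _ (ofReal_add_I_mul_ne_zero hc τ)

theorem relaxFactor_identity {c : ℝ} (hc : c ≠ 0) (τ : ℝ) :
    (c : ℂ) * Complex.I * (1 - relaxFactor c τ) = -(τ * relaxFactor c τ) := by
  linear_combination (-Complex.I) * relaxFactor_mul hc τ +
    (τ : ℂ) * relaxFactor c τ * Complex.I_mul_I

theorem norm_relaxFactor_le {c : ℝ} (hc : c ≠ 0) (τ : ℝ) : ‖relaxFactor c τ‖ ≤ 1 := by
  rw [relaxFactor, norm_div, div_le_one (norm_pos_iff.2 (ofReal_add_I_mul_ne_zero hc τ))]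
  have := Complex.abs_re_le_norm ((c : ℂ) + Complex.I * τ)
  simpa using this

/-- This is the multiplier left in the equation for `q₀` after elimination; its sign, the same for
positive and negative `c`, makes the resolvent estimate uniform in `τ`. -/
theorem re_relaxFactor {c τ : ℝ} (hτ : 0 < τ) :
    0 ≤ ((c : ℂ) * Complex.I * relaxFactor c τ).re := by
  have : ((c : ℂ) * Complex.I * relaxFactor c τ).re = c ^ 2 * τ / (c ^ 2 + τ ^ 2) := by
    rw [relaxFactor, ← mul_div_assoc, Complex.div_re]
    simp [Complex.normSq_apply]
    ring_nf
  rw [this]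
  positivity

/-- Elimination of the second component in the implicit equation of the hyperbolized system. -/
theorem sub_smul_hypL_eq_iff {c τ : ℝ} (hc : c ≠ 0) (hτ : 0 < τ) (Q R : HInf × HInf) :
    Q - c • hypL τ Q = R ↔
      Q.1 - ((c : ℂ) * Complex.I * relaxFactor c τ) • D (D Q.1) =
          R.1 - ((τ : ℂ) * relaxFactor c τ) • D R.2 ∧
        Q.2 = R.2 + relaxFactor c τ • (D Q.1 - R.2) := by
  have hτ' : (τ : ℂ) ≠ 0 := by exact_mod_cast hτ.ne'
  have hc' : (c : ℂ) ≠ 0 := by exact_mod_cast hc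
  have hmul := relaxFactor_mul hc τ
  set l := relaxFactor c τ with hl
  have hreal : ∀ f : HInf, c • f = (c : ℂ) • f := fun f => (Complex.coe_smul c f).symm
  have h2 : (Q - c • hypL τ Q).2 = R.2 ↔ Q.2 = R.2 + l • (D Q.1 - R.2) := by
    have e : (Q - c • hypL τ Q).2 = Q.2 + (c * Complex.I * (τ : ℂ)⁻¹) • (D Q.1 - Q.2) := by
      rw [Prod.snd_sub, Prod.smul_snd, hypL_apply, defect, hreal]
      module
    have hne := ofReal_add_I_mul_ne_zero hc τ
    rw [e]
    -- Multiplied by `i τ`, the second equation reads `(c + i τ) q₁ = c ∂ₓ q₀ + i τ r₁`, free of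
    -- `τ⁻¹`.
    have e1 : (Complex.I * τ) • (Q.2 + (c * Complex.I * (τ : ℂ)⁻¹) • (D Q.1 - Q.2) - R.2) =
        ((c : ℂ) + Complex.I * τ) • (Q.2 - (R.2 + l • (D Q.1 - R.2))) := by
      have a1 : Complex.I * τ * (c * Complex.I * (τ : ℂ)⁻¹) = -c := by
        field_simp
        simp
      have a2 : ((c : ℂ) + Complex.I * τ) * l = c := by rw [mul_comm]; exact hmul
      simp only [smul_sub, smul_add, smul_smul, a1, a2]
      module
    rw [← sub_eq_zero, ← sub_eq_zero (a := Q.2)]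
    constructor
    · intro h
      rw [h, smul_zero] at e1
      exact (smul_eq_zero.1 e1.symm).resolve_left hne
    · intro h
      rw [h, smul_zero] at e1
      exact (smul_eq_zero.1 e1).resolve_left (mul_ne_zero Complex.I_ne_zero hτ')
  have h1 : Q.2 = R.2 + l • (D Q.1 - R.2) → ((Q - c • hypL τ Q).1 = R.1 ↔
      Q.1 - ((c : ℂ) * Complex.I * l) • D (D Q.1) = R.1 - ((τ : ℂ) * l) • D R.2) := by
    intro hQ
    have e : (Q - c • hypL τ Q).1 = Q.1 - (c * Complex.I * l) • D (D Q.1) +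
        (τ * l) • D R.2 := by
      rw [Prod.fst_sub, Prod.smul_fst, hypL_apply, hreal, hQ]
      simp only [map_add, map_smul, map_sub]
      -- The weight of `R.2` in the equation for `q₀` is of size `τ`; this is why mere boundedness
      -- of `R.2` will suffice.
      have a' : (τ : ℂ) * l = -((c : ℂ) * Complex.I * (1 - l)) := by
        rw [relaxFactor_identity hc, neg_neg]
      rw [a']
      module
    rw [e]
    exact eq_sub_iff_add_eq.symm
  rw [Prod.ext_iff, h2]
  constructor
  · rintro ⟨a, b⟩
    exact ⟨(h1 b).1 a, b⟩
  · rintro ⟨a, b⟩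
    exact ⟨(h1 b).2 a, b⟩

/-- After an implicit solve the singular factor `τ⁻¹` has cancelled: the defect is bounded in terms
of `∂ₓ q₀ - r` by `|c|⁻¹`. -/
theorem defect_eq {c τ : ℝ} (hc : c ≠ 0) (hτ : 0 < τ) {Q : HInf × HInf} {r : HInf}
    (h : Q.2 = r + relaxFactor c τ • (D Q.1 - r)) :
    defect τ Q = ((c : ℂ)⁻¹ * relaxFactor c τ) • (D Q.1 - r) := by
  have hτ' : (τ : ℂ) ≠ 0 := by exact_mod_cast hτ.ne'
  have hc' : (c : ℂ) ≠ 0 := by exact_mod_cast hc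
  have e : (c : ℂ)⁻¹ * relaxFactor c τ = -Complex.I * (τ : ℂ)⁻¹ * (1 - relaxFactor c τ) := by
    field_simp
    linear_combination relaxFactor_identity hc τ
  rw [e, defect, h]
  module

theorem bijective_sub_smul_hypL {τ : ℝ} (hτ : 0 < τ) (c : ℝ) :
    Function.Bijective fun Q => Q - c • hypL τ Q := by
  by_cases hc : c = 0
  · simp only [hc, zero_smul, sub_zero]
    exact Function.bijective_id
  refine (Function.bijective_iff_existsUnique _).2 fun R => ?_
  simp only [sub_smul_hypL_eq_iff hc hτ]
  have hbij := bijective_sub_smul_D_D (re_relaxFactor (c := c) hτ)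
  obtain ⟨a, ha⟩ := hbij.2 (R.1 - ((τ : ℂ) * relaxFactor c τ) • D R.2)
  refine ⟨(a, R.2 + relaxFactor c τ • (D a - R.2)), ⟨ha, rfl⟩, ?_⟩
  rintro Q ⟨h1, h2⟩
  have h3 : Q.1 = a := hbij.1 (h1.trans ha.symm)
  exact Prod.ext h3 (by rw [h2, h3])

end HInf

/-! ### Asymptotic preservation -/

namespace HInf

theorem _root_.TameBigO.D {Ω : Type*} {l : Filter Ω} {κ : ℝ} {a : Ω → HInf} {φ : Ω → ℝ}
    (ha : TameBigO (nls κ).N l a φ) : TameBigO (nls κ).N l (fun z => D (a z)) φ := fun k => by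
  refine (Asymptotics.IsBigO.of_bound 1 (Eventually.of_forall fun z => ?_)).trans (ha (k + 1))
  rw [one_mul, Real.norm_of_nonneg (apply_nonneg _ _), Real.norm_of_nonneg (apply_nonneg _ _)]
  exact p_D_le k (a z)

theorem _root_.TameBigO.complex_smul {Ω : Type*} {l : Filter Ω} {κ : ℝ} {a : Ω → HInf}
    {φ ψ : Ω → ℝ} {c : Ω → ℂ} (hc : c =O[l] ψ) (ha : TameBigO (nls κ).N l a φ) :
    TameBigO (nls κ).N l (fun z => c z • a z) (fun z => ψ z * φ z) := fun k => by
  refine (hc.norm_left.mul (ha k)).congr_left fun z => ?_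
  exact (map_smul_eq_mul (p k) (c z) (a z)).symm

theorem _root_.TameBigO.const_complex_smul {Ω : Type*} {l : Filter Ω} {κ : ℝ} {a : Ω → HInf}
    {φ : Ω → ℝ} (c : ℂ) (ha : TameBigO (nls κ).N l a φ) :
    TameBigO (nls κ).N l (fun z => c • a z) φ := by
  simpa only [one_mul] using ha.complex_smul (Asymptotics.isBigO_const_const c one_ne_zero l)

theorem tameBigO_const {Ω : Type*} (l : Filter Ω) (κ : ℝ) (v : HInf) :
    TameBigO (nls κ).N l (fun _ => v) fun _ => 1 := fun _ =>
  Asymptotics.isBigO_const_const _ one_ne_zero l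

theorem isBigO_id_one : (fun τ : ℝ => τ) =O[𝓝[>] 0] fun _ => (1 : ℝ) :=
  (tendsto_id.mono_right nhdsWithin_le_nhds : Tendsto (fun τ : ℝ => τ) (𝓝[>] 0) (𝓝 0)).isBigO_one ℝ

theorem isBigO_ofReal {l : Filter ℝ} : (fun τ : ℝ => (τ : ℂ)) =O[l] fun τ => τ :=
  Asymptotics.IsBigO.of_bound 1 (Eventually.of_forall fun τ => by simp)

theorem sobolevNorm_nonneg (k : ℕ) (f : ℝ → ℂ) : 0 ≤ sobolevNorm k f := Real.sqrt_nonneg _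

/-- As `τ → 0`, the states `Q τ` tend to `(v, ∂ₓ v)` with rate `τ`, and with bounded defect. -/
def IsRelaxed (κ : ℝ) (Q : ℝ → HInf × HInf) (v : HInf) : Prop :=
  TameBigO (nls κ).N (𝓝[>] 0) (fun τ => (Q τ).1 - v) (fun τ => τ) ∧
    TameBigO (nls κ).N (𝓝[>] 0) (fun τ => defect τ (Q τ)) fun _ => 1

namespace IsRelaxed

variable {κ : ℝ} {Q : ℝ → HInf × HInf} {v : HInf}

theorem fst_isBigO (hQ : IsRelaxed κ Q v) :
    TameBigO (nls κ).N (𝓝[>] 0) (fun τ => (Q τ).1) fun _ => 1 := by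
  simpa only [sub_add_cancel] using (hQ.1.trans isBigO_id_one).add (tameBigO_const _ κ v)

theorem snd_sub (hQ : IsRelaxed κ Q v) :
    TameBigO (nls κ).N (𝓝[>] 0) (fun τ => (Q τ).2 - D v) fun τ => τ := by
  have h1 : TameBigO (nls κ).N (𝓝[>] 0) (fun τ : ℝ => (Complex.I * (τ : ℂ)) • defect τ (Q τ))
      fun τ => τ := by
    simpa only [mul_one] using
      hQ.2.complex_smul (isBigO_ofReal.const_mul_left Complex.I)
  refine (hQ.1.D.sub h1).congr' ?_
  filter_upwards [self_mem_nhdsWithin] with τ hτ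
  rw [map_sub, snd_eq (ne_of_gt hτ) (Q τ)]
  abel

theorem snd_isBigO (hQ : IsRelaxed κ Q v) :
    TameBigO (nls κ).N (𝓝[>] 0) (fun τ => (Q τ).2) fun _ => 1 := by
  simpa only [sub_add_cancel] using
    (hQ.snd_sub.trans isBigO_id_one).add (tameBigO_const _ κ (D v))

theorem hypL_fst_sub (hQ : IsRelaxed κ Q v) :
    TameBigO (nls κ).N (𝓝[>] 0) (fun τ => (hypL τ (Q τ)).1 - (nls κ).g v) fun τ => τ := by
  refine (hQ.snd_sub.D.const_complex_smul Complex.I).congr' (Eventually.of_forall fun τ => ?_)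
  change Complex.I • D ((Q τ).2 - D v) = Complex.I • D (Q τ).2 - Complex.I • D (D v)
  rw [map_sub, smul_sub]

theorem f_sub (hQ : IsRelaxed κ Q v) :
    TameBigO (nls κ).N (𝓝[>] 0) (fun τ => (nls κ).f (Q τ).1 - (nls κ).f v) fun τ => τ :=
  (nls κ).tameBigO_f_sub hQ.1 hQ.fst_isBigO (tameBigO_const _ κ v)

/-- Passage through an implicit equation. -/
theorem of_sub_smul_hypL {c : ℝ} (hc : c ≠ 0) {R : ℝ → HInf × HInf} {r : HInf}
    (hQR : ∀ τ > 0, Q τ - c • hypL τ (Q τ) = R τ) (hvr : v - c • (nls κ).g v = r)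
    (h1 : TameBigO (nls κ).N (𝓝[>] 0) (fun τ => (R τ).1 - r) fun τ => τ)
    (h2 : TameBigO (nls κ).N (𝓝[>] 0) (fun τ => (R τ).2) fun _ => 1) : IsRelaxed κ Q v := by
  have hl : (fun τ => relaxFactor c τ) =O[𝓝[>] 0] fun _ => (1 : ℝ) :=
    Asymptotics.IsBigO.of_bound 1 (Eventually.of_forall fun τ => by
      simpa using norm_relaxFactor_le hc τ)
  -- The right-hand side of the equation for `q₀ - v`. Since `c i λ = c i + τ λ` for the factor `λ =
  -- c / (c + i τ)`, replacing the multiplier of the limit equation costs only the term with `D (D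
  -- v)`.
  have hrhs : TameBigO (nls κ).N (𝓝[>] 0) (fun τ => ((R τ).1 - r) -
      ((τ : ℂ) * relaxFactor c τ) • (D (R τ).2 - D (D v))) fun τ => τ := by
    refine h1.sub ?_
    simpa only [mul_one] using
      (h2.D.sub (tameBigO_const _ κ (D (D v)))).complex_smul (isBigO_ofReal.mul hl)
  have hfst : TameBigO (nls κ).N (𝓝[>] 0) (fun τ => (Q τ).1 - v) fun τ => τ := by
    intro k
    refine (Asymptotics.IsBigO.of_bound 1 ?_).trans (hrhs k)
    filter_upwards [self_mem_nhdsWithin] with τ hτ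
    rw [one_mul, Real.norm_of_nonneg (apply_nonneg _ _), Real.norm_of_nonneg (apply_nonneg _ _)]
    refine (p_le_p_sub_smul_D_D (re_relaxFactor (c := c) hτ) k _).trans (le_of_eq ?_)
    change p k _ = p k _
    congr 1
    have e1 := ((sub_smul_hypL_eq_iff hc hτ _ _).1 (hQR τ hτ)).1
    have e2 : v - ((c : ℂ) * Complex.I) • D (D v) = r := by
      rw [← hvr, mul_smul]
      rfl
    have e3 := relaxFactor_identity hc τ
    have e4 : (c : ℂ) * Complex.I * relaxFactor c τ = c * Complex.I + τ * relaxFactor c τ := by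
      linear_combination -e3
    rw [← e2, map_sub, map_sub, smul_sub, smul_sub]
    rw [← sub_eq_zero] at e1 ⊢
    rw [← e1, e4]
    module
  refine ⟨hfst, ?_⟩
  have hQ1 : TameBigO (nls κ).N (𝓝[>] 0) (fun τ => (Q τ).1) fun _ => 1 := by
    simpa only [sub_add_cancel] using (hfst.trans isBigO_id_one).add (tameBigO_const _ κ v)
  have h3 : TameBigO (nls κ).N (𝓝[>] 0)
      (fun τ => ((c : ℂ)⁻¹ * relaxFactor c τ) • (D (Q τ).1 - (R τ).2)) fun _ => 1 := by
    simpa only [mul_one] using (hQ1.D.sub h2).complex_smul (hl.const_mul_left (c : ℂ)⁻¹)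
  refine h3.congr' ?_
  filter_upwards [self_mem_nhdsWithin] with τ hτ
  exact (defect_eq hc hτ ((sub_smul_hypL_eq_iff hc hτ _ _).1 (hQR τ hτ)).2).symm

/-- The first stage is the initial state and keeps the property. A later stage has a nonzero
diagonal coefficient and passes through its implicit equation, whose second right-hand side collects
the bounded defects of the earlier stages. -/
theorem stage {m : ℕ} {M : ImExRK (m + 1)} (hM : M.IsTypeII) {h : ℝ} (hh : h ≠ 0)
    (hQ : IsRelaxed κ Q v) {S : ℝ → Fin (m + 1) → HInf × HInf} {Sv : Fin (m + 1) → HInf}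
    (hS : ∀ τ > 0, ∀ i, S τ i = Q τ + h • (∑ j, M.Aex i j • hypF κ (S τ j) +
      ∑ j, M.Aim i j • hypL τ (S τ j)))
    (hSv : IsStages M κ h v Sv) (i : Fin (m + 1)) : IsRelaxed κ (fun τ => S τ i) (Sv i) := by
  induction i using WellFoundedLT.induction with
  | _ i ih =>
  by_cases hi : i = 0
  · have e1 : Sv i = v := by rw [hSv i, hi]; simp [hM.1, hM.2.1]
    have e2 : ∀ τ > 0, S τ i = Q τ := fun τ hτ => by rw [hS τ hτ i, hi]; simp [hM.1, hM.2.1]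
    rw [e1]
    refine ⟨hQ.1.congr' ?_, hQ.2.congr' ?_⟩ <;>
    filter_upwards [self_mem_nhdsWithin] with τ hτ <;> rw [e2 τ hτ]
  have hsum : ∀ {a : Fin (m + 1) → ℝ → HInf} {φ : ℝ → ℝ} (B : Matrix (Fin (m + 1)) (Fin (m + 1)) ℝ),
      (∀ j < i, TameBigO (nls κ).N (𝓝[>] 0) (a j) φ) → TameBigO (nls κ).N (𝓝[>] 0)
        (fun τ => ∑ j, (if j < i then B i j else 0) • a j τ) φ := by
    intro a φ B ha
    refine TameBigO.sum fun j _ => ?_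
    split_ifs with hj
    · exact (ha j hj).const_smul _
    · simpa only [zero_smul] using TameBigO.zero
  refine of_sub_smul_hypL (c := h * M.Aim i i) (mul_ne_zero hh (hM.Aim_diag_ne_zero hi))
    (fun τ hτ => (M.stage_iff (hypF κ) (hypL τ) h (Q τ) (S τ) i).1 (hS τ hτ i))
    ((M.stage_iff (nls κ).f (nls κ).g h v Sv i).1 (hSv i)) ?_ ?_
  · refine (hQ.1.add (((hsum M.Aex fun j hj => (ih j hj).f_sub).add
      (hsum M.Aim fun j hj => (ih j hj).hypL_fst_sub)).const_smul h)).congr'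
      (Eventually.of_forall fun τ => ?_)
    simp only [Prod.fst_add, Prod.smul_fst, Prod.fst_sum, smul_sub, Finset.sum_sub_distrib, hypF]
    module
  · refine (hQ.snd_isBigO.add ((hsum M.Aim fun j hj => (ih j hj).2).const_smul h)).congr'
      (Eventually.of_forall fun τ => ?_)
    simp only [Prod.snd_add, Prod.smul_snd, Prod.snd_sum, hypF, hypL_apply, smul_zero,
      Finset.sum_const_zero, zero_add]

end IsRelaxed

/-- Global stiff accuracy makes the update a stage, so the bounded defect survives into the next
step. -/
theorem isRelaxed_of_isNumericalSolution {m : ℕ} {M : ImExRK (m + 1)} (hM : M.IsTypeII)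
    (hGSA : M.IsGSA) {κ h : ℝ} (hh : h ≠ 0) {Q : ℝ → ℕ → HInf × HInf} {v : ℕ → HInf}
    (h0 : IsRelaxed κ (fun τ => Q τ 0) (v 0))
    (hQ : ∀ τ > 0, ∀ n, ∃ S, M.IsStep (hypF κ) (hypL τ) h (Q τ n) S (Q τ (n + 1)))
    (hv : IsSequence M κ h v) (n : ℕ) : IsRelaxed κ (fun τ => Q τ n) (v n) := by
  induction n with
  | zero => exact h0
  | succ n ih =>
    obtain ⟨Sv, hSv, hv'⟩ := hv n
    choose! S hS using fun τ (hτ : 0 < τ) => hQ τ hτ n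
    have hS' := fun τ hτ => (hGSA.isStep_iff (g := hypL τ)).1 (hS τ hτ)
    have := ih.stage hM hh (fun τ hτ => (hS' τ hτ).1) hSv (Fin.last m)
    rw [hv']
    refine ⟨this.1.congr' ?_, this.2.congr' ?_⟩ <;>
    filter_upwards [self_mem_nhdsWithin] with τ hτ <;> rw [(hS' τ hτ).2]

/-- The defect is `τ⁻¹` times `∂ₓ (q₀ - u₀) - (q₁ - ∂ₓ u₀)`; the rate `O(τ)` in the data, and not
just convergence, keeps it bounded. -/
theorem isRelaxed_of_isWellPrepared {u₀ : HInf} {Q₀ : ℝ → NLSHState}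
    (hwp : IsWellPrepared u₀.1 Q₀) (κ : ℝ) {Q : ℝ → HInf × HInf}
    (hQ : ∀ τ > 0, ((Q τ).1.1, (Q τ).2.1) = Q₀ τ) : IsRelaxed κ Q u₀ := by
  have key : ∀ {a : ℝ → HInf} {b : ℝ → ℝ → ℂ}, (∀ τ > 0, (a τ).1 = b τ) →
      (∀ k, (fun τ => sobolevNorm k (b τ)) =O[𝓝[>] 0] fun τ => τ) →
      TameBigO (nls κ).N (𝓝[>] 0) a fun τ => τ := by
    intro a b hab hb k
    refine (Asymptotics.IsBigO.of_bound ((k : ℝ) + 1) ?_).trans (hb k)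
    filter_upwards [self_mem_nhdsWithin] with τ hτ
    rw [Real.norm_of_nonneg (apply_nonneg _ _), Real.norm_of_nonneg (sobolevNorm_nonneg k _),
      ← hab τ hτ]
    exact p_le_sobolevNorm k (a τ)
  have h1 : TameBigO (nls κ).N (𝓝[>] 0) (fun τ => (Q τ).1 - u₀) fun τ => τ :=
    key (fun τ hτ => by rw [← hQ τ hτ]; rfl) fun k => (hwp.2 k).1
  have h2 : TameBigO (nls κ).N (𝓝[>] 0) (fun τ => (Q τ).2 - D u₀) fun τ => τ :=
    key (fun τ hτ => by rw [← hQ τ hτ]; rfl) fun k => (hwp.2 k).2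
  refine ⟨h1, ?_⟩
  have hinv : (fun τ : ℝ => -Complex.I * (τ : ℂ)⁻¹) =O[𝓝[>] 0] fun τ => τ⁻¹ :=
    Asymptotics.IsBigO.of_bound 1 (Eventually.of_forall fun τ => by simp)
  intro k
  refine (((h1.D.sub h2).complex_smul hinv).congr' (Eventually.of_forall fun τ => ?_) k).trans
    (Asymptotics.IsBigO.of_bound 1 ?_)
  · rw [defect, map_sub]
    congr 1
    abel
  · filter_upwards [self_mem_nhdsWithin] with τ hτ
    rw [inv_mul_cancel₀ (ne_of_gt hτ), one_mul]

end HInf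

/-! ### The methods on functions -/

namespace HInf

/-- The inclusion of `H^∞` into all functions. -/
noncomputable def incl : HInf →ₗ[ℝ] (ℝ → ℂ) := hInf.subtype.restrictScalars ℝ

theorem incl_injective : Function.Injective incl := Subtype.val_injective

theorem range_incl : Set.range incl = HInfty := Subtype.range_coe

/-- The inclusion of pairs in `H^∞` into all states. -/
noncomputable def inclProd : HInf × HInf →ₗ[ℝ] NLSHState := incl.prodMap incl

theorem inclProd_injective : Function.Injective inclProd :=
  incl_injective.prodMap incl_injective

theorem range_inclProd : Set.range inclProd = HInfty ×ˢ HInfty := by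
  rw [← range_incl]
  exact Set.range_prodMap (m₁ := incl) (m₂ := incl)

theorem nlsF_incl (κ : ℝ) (a : HInf) : nlsF κ (incl a) = incl ((nls κ).f a) := by
  funext x
  change Complex.I * κ * (‖a.1 x‖ : ℂ) ^ 2 * a.1 x =
    Complex.I * κ * (a.1 x * star (a.1 x) * a.1 x)
  rw [Complex.star_def, Complex.mul_conj, Complex.normSq_eq_norm_sq]
  push_cast
  ring

theorem nlsG_incl (κ : ℝ) (a : HInf) : nlsG (incl a) = incl ((nls κ).g a) := rfl

theorem nlshF_inclProd (κ : ℝ) (Q : HInf × HInf) :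
    nlshF κ (inclProd Q) = inclProd (hypF κ Q) :=
  Prod.ext (nlsF_incl κ Q.1) rfl

theorem nlshG_inclProd (τ : ℝ) (Q : HInf × HInf) :
    nlshG τ (inclProd Q) = inclProd (hypL τ Q) := rfl

variable {m : ℕ} {M : ImExRK (m + 1)}

theorem exists_unique_isNLSApprox (M : ImExRK (m + 1)) (κ h : ℝ) (u₀ : HInf) :
    ∃! v, IsNLSApprox M κ h (incl u₀) v := by
  unfold IsNLSApprox
  rw [← range_incl]
  exact M.exists_unique_numericalSolution incl_injective (nlsF_incl κ) (nlsG_incl κ) h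
    bijective_sub_smul_nlsL u₀

theorem exists_unique_isNLSHApprox (M : ImExRK (m + 1)) (κ h : ℝ) {τ : ℝ} (hτ : 0 < τ)
    (Q₀ : HInf × HInf) : ∃! q, IsNLSHApprox M κ τ h (inclProd Q₀) q := by
  unfold IsNLSHApprox
  rw [← range_inclProd]
  exact M.exists_unique_numericalSolution inclProd_injective (nlshF_inclProd κ)
    (nlshG_inclProd τ) h (bijective_sub_smul_hypL hτ) Q₀

theorem exists_isSequence_of_isNLSApprox (hGSA : M.IsGSA) {κ h : ℝ} {u₀ : HInf}
    {v : ℕ → ℝ → ℂ} (hv : IsNLSApprox M κ h (incl u₀) v) :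
    ∃ V : ℕ → HInf, (∀ n, incl (V n) = v n) ∧ V 0 = u₀ ∧ IsSequence M κ h V := by
  obtain ⟨h1, h2⟩ := hv
  rw [← range_incl] at h1
  obtain ⟨V, hV, hs⟩ :=
    (M.isNumericalSolution_map_iff incl_injective (nlsF_incl κ) (nlsG_incl κ) h v).1 h1
  exact ⟨V, hV, incl_injective ((hV 0).trans h2), fun n => (hs n).imp fun S hS =>
    (hGSA.isStep_iff (g := ((nls κ).g : HInf →ₗ[ℝ] HInf))).1 hS⟩

/-- The numerical solution of the hyperbolized system is close to that of the limit equation. -/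
theorem exists_isRelaxed (hM : M.IsTypeII) (hGSA : M.IsGSA) {κ h : ℝ} (hh : h ≠ 0)
    {u₀ : HInf} {Q₀ : ℝ → NLSHState} (hwp : IsWellPrepared (incl u₀) Q₀) {q : ℝ → ℕ → NLSHState}
    (hq : ∀ τ > 0, IsNLSHApprox M κ τ h (Q₀ τ) (q τ)) {V : ℕ → HInf} (hV0 : V 0 = u₀)
    (hV : IsSequence M κ h V) (n : ℕ) : ∃ Q : ℝ → HInf × HInf,
      (∀ τ > 0, inclProd (Q τ) = q τ n) ∧ IsRelaxed κ Q (V n) := by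
  have hex : ∀ τ > 0, ∃ Q : ℕ → HInf × HInf, (∀ n, inclProd (Q n) = q τ n) ∧
      ∀ n, ∃ S, M.IsStep (hypF κ) (hypL τ) h (Q n) S (Q (n + 1)) := by
    intro τ hτ
    have h1 := (hq τ hτ).1
    rw [← range_inclProd] at h1
    exact (M.isNumericalSolution_map_iff inclProd_injective (nlshF_inclProd κ)
      (nlshG_inclProd τ) h (q τ)).1 h1
  choose! Q hQ hs using hex
  refine ⟨fun τ => Q τ n, fun τ hτ => hQ τ hτ n,
    isRelaxed_of_isNumericalSolution hM hGSA hh ?_ hs hV n⟩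
  rw [hV0]
  exact isRelaxed_of_isWellPrepared hwp κ fun τ hτ => (hQ τ hτ 0).trans (hq τ hτ).2

theorem IsRelaxed.tendsto {κ : ℝ} {Q : ℝ → HInf × HInf} {v : HInf} (hQ : IsRelaxed κ Q v)
    (k : ℕ) : Tendsto (fun τ => p k ((Q τ).1 - v)) (𝓝[>] 0) (𝓝 0) ∧
      Tendsto (fun τ => p k ((Q τ).2 - D v)) (𝓝[>] 0) (𝓝 0) := by
  have h : Tendsto (fun τ : ℝ => τ) (𝓝[>] 0) (𝓝 0) := nhdsWithin_le_nhds
  exact ⟨(hQ.1 k).trans_tendsto h, (hQ.snd_sub k).trans_tendsto h⟩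

/-- The stiff limit: an error estimate for the limit equation transfers to the hyperbolized
system. -/
theorem IsRelaxed.eventually_sobolevNorm_le {κ : ℝ} {Q : ℝ → HInf × HInf} {v w : HInf}
    (hQ : IsRelaxed κ Q v) {k : ℕ} {ε C : ℝ} (hε : 0 < ε) (hv : p (k + 1) (v - w) ≤ C * ε) :
    ∀ᶠ τ in 𝓝[>] 0, sobolevNorm k ((Q τ).1.1 - w.1) ≤ (C + 1) * ε ∧
      sobolevNorm k ((Q τ).2.1 - deriv w.1) ≤ (C + 1) * ε := by
  -- For small `τ` the relaxation error is below `ε`, whence `C + 1`. The estimate of `v - w` is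
  -- needed at level `k + 1` because `q₁` is compared with a derivative.
  filter_upwards [(hQ.tendsto k).1.eventually_le_const hε,
    (hQ.tendsto k).2.eventually_le_const hε] with τ h1 h2
  constructor
  · have h3 : p k ((Q τ).1 - w) ≤ p k ((Q τ).1 - v) + p k (v - w) := by
      simpa using map_add_le_add (p k) ((Q τ).1 - v) (v - w)
    have h4 := p_mono k.le_succ (v - w)
    have h5 : sobolevNorm k ((Q τ).1.1 - w.1) ≤ p k ((Q τ).1 - w) :=
      sobolevNorm_le_p k ((Q τ).1 - w)
    rw [Nat.succ_eq_add_one] at h4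
    linarith
  · have h3 : p k ((Q τ).2 - D w) ≤ p k ((Q τ).2 - D v) + p k (D (v - w)) := by
      rw [map_sub D]
      simpa using map_add_le_add (p k) ((Q τ).2 - D v) (D v - D w)
    have h4 := p_D_le k (v - w)
    have h5 : sobolevNorm k ((Q τ).2.1 - deriv w.1) ≤ p k ((Q τ).2 - D w) :=
      sobolevNorm_le_p k ((Q τ).2 - D w)
    linarith

end HInf

theorem mainTheorem6 {m : ℕ} (M : ImExRK (m + 1)) (hII : M.IsTypeII) (hGSA : M.IsGSA)
    {p : ℕ} (hp : 1 ≤ p) (hord : M.HasOrder p) (κ : ℝ)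
    (u₀ : ℝ → ℂ) (hu₀ : u₀ ∈ HInfty) (Q₀ : ℝ → NLSHState) (hwp : IsWellPrepared u₀ Q₀) :
    -- the numerical solutions of both problems exist and are unique
    (∀ h > 0, (∃! v, IsNLSApprox M κ h u₀ v) ∧
      ∀ τ > 0, ∃! q, IsNLSHApprox M κ τ h (Q₀ τ) q) ∧
    ∀ q : ℝ → ℝ → ℕ → NLSHState,
      (∀ h > 0, ∀ τ > 0, IsNLSHApprox M κ τ h (Q₀ τ) (q h τ)) →
      -- asymptotic preservation for both components
      IsAPq₀ M κ u₀ q ∧ IsAPq₁ M κ u₀ q ∧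
      -- error estimates in the stiff limit
      ∀ T > 0, ∀ u : ℝ → ℝ → ℂ, IsNLSSolution κ T u → u 0 = u₀ →
        -- after any fixed number of steps
        (∀ n k : ℕ, ∃ C : ℝ, ∀ᶠ h in 𝓝[>] (0 : ℝ), ∀ᶠ τ in 𝓝[>] (0 : ℝ),
          sobolevNorm k ((q h τ n).1 - u (n * h)) ≤ C * h ^ (p + 1) ∧
          sobolevNorm k ((q h τ n).2 - deriv (u (n * h))) ≤ C * h ^ (p + 1)) ∧
        -- uniformly on the time interval, if the limiting scheme is (linearly) stable
        ((∀ y : ℝ, ‖M.stabilityFunction (Complex.I * y)‖ ≤ 1) →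
          ∀ k : ℕ, ∃ C : ℝ, ∀ᶠ h in 𝓝[>] (0 : ℝ), ∀ n : ℕ, n * h ≤ T →
            ∀ᶠ τ in 𝓝[>] (0 : ℝ),
              sobolevNorm k ((q h τ n).1 - u (n * h)) ≤ C * h ^ p ∧
              sobolevNorm k ((q h τ n).2 - deriv (u (n * h))) ≤ C * h ^ p) := by
  obtain ⟨U₀, rfl⟩ : ∃ U₀, HInf.incl U₀ = u₀ := ⟨⟨u₀, hu₀⟩, rfl⟩
  refine ⟨fun h _ => ⟨HInf.exists_unique_isNLSApprox M κ h U₀, fun τ hτ => ?_⟩, ?_⟩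
  · obtain ⟨R, hR⟩ : Q₀ τ ∈ Set.range HInf.inclProd := by
      rw [HInf.range_inclProd]
      exact hwp.1 τ hτ
    rw [← hR]
    exact HInf.exists_unique_isNLSHApprox M κ h hτ R
  intro q hq
  have hAP : ∀ h > 0, ∀ V : ℕ → HInf, V 0 = U₀ → HInf.IsSequence M κ h V → ∀ n,
      ∃ Q : ℝ → HInf × HInf, (∀ τ > 0, HInf.inclProd (Q τ) = q h τ n) ∧
        HInf.IsRelaxed κ Q (V n) := fun h hh V hV0 hV n =>
    HInf.exists_isRelaxed hII hGSA (ne_of_gt hh) hwp (hq h hh) hV0 hV n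
  refine ⟨?_, ?_, ?_⟩
  · intro h hh v hv n k
    obtain ⟨V, hVv, hV0, hV⟩ := HInf.exists_isSequence_of_isNLSApprox hGSA hv
    obtain ⟨Q, hQ, hR⟩ := hAP h hh V hV0 hV n
    refine squeeze_zero' (Eventually.of_forall fun _ => HInf.sobolevNorm_nonneg _ _) ?_
      (hR.tendsto k).1
    filter_upwards [self_mem_nhdsWithin] with τ hτ
    rw [← hQ τ hτ, ← hVv n]
    exact HInf.sobolevNorm_le_p k ((Q τ).1 - V n)
  · intro h hh v hv n k
    obtain ⟨V, hVv, hV0, hV⟩ := HInf.exists_isSequence_of_isNLSApprox hGSA hv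
    obtain ⟨Q, hQ, hR⟩ := hAP h hh V hV0 hV n
    refine squeeze_zero' (Eventually.of_forall fun _ => HInf.sobolevNorm_nonneg _ _) ?_
      (hR.tendsto k).2
    filter_upwards [self_mem_nhdsWithin] with τ hτ
    rw [← hQ τ hτ, ← hVv n]
    exact HInf.sobolevNorm_le_p k ((Q τ).2 - HInf.D (V n))
  intro T hT u hu hu0
  obtain ⟨w, hwu, hw⟩ := HInf.exists_isSolution hu
  have hw0 : w 0 = U₀ := Subtype.ext ((hwu 0 ⟨le_rfl, hT.le⟩).trans hu0)
  -- The exponent `r` will be `p + 1` for a fixed number of steps and `p` on the whole interval. How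
  -- small `τ` must be may depend on `h` and `n`, but the constant does not.
  have hlim : ∀ h > 0, ∀ V : ℕ → HInf, V 0 = w 0 → HInf.IsSequence M κ h V → ∀ n : ℕ, n * h ≤ T →
      ∀ (k r : ℕ) (C : ℝ), HInf.p (k + 1) (V n - w (n * h)) ≤ C * h ^ r →
        ∀ᶠ τ in 𝓝[>] (0 : ℝ), sobolevNorm k ((q h τ n).1 - u (n * h)) ≤ (C + 1) * h ^ r ∧
          sobolevNorm k ((q h τ n).2 - deriv (u (n * h))) ≤ (C + 1) * h ^ r := by
    intro h hh V hV0 hV n hn k r C hC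
    obtain ⟨Q, hQ, hR⟩ := hAP h hh V (hV0.trans hw0) hV n
    filter_upwards [hR.eventually_sobolevNorm_le (pow_pos hh r) hC, self_mem_nhdsWithin]
      with τ h1 hτ
    rw [← hQ τ hτ, ← hwu _ ⟨mul_nonneg n.cast_nonneg hh.le, hn⟩]
    exact h1
  have hVex : ∀ h, ∃ V : ℕ → HInf, V 0 = w 0 ∧ HInf.IsSequence M κ h V := fun h => by
    obtain ⟨v, hv, _⟩ := HInf.exists_unique_isNLSApprox M κ h (w 0)
    obtain ⟨V, _, hV0, hV⟩ := HInf.exists_isSequence_of_isNLSApprox hGSA hv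
    exact ⟨V, hV0, hV⟩
  choose V hV0 hV using hVex
  constructor
  · intro n k
    obtain ⟨C, _, hC⟩ := HInf.exists_p_error_le_of_fixed hII hGSA hord hT hw k n
    refine ⟨C + 1, ?_⟩
    have hsmall : ∀ᶠ h in 𝓝[>] (0 : ℝ), n * h ≤ T := by
      have : Tendsto (fun h : ℝ => n * h) (𝓝[>] 0) (𝓝 0) := by
        simpa using ((continuous_const_mul (n : ℝ)).tendsto 0).mono_left nhdsWithin_le_nhds
      exact this.eventually_le_const hT
    filter_upwards [hC, hsmall, self_mem_nhdsWithin] with h h1 h2 hh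
    exact hlim h hh (V h) (hV0 h) (hV h) n h2 k (p + 1) C (h1 _ (hV0 h) (hV h))
  · intro hstab k
    obtain ⟨C, _, hC⟩ := HInf.exists_p_error_le_of_stable hII hGSA (by omega) hord hstab hT hw k
    refine ⟨C + 1, ?_⟩
    filter_upwards [hC, self_mem_nhdsWithin] with h h1 hh n hn
    exact hlim h hh (V h) (hV0 h) (hV h) n hn k p C (h1 _ (hV0 h) (hV h) n hn)
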